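/- **Theorem (Variant of Shah et al.).** Let $n\ge 2$ and let $\mathcal Q$ be a probability distribution on the unordered pairs of distinct elements of $[n]$; write $\mathcal Q(x,y)=\mathcal Q(y,x)$ for the probability of $\{x,y\}$, and let $\mathcal E$ be the support of $\mathcal Q$. Assume that the graph $([n],\mathcal E)$ is connected. Let $Q$ be the Laplacian of $\mathcal Q$: $Q_{xy}=-\mathcal Q(x,y)$ for $x\ne y$ and $Q\mathbf 1=0$. For $\phi>1$ put $$\Omega_\phi=\Big\{w\in\mathbb R^n:\ \langle \mathbf 1,w\rangle=0,\ |w_x-w_y|\le\log\phi\ \text{ for all }\{x,y\}\in\mathcal E\Big\}.$$ For $z\in\Omega_\phi$ the oracle $\mathrm{Ex}(\mathcal Q;z)$ returns $((x,y),q)$, where $\{x,y\}$ is drawn from $\mathcal Q$ (and written as an ordered pair with $x<y$) and, given the pair, $q=1$ with probability $e^{z_x}/(e^{z_x}+e^{z_y})$ and $q=0$ otherwise. For $N$ independent examples $s=((x_i,y_i),q_i)_{i\le N}$ let $$L=\frac1N\sum_{i=1}^N(e_{x_i}-e_{y_i})(e_{x_i}-e_{y_i})^{T},\qquad L_N(w)=-\frac1N\sum_{i=1}^N\Big(\mathbf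 1\{q_i=1\}w_{x_i}+\mathbf 1\{q_i=0\}w_{y_i}-\log(e^{w_{x_i}}+e^{w_{y_i}})\Big)$$ be the empirical Laplacian (so $\mathbb E[L]=Q$) and the empirical negative log-likelihood, and let $\lambda(\cdot)$ denote the second smallest eigenvalue. A constrained maximum likelihood estimate (MLE) is a minimizer of $L_N$ over $\Omega_\phi$. There is a single program of a real-number random access machine (unit-cost $+,-,\times,/,\exp,\log$ and comparison of reals, rational constants, and unit-cost addition, truncated subtraction and comparison of natural numbers, which serve as addresses and counters) such that for every $\phi>1$ there are a constant $C>0$ and a polynomial $T$, depending only on $\phi$, with the following properties for all $n$ and $\mathcal Q$ as above. 1. For every $N\ge n-1$ and every sample $s$ of size $N$ with compared pairs in $\mathcal E$, a constrained MLE exists, and on input $(n,N,s,\mathcal E,\phi)$ the program halts within $T(N)$ steps with an output $\widehat z\in\Omega_\phi$ such that $L_N(\widehat z)\le\min_{\Omega_\phi}L_N+1/N$. 2. Let $z\in\Omega_\phi$, $\epsilon>0$ and $0<\delta\le 1/2$, and let $N$ independent examples be drawn from $\mathrm{Ex}(\mathcal Q;z)$. Call the sample good if every constrained MLE $\widehat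 z$ satisfies $\|z-\widehat z\|_2\le\epsilon$, and the program halts within $T(N)$ steps with an output $\widehat z$ that satisfies $\|z-\widehat z\|_2\le\epsilon$ as well. * For every sequence of $N$ pairs in $\mathcal E$ whose empirical Laplacian $L$ satisfies $\lambda(L)>0$ and $$N\ \ge\ C\,\frac{n}{\lambda(L)\,\epsilon^2}\,\log\frac1\delta ,$$ the sample is good with conditional probability at least $1-\delta$, given that this is the sequence of compared pairs. * If $\epsilon\le1$ and $N\ge C\,\frac{n}{\lambda(Q)\,\epsilon^2}\log\frac1\delta$, then the sample is good with probability at least $1-\delta$. -/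

import Mathlib

open MeasureTheory

noncomputable section

namespace BTL

/-! ### Pair distributions, comparison graphs and Laplacians -/

/-- Unordered pairs `{x, y}` of distinct items among `n`, each listed once, as `(x, y)` with
`x < y`. -/
abbrev Pair (n : ℕ) : Type := {p : Fin n × Fin n // p.1 < p.2}

/-- The probability `Q(x, y) = Q(y, x)` that the unordered pair `{x, y}` is drawn
(and `0` if `x = y`). -/
def pairProb {n : ℕ} (Q : PMF (Pair n)) (x y : Fin n) : ℝ :=
  if h : x < y then (Q ⟨(x, y), h⟩).toReal
  else if h : y < x then (Q ⟨(y, x), h⟩).toReal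
  else 0

lemma pairProb_comm {n : ℕ} (Q : PMF (Pair n)) (x y : Fin n) :
    pairProb Q x y = pairProb Q y x := by
  unfold pairProb
  by_cases h : x < y
  · simp [h, h.not_gt]
  · simp [h]

/-- The graph of the support of `Q`. -/
def comparisonGraph {n : ℕ} (Q : PMF (Pair n)) : SimpleGraph (Fin n) where
  Adj x y := 0 < pairProb Q x y
  symm := ⟨fun x y h => by rw [pairProb_comm]; exact h⟩
  loopless := ⟨fun x h => by simp [pairProb] at h⟩

/-- The Laplacian of `Q`: off-diagonal entries `-Q(x, y)`, rows summing to `0`. -/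
def laplacian {n : ℕ} (Q : PMF (Pair n)) : Matrix (Fin n) (Fin n) ℝ :=
  Matrix.of fun x y => if x = y then ∑ w, pairProb Q x w else - pairProb Q x y

/-- The measurement vector `e_x - e_y` of the pair `{x, y}`. -/
def pairVec {n : ℕ} (p : Pair n) : Fin n → ℝ :=
  Pi.single p.1.1 1 - Pi.single p.1.2 1

/-- The empirical Laplacian `(1/N) ∑ i, v_i v_iᵀ` of the compared pairs. -/
def empiricalLaplacian {n N : ℕ} (e : Fin N → Pair n) : Matrix (Fin n) (Fin n) ℝ :=
  (1 / (N : ℝ)) • ∑ i, Matrix.vecMulVec (pairVec (e i)) (pairVec (e i))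

lemma laplacian_isHermitian {n : ℕ} (Q : PMF (Pair n)) : (laplacian Q).IsHermitian := by
  ext x y
  by_cases h : x = y
  · subst h; simp [laplacian]
  · simp [laplacian, h, Ne.symm h, pairProb_comm Q y x]

lemma empiricalLaplacian_isHermitian {n N : ℕ} (e : Fin N → Pair n) :
    (empiricalLaplacian e).IsHermitian := by
  ext x y
  simp [empiricalLaplacian, Matrix.sum_apply, Matrix.vecMulVec_apply, mul_comm]

/-- The second smallest eigenvalue (with multiplicity) of a symmetric `n × n` matrix, `2 ≤ n`;
`eigenvalues₀` lists the eigenvalues in decreasing order. -/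
def fiedler {n : ℕ} (hn : 2 ≤ n) {A : Matrix (Fin n) (Fin n) ℝ} (hA : A.IsHermitian) : ℝ :=
  hA.eigenvalues₀ ⟨n - 2, by rw [Fintype.card_fin]; omega⟩

/-! ### The comparison oracle and the constrained maximum likelihood estimator -/

/-- Probability that `x` beats `y` when the parameters are `z`. -/
def winProb {n : ℕ} (z : EuclideanSpace ℝ (Fin n)) (x y : Fin n) : ℝ :=
  Real.exp (z x) / (Real.exp (z x) + Real.exp (z y))

lemma winProb_nonneg {n : ℕ} (z : EuclideanSpace ℝ (Fin n)) (x y : Fin n) :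
    0 ≤ winProb z x y := by
  unfold winProb; positivity

lemma winProb_add {n : ℕ} (z : EuclideanSpace ℝ (Fin n)) (x y : Fin n) :
    winProb z x y + winProb z y x = 1 := by
  unfold winProb
  have hx := Real.exp_pos (z x)
  have hy := Real.exp_pos (z y)
  field_simp
  ring

/-- The law of the comparison bit: `true` if `x` beats `y`, `false` if `y` beats `x`. -/
def bitLaw {n : ℕ} (z : EuclideanSpace ℝ (Fin n)) (x y : Fin n) : PMF Bool :=
  PMF.ofFintype (fun q => ENNReal.ofReal (if q then winProb z x y else winProb z y x)) (by
    rw [Fintype.sum_bool]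
    simp only [if_true, Bool.false_eq_true, if_false]
    rw [← ENNReal.ofReal_add (winProb_nonneg z x y) (winProb_nonneg z y x), winProb_add,
      ENNReal.ofReal_one])

/-- One example `((x, y), q)`: the compared pair and the bit telling whether `x` won. -/
abbrev Example (n : ℕ) : Type := Pair n × Bool

/-- The law of one call of the oracle `Ex(Q; z)`. -/
def exampleLaw {n : ℕ} (Q : PMF (Pair n)) (z : EuclideanSpace ℝ (Fin n)) : PMF (Example n) :=
  Q.bind fun p => (bitLaw z p.1.1 p.1.2).map fun q => (p, q)

/-- The law of `N` independent calls of the oracle `Ex(Q; z)`. -/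
def sampleLaw {n : ℕ} (Q : PMF (Pair n)) (z : EuclideanSpace ℝ (Fin n)) (N : ℕ) :
    Measure (Fin N → Example n) :=
  Measure.pi fun _ => (exampleLaw Q z).toMeasure

/-- The empirical negative log-likelihood. -/
def negLogLik {n N : ℕ} (s : Fin N → Example n) (w : EuclideanSpace ℝ (Fin n)) : ℝ :=
  -(1 / (N : ℝ)) * ∑ i, ((if (s i).2 then w (s i).1.1.1 else w (s i).1.1.2)
    - Real.log (Real.exp (w (s i).1.1.1) + Real.exp (w (s i).1.1.2)))

/-- The constraint set `Ω_φ` for the comparison graph `G`. -/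
def paramSet {n : ℕ} (G : SimpleGraph (Fin n)) (φ : ℝ) : Set (EuclideanSpace ℝ (Fin n)) :=
  {w | ∑ x, w x = 0 ∧ ∀ x y, G.Adj x y → |w x - w y| ≤ Real.log φ}

/-- `w` is a constrained maximum likelihood estimate: it minimizes the empirical negative
log-likelihood over `Ω_φ`. -/
def IsConstrainedMLE {n N : ℕ} (G : SimpleGraph (Fin n)) (φ : ℝ) (s : Fin N → Example n)
    (w : EuclideanSpace ℝ (Fin n)) : Prop :=
  w ∈ paramSet G φ ∧ ∀ v ∈ paramSet G φ, negLogLik s w ≤ negLogLik s v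

/-! ### A real random access machine with a step count

The memory has cells holding natural numbers and cells holding real numbers, both addressed by a
row and a column. A program is a finite piece of text; its only constants are natural
and rational numbers. Every evaluation of an operation, of a memory access or of a constant costs one
step. Natural numbers (used for addresses and counters) can only be added, subtracted (truncated at
`0`) and compared. -/

structure Store where
  nat : ℕ → ℕ → ℕ
  real : ℕ → ℕ → ℝ

inductive NatExpr where
  | const (k : ℕ)
  | cell (r c : NatExpr)
  | plus (a b : NatExpr)
  | minus (a b : NatExpr)

inductive RealExpr where
  | const (q : ℚ)
  | cell (r c : NatExpr)
  | ofNat (a : NatExpr)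
  | plus (a b : RealExpr)
  | minus (a b : RealExpr)
  | times (a b : RealExpr)
  | divide (a b : RealExpr)
  | exp (a : RealExpr)
  | log (a : RealExpr)

inductive Test where
  | natLt (a b : NatExpr)
  | realLt (a b : RealExpr)

inductive Program where
  | skip
  | setNat (r c a : NatExpr)
  | setReal (r c : NatExpr) (a : RealExpr)
  | seq (p q : Program)
  | ite (t : Test) (p q : Program)
  | loop (t : Test) (p : Program)

def NatExpr.eval (σ : Store) : NatExpr → ℕ
  | const k => k
  | cell r c => σ.nat (r.eval σ) (c.eval σ)
  | plus a b => a.eval σ + b.eval σ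
  | minus a b => a.eval σ - b.eval σ

def NatExpr.cost : NatExpr → ℕ
  | const _ => 1
  | cell r c => r.cost + c.cost + 1
  | plus a b => a.cost + b.cost + 1
  | minus a b => a.cost + b.cost + 1

def RealExpr.eval (σ : Store) : RealExpr → ℝ
  | const q => (q : ℝ)
  | cell r c => σ.real (r.eval σ) (c.eval σ)
  | ofNat a => (a.eval σ : ℝ)
  | plus a b => a.eval σ + b.eval σ
  | minus a b => a.eval σ - b.eval σ
  | times a b => a.eval σ * b.eval σ
  | divide a b => a.eval σ / b.eval σ
  | exp a => Real.exp (a.eval σ)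
  | log a => Real.log (a.eval σ)

def RealExpr.cost : RealExpr → ℕ
  | const _ => 1
  | cell r c => r.cost + c.cost + 1
  | ofNat a => a.cost + 1
  | plus a b => a.cost + b.cost + 1
  | minus a b => a.cost + b.cost + 1
  | times a b => a.cost + b.cost + 1
  | divide a b => a.cost + b.cost + 1
  | exp a => a.cost + 1
  | log a => a.cost + 1

def Test.Holds (σ : Store) : Test → Prop
  | natLt a b => a.eval σ < b.eval σ
  | realLt a b => a.eval σ < b.eval σ

def Test.cost : Test → ℕ
  | natLt a b => a.cost + b.cost + 1
  | realLt a b => a.cost + b.cost + 1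

def Store.setNat (σ : Store) (r c v : ℕ) : Store :=
  { σ with nat := fun r' c' => if r' = r ∧ c' = c then v else σ.nat r' c' }

def Store.setReal (σ : Store) (r c : ℕ) (v : ℝ) : Store :=
  { σ with real := fun r' c' => if r' = r ∧ c' = c then v else σ.real r' c' }

/-- `Runs p σ k τ`: started on the store `σ`, the program `p` halts after exactly `k` steps with
the store `τ`. -/
inductive Runs : Program → Store → ℕ → Store → Prop
  | skip (σ : Store) : Runs .skip σ 1 σ
  | setNat (σ : Store) (r c a : NatExpr) :
      Runs (.setNat r c a) σ (r.cost + c.cost + a.cost + 1)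
        (σ.setNat (r.eval σ) (c.eval σ) (a.eval σ))
  | setReal (σ : Store) (r c : NatExpr) (a : RealExpr) :
      Runs (.setReal r c a) σ (r.cost + c.cost + a.cost + 1)
        (σ.setReal (r.eval σ) (c.eval σ) (a.eval σ))
  | seq {p q : Program} {σ τ υ : Store} {k l : ℕ} :
      Runs p σ k τ → Runs q τ l υ → Runs (.seq p q) σ (k + l) υ
  | iteTrue {t : Test} {p q : Program} {σ τ : Store} {k : ℕ} :
      t.Holds σ → Runs p σ k τ → Runs (.ite t p q) σ (t.cost + k) τ
  | iteFalse {t : Test} {p q : Program} {σ τ : Store} {k : ℕ} :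
      ¬ t.Holds σ → Runs q σ k τ → Runs (.ite t p q) σ (t.cost + k) τ
  | loopStep {t : Test} {p : Program} {σ τ υ : Store} {k l : ℕ} :
      t.Holds σ → Runs p σ k τ → Runs (.loop t p) τ l υ →
        Runs (.loop t p) σ (t.cost + k + l) υ
  | loopDone {t : Test} {p : Program} {σ : Store} :
      ¬ t.Holds σ → Runs (.loop t p) σ t.cost σ

open Classical in
/-- The input store: natural cells hold `n` and `N` (row `0`), the items `x_i` (row `1`),
the items `y_i` (row `2`) and the bits `q_i` (row `3`) of the examples, and the adjacency matrix of the
comparison graph (rows `4, …, n + 3`); the real cell `(0, 0)` holds `φ`; all other cells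
hold `0`. -/
def inputStore {n N : ℕ} (G : SimpleGraph (Fin n)) (φ : ℝ) (s : Fin N → Example n) : Store where
  nat r c := match r with
    | 0 => if c = 0 then n else if c = 1 then N else 0
    | 1 => if h : c < N then ((s ⟨c, h⟩).1.1.1 : ℕ) else 0
    | 2 => if h : c < N then ((s ⟨c, h⟩).1.1.2 : ℕ) else 0
    | 3 => if h : c < N then (if (s ⟨c, h⟩).2 then 1 else 0) else 0
    | x + 4 => if h : x < n ∧ c < n then (if G.Adj ⟨x, h.1⟩ ⟨c, h.2⟩ then 1 else 0) else 0
  real r c := if r = 0 ∧ c = 0 then φ else 0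

/-- Started on the store `σ`, the program halts within `t` steps and leaves the vector `w` in row
`1` of the real memory. -/
def OutputsWithin {n : ℕ} (p : Program) (σ : Store) (t : ℕ) (w : EuclideanSpace ℝ (Fin n)) :
    Prop :=
  ∃ k τ, Runs p σ k τ ∧ k ≤ t ∧ ∀ x : Fin n, τ.real 1 x = w x

/-- The sample `s` is good for the target `z`: every exact constrained maximum likelihood estimate
and also the vector that the program `p` computes within `t` steps are `ε`-close to `z`. -/
def GoodSample {n N : ℕ} (p : Program) (t : ℕ) (G : SimpleGraph (Fin n)) (φ : ℝ)
    (z : EuclideanSpace ℝ (Fin n)) (ε : ℝ) (s : Fin N → Example n) : Prop :=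
  (∀ w, IsConstrainedMLE G φ s w → ‖z - w‖ ≤ ε) ∧
    ∃ w, OutputsWithin p (inputStore G φ s) t w ∧ ‖z - w‖ ≤ ε

end BTL

end

/-! Computation. Write `η = 1/(2N)`. The program runs a switching subgradient method on `N` times
the likelihood, starting at 0. A pass sweeps over the constraints relaxed to `log φ + η`; a violated
one is repaired by moving its two coordinates towards each other by `η/2`. If nothing is violated,
the point competes for the best value so far and a gradient step of length `η/(2N)` is made. Against
any fixed `u` in `Ω_φ`, a repair lowers the squared distance to `u` by at least `η²/2`, and so does
a gradient step from a point whose loss exceeds that of `u` by more than `Nη` (`dist2_repair`,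
`dist2_descend`). Initially the squared distance is at most `n³ (log φ)²`, so after polynomially
many passes the best point is `η`-optimal. Scaling it back into `Ω_φ` costs another `η`, because the
logistic loss is 1-Lipschitz.

Error for given pairs. On `Ω_φ` the logistic loss has curvature at least `1/(4φ)` along compared
pairs, so the likelihood at `z + Δ` exceeds the one at `z` by at least `(1/(8φ)) Δᵀ L Δ` minus a
linear noise term (`negLogLik_lower`). In an eigenbasis of `L` on the sum-zero vectors this noise
has at most `n` normalized subgaussian coordinates. They are dependent, but Jensen's inequality and
a Gaussian integral bound the sum of their squares by `8 n log(1/δ)` (`tail_bound`). Hence `Δᵀ L Δ =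
O(n log(1/δ)/N)` for every point that is optimal up to `1/N`, and dividing by `λ(L)` bounds the
error of exact and computed estimates alike (`sum_bad_le`).

Random pairs. It remains to show that `λ(L) ≥ λ(Q)/8` with high probability. The sample is cut into
about `log(1/δ)` blocks of about `n/λ(Q)` or more pairs. In coordinates where `Q` is the identity, a
second-moment bound shows that a block fails with probability at most `1/16` (`measure_sparse_le`).
If fewer than half of the blocks fail, the others suffice; a union bound over sets of failing blocks
does the rest (`measure_fiedler_lt_le`). -/

noncomputable section

open scoped Matrix

namespace BTL

/-! ### The logistic loss -/

/-- The logistic loss `log (1 + e^d)`. -/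
def softplus (d : ℝ) : ℝ := Real.log (1 + Real.exp d)

/-- The derivative of the logistic loss. -/
def logistic (d : ℝ) : ℝ := Real.exp d / (1 + Real.exp d)

lemma logistic_nonneg (d : ℝ) : 0 ≤ logistic d := by unfold logistic; positivity

lemma logistic_le_one (d : ℝ) : logistic d ≤ 1 := by
  unfold logistic
  rw [div_le_one (by positivity)]
  linarith

lemma hasDerivAt_softplus (d : ℝ) : HasDerivAt softplus (logistic d) d := by
  have h : HasDerivAt (fun x => 1 + Real.exp x) (Real.exp d) d :=
    (Real.hasDerivAt_exp d).const_add 1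
  exact h.log (by positivity)

lemma hasDerivAt_logistic (d : ℝ) :
    HasDerivAt logistic (logistic d * (1 - logistic d)) d := by
  have h : HasDerivAt (fun x => 1 + Real.exp x) (Real.exp d) d :=
    (Real.hasDerivAt_exp d).const_add 1
  refine ((Real.hasDerivAt_exp d).div h (by positivity)).congr_deriv ?_
  unfold logistic
  have : 1 + Real.exp d ≠ 0 := by positivity
  field_simp

/-- After subtracting `c/2 * x^2` the second derivative is still nonnegative on `D`, so the
difference is convex there and lies above its tangent at `a`. -/
lemma softplus_quadratic_lower {D : Set ℝ} (hD : Convex ℝ D) {c : ℝ}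
    (hc : ∀ x ∈ D, c ≤ logistic x * (1 - logistic x)) {a b : ℝ} (ha : a ∈ D) (hb : b ∈ D) :
    softplus a + logistic a * (b - a) + c / 2 * (b - a) ^ 2 ≤ softplus b := by
  have hg : ∀ x, HasDerivAt (fun x => softplus x - c / 2 * x ^ 2) (logistic x - c * x) x := by
    intro x
    have := (hasDerivAt_softplus x).sub ((hasDerivAt_pow 2 x).const_mul (c / 2))
    exact this.congr_deriv (by simp; ring)
  have hg' : ∀ x, HasDerivAt (fun x => logistic x - c * x)
      (logistic x * (1 - logistic x) - c) x := by
    intro x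
    have := (hasDerivAt_logistic x).sub ((hasDerivAt_id x).const_mul c)
    exact this.congr_deriv (by simp)
  have hconv : ConvexOn ℝ D (fun x => softplus x - c / 2 * x ^ 2) :=
    convexOn_of_hasDerivWithinAt2_nonneg hD
      (fun x _ => (hg x).continuousAt.continuousWithinAt)
      (fun x _ => (hg x).hasDerivWithinAt) (fun x _ => (hg' x).hasDerivWithinAt)
      (fun x hx => sub_nonneg.2 (hc x (interior_subset hx)))
  rcases lt_trichotomy a b with h | h | h
  · have := hconv.le_slope_of_hasDerivAt ha hb h (hg a)
    rw [slope_def_field, le_div_iff₀ (by linarith)] at this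
    nlinarith
  · subst h; simp
  · have := hconv.slope_le_of_hasDerivAt hb ha h (hg a)
    rw [slope_def_field, div_le_iff₀ (by linarith)] at this
    nlinarith

lemma softplus_tangent_le (a b : ℝ) : softplus a + logistic a * (b - a) ≤ softplus b := by
  have := softplus_quadratic_lower (c := 0) convex_univ
    (fun x _ => mul_nonneg (logistic_nonneg x) (sub_nonneg.2 (logistic_le_one x)))
    (Set.mem_univ a) (Set.mem_univ b)
  linarith

/-- The slope lies between 0 and 1. This Lipschitz bound pays for the final rescaling of the
computed point. -/
lemma softplus_le_add_abs (a b : ℝ) : softplus b ≤ softplus a + |b - a| := by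
  have h := softplus_tangent_le b a
  have h1 := logistic_nonneg b
  have h2 := logistic_le_one b
  have h3 : logistic b * (b - a) ≤ |b - a| := by
    calc logistic b * (b - a) ≤ logistic b * |b - a| :=
          mul_le_mul_of_nonneg_left (le_abs_self _) h1
      _ ≤ 1 * |b - a| := mul_le_mul_of_nonneg_right h2 (abs_nonneg _)
      _ = _ := one_mul _
  nlinarith

/-- With `E = e^d` the curvature is `E / (1 + E)^2`. Since `E` and `1/E` are at most `φ`, each of
`1`, `E` and `E^2` is at most `φ E`, whence `(1 + E)^2 ≤ 4 φ E`. -/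
lemma logistic_curvature {φ : ℝ} (hφ : 1 < φ) {d : ℝ} (hd : |d| ≤ Real.log φ) :
    1 / (4 * φ) ≤ logistic d * (1 - logistic d) := by
  have h0 : 0 < φ := by linarith
  have h1 : Real.exp d ≤ φ := by
    rw [← Real.exp_log h0]; exact Real.exp_le_exp.2 ((abs_le.1 hd).2)
  have h2 : 1 ≤ φ * Real.exp d := by
    have : Real.exp (-Real.log φ) ≤ Real.exp d := Real.exp_le_exp.2 ((abs_le.1 hd).1)
    rw [Real.exp_neg, Real.exp_log h0] at this
    calc 1 = φ * φ⁻¹ := by field_simp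
      _ ≤ _ := by gcongr
  have h3 := Real.exp_pos d
  have : logistic d * (1 - logistic d) = Real.exp d / (1 + Real.exp d) ^ 2 := by
    unfold logistic
    field_simp
    ring
  rw [this, div_le_div_iff₀ (by positivity) (by positivity)]
  nlinarith

lemma softplus_strong {φ : ℝ} (hφ : 1 < φ) {a b : ℝ} (ha : |a| ≤ Real.log φ)
    (hb : |b| ≤ Real.log φ) :
    softplus a + logistic a * (b - a) + 1 / (8 * φ) * (b - a) ^ 2 ≤ softplus b := by
  have := softplus_quadratic_lower (D := Set.Icc (-Real.log φ) (Real.log φ))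
    (convex_Icc _ _) (c := 1 / (4 * φ))
    (fun x hx => logistic_curvature hφ (abs_le.2 hx)) (abs_le.1 ha) (abs_le.1 hb)
  have h8 : 1 / (4 * φ) / 2 = 1 / (8 * φ) := by
    have : φ ≠ 0 := by linarith
    field_simp; norm_num
  rwa [h8] at this

lemma log_exp_add_exp (a b : ℝ) : Real.log (Real.exp a + Real.exp b) = a + softplus (b - a) := by
  unfold softplus
  have : Real.exp a + Real.exp b = Real.exp a * (1 + Real.exp (b - a)) := by
    rw [Real.exp_sub]; field_simp
  rw [this, Real.log_mul (by positivity) (by positivity), Real.log_exp]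

/-! ### Reasoning about programs -/

/-- The program `p`, started on `σ`, halts within `B` steps on a store with the property `P`. -/
def Reach (p : Program) (σ : Store) (B : ℕ) (P : Store → Prop) : Prop :=
  ∃ k τ, Runs p σ k τ ∧ k ≤ B ∧ P τ

lemma Reach.mono {p : Program} {σ : Store} {B B' : ℕ} {P P' : Store → Prop}
    (h : Reach p σ B P) (hB : B ≤ B') (hP : ∀ τ, P τ → P' τ) : Reach p σ B' P' := by
  obtain ⟨k, τ, hr, hk, hp⟩ := h
  exact ⟨k, τ, hr, hk.trans hB, hP τ hp⟩

lemma Reach.skip {σ : Store} {B : ℕ} {P : Store → Prop} (hB : 1 ≤ B) (h : P σ) :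
    Reach .skip σ B P := ⟨1, σ, .skip σ, hB, h⟩

lemma Reach.setNat {r c a : NatExpr} {σ : Store} {B : ℕ} {P : Store → Prop}
    (hB : r.cost + c.cost + a.cost + 1 ≤ B)
    (h : P (σ.setNat (r.eval σ) (c.eval σ) (a.eval σ))) : Reach (.setNat r c a) σ B P :=
  ⟨_, _, .setNat σ r c a, hB, h⟩

lemma Reach.setReal {r c : NatExpr} {a : RealExpr} {σ : Store} {B : ℕ} {P : Store → Prop}
    (hB : r.cost + c.cost + a.cost + 1 ≤ B)
    (h : P (σ.setReal (r.eval σ) (c.eval σ) (a.eval σ))) : Reach (.setReal r c a) σ B P :=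
  ⟨_, _, .setReal σ r c a, hB, h⟩

lemma Reach.seq {p q : Program} {σ : Store} {B₁ B₂ B : ℕ} {M P : Store → Prop}
    (hp : Reach p σ B₁ M) (hq : ∀ τ, M τ → Reach q τ B₂ P) (hB : B₁ + B₂ ≤ B) :
    Reach (.seq p q) σ B P := by
  obtain ⟨k, τ, hr, hk, hm⟩ := hp
  obtain ⟨l, υ, hr', hl, hp⟩ := hq τ hm
  exact ⟨_, _, .seq hr hr', by omega, hp⟩

lemma Reach.ite {t : Test} {p q : Program} {σ : Store} {B B' : ℕ} {P : Store → Prop}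
    (hp : t.Holds σ → Reach p σ B P) (hq : ¬ t.Holds σ → Reach q σ B P)
    (hB : t.cost + B ≤ B') : Reach (.ite t p q) σ B' P := by
  by_cases h : t.Holds σ
  · obtain ⟨k, τ, hr, hk, hm⟩ := hp h
    exact ⟨_, _, .iteTrue h hr, by omega, hm⟩
  · obtain ⟨k, τ, hr, hk, hm⟩ := hq h
    exact ⟨_, _, .iteFalse h hr, by omega, hm⟩

/-- The invariant is indexed by the number of completed rounds and determines the outcome of the
test, so the number of rounds is exactly `M`. The additional `t.cost` pays for the failing test. -/
lemma Reach.loop {t : Test} {p : Program} {B : ℕ} (Inv : ℕ → Store → Prop) (M : ℕ)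
    (ht : ∀ k ≤ M, ∀ σ, Inv k σ → (t.Holds σ ↔ k < M))
    (hbody : ∀ k < M, ∀ σ, Inv k σ → Reach p σ B (Inv (k + 1))) {σ : Store} (h0 : Inv 0 σ) :
    Reach (.loop t p) σ (M * (t.cost + B) + t.cost) (Inv M) := by
  suffices H : ∀ j k, k + j = M → ∀ σ, Inv k σ →
      Reach (.loop t p) σ (j * (t.cost + B) + t.cost) (Inv M) from H M 0 (by omega) σ h0
  intro j
  induction j with
  | zero =>
    intro k hk σ hσ
    have hk' : k = M := by omega
    subst hk'
    exact ⟨_, σ, .loopDone (fun h => by simpa using (ht k le_rfl σ hσ).1 h), by omega, hσ⟩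
  | succ j ih =>
    intro k hk σ hσ
    obtain ⟨a, τ, hr, ha, hτ⟩ := hbody k (by omega) σ hσ
    obtain ⟨b, υ, hr', hb, hυ⟩ := ih (k + 1) (by omega) τ hτ
    refine ⟨_, υ, .loopStep ((ht k (by omega) σ hσ).2 (by omega)) hr hr', ?_, hυ⟩
    have : (j + 1) * (t.cost + B) = j * (t.cost + B) + (t.cost + B) := by ring
    omega

/-! Short names for addresses: `reg k` and `rreg k` are the natural and the real cell `(0, k)`. -/

abbrev lit (k : ℕ) : NatExpr := .const k
abbrev reg (k : ℕ) : NatExpr := .cell (.const 0) (.const k)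
abbrev rreg (k : ℕ) : RealExpr := .cell (.const 0) (.const k)
abbrev vec (r : ℕ) (c : NatExpr) : RealExpr := .cell (.const r) c

/-- `for (0, i) = 0, …, m - 1` where `m` is the content of the natural cell `(0, j)`. -/
def forLoop (i j : ℕ) (body : Program) : Program :=
  .seq (.setNat (lit 0) (lit i) (lit 0))
    (.loop (.natLt (reg i) (reg j))
      (.seq body (.setNat (lit 0) (lit i) (.plus (reg i) (lit 1)))))

/-- The cost 15 per round is 7 for the test and 8 for the increment; 11 is 4 for the initialization
and 7 for the last test. The body has to leave the counter unchanged. -/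
lemma Reach.forLoop {i j : ℕ} {body : Program} {B m : ℕ} (Inv : ℕ → Store → Prop)
    (hreg : ∀ k ≤ m, ∀ σ, Inv k σ → σ.nat 0 i = k ∧ σ.nat 0 j = m)
    (hbody : ∀ k < m, ∀ σ, Inv k σ →
      Reach body σ B (fun τ => τ.nat 0 i = k ∧ Inv (k + 1) (τ.setNat 0 i (k + 1))))
    {σ : Store} (h0 : Inv 0 (σ.setNat 0 i 0)) :
    Reach (BTL.forLoop i j body) σ (m * (B + 15) + 11) (Inv m) := by
  refine Reach.seq (B₁ := 4) (M := Inv 0) ?_ (fun τ hτ => ?_) (B₂ := m * (B + 15) + 7) ?_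
  · exact Reach.setNat (by simp [NatExpr.cost]) h0
  · have := Reach.loop (t := .natLt (reg i) (reg j)) (B := B + 8)
      (p := .seq body (.setNat (lit 0) (lit i) (.plus (reg i) (lit 1)))) Inv m
      (fun k hk σ hσ => by
        obtain ⟨h1, h2⟩ := hreg k hk σ hσ
        simp [Test.Holds, NatExpr.eval, h1, h2])
      (fun k hk σ hσ => by
        refine Reach.seq (hbody k hk σ hσ) (fun τ hτ => ?_) (B₂ := 8) le_rfl
        refine Reach.setNat (by simp [NatExpr.cost]) ?_
        simpa [NatExpr.eval, hτ.1] using hτ.2) hτ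
    refine this.mono ?_ (fun _ h => h)
    simp only [Test.cost, NatExpr.cost]
    have : 1 + 1 + 1 + (1 + 1 + 1) + 1 + (B + 8) = B + 15 := by ring
    rw [this]
  · ring_nf; omega

@[simp] lemma Store.setReal_nat (σ : Store) (r c : ℕ) (v : ℝ) : (σ.setReal r c v).nat = σ.nat :=
  rfl

@[simp] lemma Store.setNat_real (σ : Store) (r c v : ℕ) : (σ.setNat r c v).real = σ.real := rfl

@[simp] lemma Store.setReal_real_same (σ : Store) (r c : ℕ) (v : ℝ) :
    (σ.setReal r c v).real r = Function.update (σ.real r) c v := by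
  funext x; simp [Store.setReal, Function.update_apply]

lemma Store.setReal_real_ne (σ : Store) {r r' : ℕ} (h : r' ≠ r) (c : ℕ) (v : ℝ) :
    (σ.setReal r c v).real r' = σ.real r' := by
  funext x; simp [Store.setReal, h]

@[simp] lemma Store.setNat_nat_same (σ : Store) (r c v : ℕ) :
    (σ.setNat r c v).nat r = Function.update (σ.nat r) c v := by
  funext x; simp [Store.setNat, Function.update_apply]

lemma Store.setNat_nat_ne (σ : Store) {r r' : ℕ} (h : r' ≠ r) (c v : ℕ) :
    (σ.setNat r c v).nat r' = σ.nat r' := by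
  funext x; simp [Store.setNat, h]

lemma sum_update_add {n x : ℕ} (hx : x < n) (F : ℕ → ℝ → ℝ) (w : ℕ → ℝ) (v : ℝ) :
    ∑ k ∈ Finset.range n, F k (Function.update w x v k)
      = ∑ k ∈ Finset.range n, F k (w k) - F x (w x) + F x v := by
  have hx' : x ∈ Finset.range n := Finset.mem_range.2 hx
  rw [← Finset.add_sum_erase _ _ hx', ← Finset.add_sum_erase _ (fun k => F k (w k)) hx']
  have : ∑ k ∈ (Finset.range n).erase x, F k (Function.update w x v k)
      = ∑ k ∈ (Finset.range n).erase x, F k (w k) :=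
    Finset.sum_congr rfl fun k hk => by
      rw [Function.update_of_ne (Finset.ne_of_mem_erase hk)]
  rw [this]; simp; ring

/-! ### A switching subgradient method -/

/-- The data of a maximum likelihood problem as they are stored in the memory of the machine. -/
structure Problem where
  n : ℕ
  N : ℕ
  rows : ℕ → ℕ → ℕ
  level : ℝ

namespace Problem

variable (P : Problem)

def adj (x y : ℕ) : Prop := 0 < P.rows (x + 4) y

def win (i : ℕ) : ℕ := if 0 < P.rows 3 i then P.rows 1 i else P.rows 2 i

def los (i : ℕ) : ℕ := if 0 < P.rows 3 i then P.rows 2 i else P.rows 1 i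

/-- The accuracy `η`. -/
def tol : ℝ := 1 / (2 * P.N)

/-- The relaxed level `log φ + η`. -/
def thr : ℝ := P.level + P.tol

def bound : ℝ := 8 * P.n ^ 3 * P.level ^ 2 * P.N ^ 2 + 1

structure Valid : Prop where
  n_pos : 0 < P.n
  N_pos : 0 < P.N
  level_pos : 0 < P.level
  adj_irrefl : ∀ x, ¬ P.adj x x
  win_lt : ∀ i < P.N, P.win i < P.n
  los_lt : ∀ i < P.N, P.los i < P.n
  adj_win_los : ∀ i < P.N, P.adj (P.win i) (P.los i)
  adj_los_win : ∀ i < P.N, P.adj (P.los i) (P.win i)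

/-- The relaxed constraints. -/
def Feasible (θ : ℝ) (w : ℕ → ℝ) : Prop :=
  ∑ k ∈ Finset.range P.n, w k = 0 ∧ ∀ x < P.n, ∀ y < P.n, P.adj x y → w x - w y ≤ θ

/-- `N` times the empirical negative log-likelihood. -/
def loss (w : ℕ → ℝ) : ℝ := ∑ i ∈ Finset.range P.N, softplus (w (P.los i) - w (P.win i))

/-- The squared distance. -/
def dist2 (u w : ℕ → ℝ) : ℝ := ∑ k ∈ Finset.range P.n, (w k - u k) ^ 2

/-- The contribution of the first `i` examples to the gradient of the loss. -/
def grad (w : ℕ → ℝ) (i : ℕ) (k : ℕ) : ℝ :=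
  ∑ j ∈ Finset.range i, logistic (w (P.los j) - w (P.win j)) *
    ((if P.los j = k then 1 else 0) - (if P.win j = k then 1 else 0))

structure Frame (σ : Store) : Prop where
  n_eq : σ.nat 0 0 = P.n
  N_eq : σ.nat 0 1 = P.N
  rows_eq : ∀ r ≠ 0, σ.nat r = P.rows r
  thr_eq : σ.real 0 1 = P.thr
  bound_eq : σ.real 0 2 = P.bound
  step_eq : σ.real 0 8 = P.tol / 2
  gstep_eq : σ.real 0 9 = P.tol / 2 / P.N
  ratio_eq : σ.real 0 10 = P.level / P.thr

variable {P}

lemma Frame.setNat {σ : Store} (h : P.Frame σ) {k : ℕ} (hk : 2 ≤ k) (v : ℕ) :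
    P.Frame (σ.setNat 0 k v) where
  n_eq := by
    rw [Store.setNat_nat_same, Function.update_of_ne (by omega)]; exact h.n_eq
  N_eq := by
    rw [Store.setNat_nat_same, Function.update_of_ne (by omega)]; exact h.N_eq
  rows_eq r hr := by rw [Store.setNat_nat_ne _ hr]; exact h.rows_eq r hr
  thr_eq := h.thr_eq
  bound_eq := h.bound_eq
  step_eq := h.step_eq
  gstep_eq := h.gstep_eq
  ratio_eq := h.ratio_eq

lemma Frame.setReal {σ : Store} (h : P.Frame σ) {r : ℕ} (hr : r ≠ 0) (k : ℕ) (v : ℝ) :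
    P.Frame (σ.setReal r k v) where
  n_eq := h.n_eq
  N_eq := h.N_eq
  rows_eq := h.rows_eq
  thr_eq := by rw [Store.setReal_real_ne _ hr.symm]; exact h.thr_eq
  bound_eq := by rw [Store.setReal_real_ne _ hr.symm]; exact h.bound_eq
  step_eq := by rw [Store.setReal_real_ne _ hr.symm]; exact h.step_eq
  gstep_eq := by rw [Store.setReal_real_ne _ hr.symm]; exact h.gstep_eq
  ratio_eq := by rw [Store.setReal_real_ne _ hr.symm]; exact h.ratio_eq

lemma Frame.setRealReg {σ : Store} (h : P.Frame σ) {k : ℕ} (h1 : 3 ≤ k) (h2 : k ≤ 7) (v : ℝ) :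
    P.Frame (σ.setReal 0 k v) where
  n_eq := h.n_eq
  N_eq := h.N_eq
  rows_eq := h.rows_eq
  thr_eq := by
    rw [Store.setReal_real_same, Function.update_of_ne (by omega)]; exact h.thr_eq
  bound_eq := by
    rw [Store.setReal_real_same, Function.update_of_ne (by omega)]; exact h.bound_eq
  step_eq := by
    rw [Store.setReal_real_same, Function.update_of_ne (by omega)]; exact h.step_eq
  gstep_eq := by
    rw [Store.setReal_real_same, Function.update_of_ne (by omega)]; exact h.gstep_eq
  ratio_eq := by
    rw [Store.setReal_real_same, Function.update_of_ne (by omega)]; exact h.ratio_eq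

end Problem

/-- Repair the constraint of the pair stored in the registers `2` and `3`. -/
def repairPair : Program :=
  .ite (.natLt (lit 0) (.cell (.plus (reg 2) (lit 4)) (reg 3)))
    (.ite (.realLt (rreg 1) (.minus (vec 2 (reg 2)) (vec 2 (reg 3))))
      (.seq (.setReal (lit 2) (reg 2) (.minus (vec 2 (reg 2)) (rreg 8)))
        (.seq (.setReal (lit 2) (reg 3) (.plus (vec 2 (reg 3)) (rreg 8)))
          (.setNat (lit 0) (lit 4) (lit 1))))
      .skip)
    .skip

/-- Repair all constraints; the register `4` tells whether there was anything to repair. -/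
def repairAll : Program :=
  .seq (.setNat (lit 0) (lit 4) (lit 0)) (forLoop 2 0 (forLoop 3 0 repairPair))

/-! ### Correctness of a repair round -/

namespace Problem

variable {P : Problem}

/-- The state of a repair round that has dealt with the pairs before `(x, y)`. -/
structure Repaired (P : Problem) (u : ℕ → ℝ) (σ₀ : Store) (x y : ℕ) (σ : Store) : Prop where
  frame : P.Frame σ
  real0 : σ.real 0 = σ₀.real 0
  real1 : σ.real 1 = σ₀.real 1
  real3 : σ.real 3 = σ₀.real 3
  sum_eq : ∑ k ∈ Finset.range P.n, σ.real 2 k = 0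
  progress : (σ.nat 0 4 = 0 ∧ σ.real 2 = σ₀.real 2 ∧
      ∀ x' < P.n, ∀ y' < P.n, (x' < x ∨ x' = x ∧ y' < y) → P.adj x' y' →
        σ₀.real 2 x' - σ₀.real 2 y' ≤ P.thr) ∨
    (σ.nat 0 4 = 1 ∧ P.dist2 u (σ.real 2) ≤ P.dist2 u (σ₀.real 2) - P.tol ^ 2 / 2)

lemma Repaired.setNat {u : ℕ → ℝ} {σ₀ σ : Store} {x y : ℕ} (h : P.Repaired u σ₀ x y σ)
    {k : ℕ} (hk : k = 2 ∨ k = 3) (v : ℕ) : P.Repaired u σ₀ x y (σ.setNat 0 k v) where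
  frame := h.frame.setNat (by omega) v
  real0 := h.real0
  real1 := h.real1
  real3 := h.real3
  sum_eq := h.sum_eq
  progress := by
    have := h.progress
    rwa [Store.setNat_nat_same, Function.update_of_ne (by omega)]

/-- With `a = w x - u x` and `b = w y - u y`, feasibility of `u` and the violation give `a - b > η`,
while the move changes the squared distance by `-η (a - b) + η^2 / 2`. -/
lemma dist2_repair {u w : ℕ → ℝ} {x y : ℕ} (hx : x < P.n) (hy : y < P.n) (hxy : x ≠ y)
    (hu : u x - u y ≤ P.level) (hw : P.thr < w x - w y) (hη : 0 ≤ P.tol) :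
    P.dist2 u (Function.update (Function.update w x (w x - P.tol / 2)) y (w y + P.tol / 2))
      ≤ P.dist2 u w - P.tol ^ 2 / 2 := by
  unfold dist2
  rw [sum_update_add hy (fun k v => (v - u k) ^ 2), sum_update_add hx (fun k v => (v - u k) ^ 2),
    Function.update_of_ne hxy.symm]
  unfold thr at hw
  nlinarith

/-- As long as nothing has been repaired, the current point is still the initial one, so the checks
made so far remain valid for it. After the first repair only the distance is recorded; further
repairs lower it again, but a single gain of `η^2 / 2` is all that is kept. -/
lemma reach_repairPair (hP : P.Valid) {u : ℕ → ℝ} (hu : P.Feasible P.level u) {σ₀ σ : Store}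
    {x y : ℕ} (hx : x < P.n) (hy : y < P.n) (h : P.Repaired u σ₀ x y σ) (h2 : σ.nat 0 2 = x)
    (h3 : σ.nat 0 3 = y) :
    Reach repairPair σ 60
      (fun τ => τ.nat 0 2 = x ∧ τ.nat 0 3 = y ∧ P.Repaired u σ₀ x (y + 1) τ) := by
  have hη : 0 ≤ P.tol := by unfold tol; positivity
  have hskip : (P.adj x y → σ.real 2 x - σ.real 2 y ≤ P.thr) →
      P.Repaired u σ₀ x (y + 1) σ := fun hle =>
    { h with
      progress := by
        rcases h.progress with ⟨ha, hb, hc⟩ | hb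
        · refine .inl ⟨ha, hb, fun x' hx' y' hy' hlt hadj => ?_⟩
          by_cases hcase : x' < x ∨ x' = x ∧ y' < y
          · exact hc x' hx' y' hy' hcase hadj
          · obtain ⟨rfl, rfl⟩ : x' = x ∧ y' = y := by omega
            rw [← hb]; exact hle hadj
        · exact .inr hb }
  have hadj : (Test.natLt (lit 0) (.cell (.plus (reg 2) (lit 4)) (reg 3))).Holds σ
      ↔ P.adj x y := by
    simp [Test.Holds, NatExpr.eval, h2, h3, adj, h.frame.rows_eq (x + 4) (by omega)]
  have htest : (Test.realLt (rreg 1) (.minus (vec 2 (reg 2)) (vec 2 (reg 3)))).Holds σ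
      ↔ P.thr < σ.real 2 x - σ.real 2 y := by
    simp [Test.Holds, NatExpr.eval, RealExpr.eval, h2, h3, h.frame.thr_eq]
  refine Reach.ite (B := 49) (fun ht => ?_) (fun ht => ?_) (by simp [Test.cost, NatExpr.cost])
  · rw [hadj] at ht
    refine Reach.ite (B := 34) (fun ht' => ?_) (fun ht' => ?_)
      (by simp [Test.cost, NatExpr.cost, RealExpr.cost])
    · rw [htest] at ht'
      have hxy : x ≠ y := fun e => hP.adj_irrefl x (by rw [← e] at ht; exact ht)
      refine Reach.seq (B₁ := 14) (B₂ := 20) (M := fun τ => τ =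
        σ.setReal 2 x (σ.real 2 x - P.tol / 2)) (Reach.setReal
          (by simp [NatExpr.cost, RealExpr.cost]) ?_) ?_ le_rfl
      · simp [NatExpr.eval, RealExpr.eval, h2, h.frame.step_eq]
      rintro τ rfl
      refine Reach.seq (B₁ := 14) (B₂ := 6) (M := fun τ => τ =
        (σ.setReal 2 x (σ.real 2 x - P.tol / 2)).setReal 2 y (σ.real 2 y + P.tol / 2))
        (Reach.setReal (by simp [NatExpr.cost, RealExpr.cost]) ?_) ?_ le_rfl
      · simp [NatExpr.eval, RealExpr.eval, h3, Function.update_of_ne hxy.symm,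
          (h.frame.setReal (r := 2) (by simp) x _).step_eq]
      rintro τ rfl
      refine Reach.setNat (by simp [NatExpr.cost]) ?_
      refine ⟨by simpa [NatExpr.eval] using h2, by simpa [NatExpr.eval] using h3, ?_⟩
      have hw := dist2_repair (u := u) (w := σ.real 2) hx hy hxy (hu.2 x hx y hy ht) ht' hη
      refine ⟨((h.frame.setReal (by simp) _ _).setReal (by simp) _ _).setNat (by simp [NatExpr.eval]) _,
        ?_, ?_, ?_, ?_, .inr ⟨?_, ?_⟩⟩
      · simp [Store.setReal_real_ne, h.real0]
      · simp [Store.setReal_real_ne, h.real1]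
      · simp [Store.setReal_real_ne, h.real3]
      · simp only [Store.setNat_real, Store.setReal_real_same]
        rw [sum_update_add hy (fun _ v => v), sum_update_add hx (fun _ v => v), h.sum_eq,
          Function.update_of_ne hxy.symm]
        ring
      · simp [NatExpr.eval]
      · simp only [Store.setNat_real, Store.setReal_real_same]
        rcases h.progress with ⟨-, hb, -⟩ | ⟨-, hb⟩
        · rw [hb] at hw ⊢; exact hw
        · have : 0 ≤ P.tol ^ 2 := sq_nonneg _
          linarith
    · rw [htest] at ht'
      exact Reach.skip (by omega) ⟨h2, h3, hskip fun _ => not_lt.1 ht'⟩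
  · rw [hadj] at ht
    exact Reach.skip (by omega) ⟨h2, h3, hskip fun ha => absurd ha ht⟩

lemma reach_repairAll (hP : P.Valid) {u : ℕ → ℝ} (hu : P.Feasible P.level u) {σ : Store}
    (hσ : P.Frame σ) (hsum : ∑ k ∈ Finset.range P.n, σ.real 2 k = 0) :
    Reach repairAll σ (P.n * (P.n * 75 + 26) + 15) (P.Repaired u σ P.n 0) := by
  refine Reach.seq (B₁ := 4) (B₂ := P.n * ((P.n * 75 + 11) + 15) + 11)
    (M := P.Repaired u σ 0 0) (Reach.setNat (by simp [NatExpr.cost]) ?_) (fun τ hτ => ?_) ?_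
  · exact ⟨hσ.setNat (by simp [NatExpr.eval]) _, rfl, rfl, rfl, hsum,
      .inl ⟨by simp [NatExpr.eval], rfl, by omega⟩⟩
  · refine (Reach.forLoop (fun x τ => τ.nat 0 2 = x ∧ P.Repaired u σ x 0 τ) (m := P.n)
      (fun k _ τ h => ⟨h.1, h.2.frame.n_eq⟩) (fun x hx τ h => ?_)
      ⟨by simp, hτ.setNat (.inl rfl) _⟩).mono le_rfl fun _ h => h.2
    refine (Reach.forLoop (B := 60) (fun y τ => τ.nat 0 2 = x ∧ τ.nat 0 3 = y ∧
      P.Repaired u σ x y τ) (m := P.n) (fun k _ τ h => ⟨h.2.1, h.2.2.frame.n_eq⟩)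
      (fun y hy τ h => ?_) ⟨by simpa using h.1, by simp, h.2.setNat (.inr rfl) _⟩).mono
        (by omega) fun υ hυ => ⟨hυ.1, by simp, ?_⟩
    · refine (reach_repairPair hP hu hx hy h.2.2 h.1 h.2.1).mono le_rfl fun υ hυ => ?_
      exact ⟨hυ.2.1, by simpa using hυ.1, by simp, hυ.2.2.setNat (.inr rfl) _⟩
    · have := hυ.2.2.setNat (.inl rfl) (x + 1)
      refine { this with progress := ?_ }
      rcases this.progress with ⟨ha, hb, hc⟩ | hb
      · exact .inl ⟨ha, hb, fun x' hx' y' hy' hlt => hc x' hx' y' hy' (by omega)⟩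
      · exact .inr hb
  · ring_nf; omega

end Problem

/-- Add the contribution of the example in the register `2` to the loss and to the gradient. -/
def addExample : Program :=
  .seq (.ite (.natLt (lit 0) (.cell (lit 3) (reg 2)))
      (.seq (.setNat (lit 0) (lit 5) (.cell (lit 1) (reg 2)))
        (.setNat (lit 0) (lit 6) (.cell (lit 2) (reg 2))))
      (.seq (.setNat (lit 0) (lit 5) (.cell (lit 2) (reg 2)))
        (.setNat (lit 0) (lit 6) (.cell (lit 1) (reg 2)))))
    (.seq (.setReal (lit 0) (lit 6) (.exp (.minus (vec 2 (reg 6)) (vec 2 (reg 5)))))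
      (.seq (.setReal (lit 0) (lit 5) (.plus (rreg 5) (.log (.plus (.const 1) (rreg 6)))))
        (.seq (.setReal (lit 0) (lit 7) (.divide (rreg 6) (.plus (.const 1) (rreg 6))))
          (.seq (.setReal (lit 3) (reg 5) (.minus (vec 3 (reg 5)) (rreg 7)))
            (.setReal (lit 3) (reg 6) (.plus (vec 3 (reg 6)) (rreg 7)))))))

/-- Compute the loss and its gradient. -/
def evalLoss : Program :=
  .seq (.setReal (lit 0) (lit 5) (.const 0)) (forLoop 2 1 addExample)

/-- Keep the current point if its loss is smaller than that of the best point so far. -/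
def recordBest : Program :=
  .ite (.realLt (rreg 5) (rreg 4))
    (.seq (.setReal (lit 0) (lit 4) (rreg 5))
      (forLoop 2 0 (.setReal (lit 1) (reg 2) (vec 2 (reg 2)))))
    .skip

/-- A gradient step. -/
def descend : Program :=
  forLoop 2 0 (.seq
    (.setReal (lit 2) (reg 2) (.minus (vec 2 (reg 2)) (.times (rreg 9) (vec 3 (reg 2)))))
    (.setReal (lit 3) (reg 2) (.const 0)))

/-! ### Correctness of the evaluation, the record of the best point and the gradient step -/

namespace Problem

variable {P : Problem}

/-- The state after the first `i` examples have been evaluated. -/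
structure Evaluated (P : Problem) (σ₀ : Store) (i : ℕ) (σ : Store) : Prop where
  frame : P.Frame σ
  cnt : σ.real 0 3 = σ₀.real 0 3
  best : σ.real 0 4 = σ₀.real 0 4
  real1 : σ.real 1 = σ₀.real 1
  real2 : σ.real 2 = σ₀.real 2
  value : σ.real 0 5 = ∑ j ∈ Finset.range i,
    softplus (σ₀.real 2 (P.los j) - σ₀.real 2 (P.win j))
  grad_eq : ∀ k < P.n, σ.real 3 k = P.grad (σ₀.real 2) i k

lemma Evaluated.setNat {σ₀ σ : Store} {i : ℕ} (h : P.Evaluated σ₀ i σ)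
    {k : ℕ} (hk : 2 ≤ k) (v : ℕ) : P.Evaluated σ₀ i (σ.setNat 0 k v) :=
  ⟨h.frame.setNat hk v, h.cnt, h.best, h.real1, h.real2, h.value, h.grad_eq⟩

/-- Winner and loser are adjacent, hence distinct, so the second update of the gradient row does not
read the cell changed by the first. -/
lemma reach_addExample (hP : P.Valid) {σ₀ σ : Store} {i : ℕ} (hi : i < P.N)
    (h : P.Evaluated σ₀ i σ) (h2 : σ.nat 0 2 = i) :
    Reach addExample σ 105 (fun τ => τ.nat 0 2 = i ∧ P.Evaluated σ₀ (i + 1) τ) := by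
  have hadj := hP.adj_win_los i hi
  have hne : P.win i ≠ P.los i := fun e => hP.adj_irrefl _ (by rw [e] at hadj; exact hadj)
  refine Reach.seq (B₁ := 30) (B₂ := 75) (M := fun τ => τ.nat 0 2 = i ∧ τ.nat 0 5 = P.win i ∧
    τ.nat 0 6 = P.los i ∧ P.Evaluated σ₀ i τ) ?_ ?_ (by omega)
  · have htest : (Test.natLt (lit 0) (.cell (lit 3) (reg 2))).Holds σ ↔ 0 < P.rows 3 i := by
      simp [Test.Holds, NatExpr.eval, h2, h.frame.rows_eq 3 (by omega)]
    refine Reach.ite (B := 22) (fun ht => ?_) (fun ht => ?_) (by simp [Test.cost, NatExpr.cost])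
    all_goals
      rw [htest] at ht
      refine Reach.seq (B₁ := 8) (B₂ := 8) (M := fun τ => τ.nat 0 2 = i ∧ τ.nat 0 5 = P.win i ∧
        P.Evaluated σ₀ i τ) (Reach.setNat (by simp [NatExpr.cost]) ⟨?_, ?_, ?_⟩) ?_ (by omega)
      · simp [NatExpr.eval, h2]
      · simp [NatExpr.eval, h2, win, ht, h.frame.rows_eq]
      · exact h.setNat (by simp [NatExpr.eval]) _
      · rintro τ ⟨g2, g5, g⟩
        refine Reach.setNat (by simp [NatExpr.cost]) ⟨?_, ?_, ?_, ?_⟩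
        · simp [NatExpr.eval, g2]
        · simp [NatExpr.eval, g5]
        · simp [NatExpr.eval, g2, los, ht, g.frame.rows_eq]
        · exact g.setNat (by simp [NatExpr.eval]) _
  · rintro τ ⟨g2, g5, g6, g⟩
    set d := σ₀.real 2 (P.los i) - σ₀.real 2 (P.win i) with hd
    refine Reach.seq (B₁ := 15) (B₂ := 60) (M := fun υ => υ = τ.setReal 0 6 (Real.exp d))
      (Reach.setReal (by simp [NatExpr.cost, RealExpr.cost]) ?_) ?_ (by omega)
    · simp [NatExpr.eval, RealExpr.eval, g5, g6, g.real2, hd]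
    rintro υ rfl
    refine Reach.seq (B₁ := 13) (B₂ := 47) (M := fun υ => υ = (τ.setReal 0 6 (Real.exp d)).setReal
        0 5 (τ.real 0 5 + softplus d))
      (Reach.setReal (by simp [NatExpr.cost, RealExpr.cost]) ?_) ?_ (by omega)
    · simp [NatExpr.eval, RealExpr.eval, softplus]
    rintro υ rfl
    refine Reach.seq (B₁ := 12) (B₂ := 35) (M := fun υ => υ = ((τ.setReal 0 6 (Real.exp d)).setReal
        0 5 (τ.real 0 5 + softplus d)).setReal 0 7 (logistic d))
      (Reach.setReal (by simp [NatExpr.cost, RealExpr.cost]) ?_) ?_ (by omega)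
    · simp [NatExpr.eval, RealExpr.eval, logistic]
    rintro υ rfl
    refine Reach.seq (B₁ := 15) (B₂ := 15) (M := fun υ => υ =
      (((τ.setReal 0 6 (Real.exp d)).setReal 0 5 (τ.real 0 5 + softplus d)).setReal 0 7
        (logistic d)).setReal 3 (P.win i) (τ.real 3 (P.win i) - logistic d))
      (Reach.setReal (by simp [NatExpr.cost, RealExpr.cost]) ?_) ?_ (by omega)
    · simp [NatExpr.eval, RealExpr.eval, g5, Store.setReal_real_ne]
    rintro υ rfl
    refine Reach.setReal (by simp [NatExpr.cost, RealExpr.cost]) ⟨?_, ?_⟩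
    · simpa [NatExpr.eval] using g2
    · have hf := ((((g.frame.setRealReg (k := 6) (by omega) (by omega) (Real.exp d)).setRealReg
        (k := 5) (by omega) (by omega) (τ.real 0 5 + softplus d)).setRealReg (k := 7)
          (by omega) (by omega) (logistic d)).setReal (r := 3) (by omega) (P.win i)
            (τ.real 3 (P.win i) - logistic d))
      refine ⟨hf.setReal (by simp [NatExpr.eval]) _ _, ?_, ?_, ?_, ?_, ?_, fun k hk => ?_⟩
      · simpa [NatExpr.eval, Store.setReal_real_ne] using g.cnt
      · simpa [NatExpr.eval, Store.setReal_real_ne] using g.best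
      · simpa [NatExpr.eval, Store.setReal_real_ne] using g.real1
      · simpa [NatExpr.eval, Store.setReal_real_ne] using g.real2
      · rw [Finset.sum_range_succ, ← g.value]
        simp [NatExpr.eval, Store.setReal_real_ne, hd]
      · have hk' := g.grad_eq k hk
        simp only [grad] at hk' ⊢
        rw [Finset.sum_range_succ, ← hk']
        simp only [NatExpr.eval, RealExpr.eval, Store.setReal_nat, g6, Store.setReal_real_same,
          Store.setReal_real_ne _ (show (3 : ℕ) ≠ 0 by omega),
          Store.setReal_real_ne _ (show (0 : ℕ) ≠ 3 by omega), Function.update_self]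
        rw [Function.update_of_ne hne.symm]
        by_cases h1 : k = P.los i
        · subst h1
          simp [hne, ← hd]
        · by_cases h3 : k = P.win i
          · subst h3
            simp [hne, hne.symm, ← hd]; ring
          · simp [h1, h3, Ne.symm h1, Ne.symm h3]

lemma reach_evalLoss (hP : P.Valid) {σ : Store} (hσ : P.Frame σ)
    (hg : ∀ k < P.n, σ.real 3 k = 0) :
    Reach evalLoss σ (P.N * 120 + 15) (P.Evaluated σ P.N) := by
  refine Reach.seq (B₁ := 4) (B₂ := P.N * (105 + 15) + 11)
    (M := P.Evaluated σ 0) (Reach.setReal (by simp [NatExpr.cost, RealExpr.cost]) ?_)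
    (fun τ hτ => ?_) (by omega)
  · refine ⟨hσ.setRealReg (by simp [NatExpr.eval]) (by simp [NatExpr.eval]) _, ?_, ?_, ?_, ?_, ?_, ?_⟩
    · simp [NatExpr.eval]
    · simp [NatExpr.eval]
    · simp [NatExpr.eval, Store.setReal_real_ne]
    · simp [NatExpr.eval, Store.setReal_real_ne]
    · simp [NatExpr.eval, RealExpr.eval]
    · intro k hk
      simp [NatExpr.eval, Store.setReal_real_ne, grad, hg k hk]
  · refine (Reach.forLoop (fun i τ => τ.nat 0 2 = i ∧ P.Evaluated σ i τ) (m := P.N)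
      (fun k _ τ h => ⟨h.1, h.2.frame.N_eq⟩) (fun i hi τ h => ?_)
      ⟨by simp, hτ.setNat (by omega) _⟩).mono le_rfl fun _ h => h.2
    exact (reach_addExample hP hi h.2 h.1).mono le_rfl fun υ hυ =>
      ⟨hυ.1, by simp, hυ.2.setNat (by omega) _⟩

lemma loss_congr (hP : P.Valid) {v w : ℕ → ℝ} (h : ∀ k < P.n, v k = w k) :
    P.loss v = P.loss w :=
  Finset.sum_congr rfl fun i hi => by
    rw [h _ (hP.los_lt i (Finset.mem_range.1 hi)), h _ (hP.win_lt i (Finset.mem_range.1 hi))]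

lemma Feasible.congr {θ : ℝ} {v w : ℕ → ℝ} (h : ∀ k < P.n, v k = w k) (hw : P.Feasible θ w) :
    P.Feasible θ v :=
  ⟨by rw [← hw.1]; exact Finset.sum_congr rfl fun k hk => h k (Finset.mem_range.1 hk),
    fun x hx y hy hxy => by rw [h x hx, h y hy]; exact hw.2 x hx y hy hxy⟩

/-- The state between the evaluation of the loss and the gradient step. -/
structure Recorded (P : Problem) (σ₀ σ : Store) : Prop where
  frame : P.Frame σ
  cnt : σ.real 0 3 = σ₀.real 0 3
  real2 : σ.real 2 = σ₀.real 2
  grad_eq : ∀ k < P.n, σ.real 3 k = P.grad (σ₀.real 2) P.N k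
  feasible : P.Feasible P.thr (σ.real 1)
  best : σ.real 0 4 = P.loss (σ.real 1)
  le_old : P.loss (σ.real 1) ≤ P.loss (σ₀.real 1)
  le_new : P.loss (σ.real 1) ≤ P.loss (σ₀.real 2)

lemma reach_recordBest (hP : P.Valid) {σ₀ σ : Store} (h : P.Evaluated σ₀ P.N σ)
    (hbest : σ₀.real 0 4 = P.loss (σ₀.real 1)) (hf1 : P.Feasible P.thr (σ₀.real 1))
    (hf2 : P.Feasible P.thr (σ₀.real 2)) :
    Reach recordBest σ (P.n * 30 + 30) (P.Recorded σ₀) := by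
  have htest : (Test.realLt (rreg 5) (rreg 4)).Holds σ
      ↔ P.loss (σ₀.real 2) < P.loss (σ₀.real 1) := by
    simp [Test.Holds, NatExpr.eval, RealExpr.eval, h.value, h.best, hbest, loss]
  refine Reach.ite (B := P.n * 30 + 20) (fun ht => ?_) (fun ht => ?_)
    (by simp [Test.cost, NatExpr.cost, RealExpr.cost]; omega)
  · rw [htest] at ht
    refine Reach.seq (B₁ := 6) (B₂ := P.n * (11 + 15) + 11)
      (M := fun τ => τ = σ.setReal 0 4 (P.loss (σ₀.real 2)))
      (Reach.setReal (by simp [NatExpr.cost, RealExpr.cost]) ?_) ?_ (by omega)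
    · simp [NatExpr.eval, RealExpr.eval, h.value, loss]
    rintro τ rfl
    refine (Reach.forLoop (fun i τ => τ.nat 0 2 = i ∧ P.Frame τ ∧ τ.real 0 3 = σ₀.real 0 3 ∧
      τ.real 0 4 = P.loss (σ₀.real 2) ∧ τ.real 2 = σ₀.real 2 ∧ τ.real 3 = σ.real 3 ∧
      ∀ k < i, τ.real 1 k = σ₀.real 2 k) (m := P.n)
      (fun k _ τ h => ⟨h.1, h.2.1.n_eq⟩) (fun i hi τ g => ?_)
      ⟨by simp, (h.frame.setRealReg (by omega) (by omega) _).setNat (by omega) _, ?_, ?_, ?_, ?_,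
        ?_⟩).mono le_rfl fun τ g => ?_
    · obtain ⟨g1, g2, g3, g4, g5, g6, g7⟩ := g
      refine Reach.setReal (by simp [NatExpr.cost, RealExpr.cost]) ⟨?_, ?_, ?_, ?_, ?_, ?_, ?_, ?_⟩
      · simpa using g1
      · simp
      · exact (g2.setReal (by simp [NatExpr.eval]) _ _).setNat (by omega) _
      · simpa [NatExpr.eval, Store.setReal_real_ne] using g3
      · simpa [NatExpr.eval, Store.setReal_real_ne] using g4
      · simpa [NatExpr.eval, Store.setReal_real_ne] using g5
      · simpa [NatExpr.eval, Store.setReal_real_ne] using g6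
      · intro k hk
        simp only [NatExpr.eval, RealExpr.eval, Store.setNat_real, Store.setReal_real_same, g1, g5]
        by_cases hki : k = i
        · subst hki; simp
        · rw [Function.update_of_ne hki]; exact g7 k (by omega)
    · simpa using h.cnt
    · simp
    · simpa [Store.setReal_real_ne] using h.real2
    · simp [Store.setReal_real_ne]
    · intro k hk; omega
    · obtain ⟨g1, g2, g3, g4, g5, g6, g7⟩ := g
      have hl := loss_congr hP g7
      exact ⟨g2, g3, g5, by rw [g6]; exact h.grad_eq, hf2.congr g7, by rw [g4, hl],
        by rw [hl]; exact ht.le, hl.le⟩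
  · rw [htest] at ht
    exact Reach.skip (by omega) ⟨h.frame, h.cnt, h.real2, h.grad_eq, by rwa [h.real1],
      by rw [h.best, h.real1, hbest], by rw [h.real1], by rw [h.real1]; exact not_lt.1 ht⟩

/-- The invariant separates the coordinates already moved from the rest. Each gradient cell is
cleared once used, because the next evaluation accumulates onto the row. -/
lemma reach_descend {σ₀ σ : Store} (h : P.Recorded σ₀ σ) :
    Reach descend σ (P.n * 50 + 11) (fun τ => P.Frame τ ∧ τ.real 0 3 = σ₀.real 0 3 ∧
      τ.real 0 4 = P.loss (τ.real 1) ∧ τ.real 1 = σ.real 1 ∧ ∀ k < P.n, τ.real 3 k = 0 ∧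
        τ.real 2 k = σ₀.real 2 k - P.tol / 2 / P.N * P.grad (σ₀.real 2) P.N k) := by
  refine (Reach.forLoop (B := 30) (fun i τ => τ.nat 0 2 = i ∧ P.Frame τ ∧
      τ.real 0 3 = σ₀.real 0 3 ∧
      τ.real 0 4 = P.loss (σ.real 1) ∧ τ.real 1 = σ.real 1 ∧ ∀ k < P.n,
        if k < i then τ.real 3 k = 0 ∧
          τ.real 2 k = σ₀.real 2 k - P.tol / 2 / P.N * P.grad (σ₀.real 2) P.N k
        else τ.real 3 k = P.grad (σ₀.real 2) P.N k ∧ τ.real 2 k = σ₀.real 2 k) (m := P.n)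
      (fun k _ τ h => ⟨h.1, h.2.1.n_eq⟩) (fun i hi τ g => ?_)
      ⟨by simp, h.frame.setNat (by omega) _, h.cnt, h.best, rfl, fun k hk => ?_⟩).mono
        (by omega) fun τ g => ?_
  · obtain ⟨g1, g2, g3, g4, g5, g7⟩ := g
    have hi' := g7 i hi
    simp only [lt_irrefl, if_false] at hi'
    refine Reach.seq (B₁ := 20) (B₂ := 6) (M := fun υ => υ = τ.setReal 2 i
      (σ₀.real 2 i - P.tol / 2 / P.N * P.grad (σ₀.real 2) P.N i))
      (Reach.setReal (by simp [NatExpr.cost, RealExpr.cost]) ?_) ?_ (by omega)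
    · simp [NatExpr.eval, RealExpr.eval, g1, hi'.1, hi'.2, g2.gstep_eq]
    rintro υ rfl
    refine Reach.setReal (by simp [NatExpr.cost, RealExpr.cost]) ⟨?_, ?_, ?_, ?_, ?_, ?_, ?_⟩
    · simpa using g1
    · simp
    · exact ((g2.setReal (by simp) _ _).setReal (by simp [NatExpr.eval]) _ _).setNat (by omega) _
    · simpa [NatExpr.eval, Store.setReal_real_ne] using g3
    · simpa [NatExpr.eval, Store.setReal_real_ne] using g4
    · simpa [NatExpr.eval, Store.setReal_real_ne] using g5
    · intro k hk
      have hk' := g7 k hk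
      by_cases hki : k = i
      · subst hki
        simp [NatExpr.eval, RealExpr.eval, Store.setReal_real_ne, g1]
      · have : k < i + 1 ↔ k < i := by omega
        simpa [NatExpr.eval, RealExpr.eval, Store.setReal_real_ne, g1, hki, this] using hk'
  · simpa using ⟨h.grad_eq k hk, congrFun h.real2 k⟩
  · obtain ⟨g1, g2, g3, g4, g5, g7⟩ := g
    refine ⟨g2, g3, by rw [g4, g5], g5, fun k hk => ?_⟩
    simpa [hk] using g7 k hk

/-! ### The gain in distance made by a gradient step -/

lemma sum_grad_mul (hP : P.Valid) (w v : ℕ → ℝ) :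
    ∑ k ∈ Finset.range P.n, P.grad w P.N k * v k
      = ∑ j ∈ Finset.range P.N, logistic (w (P.los j) - w (P.win j)) *
        (v (P.los j) - v (P.win j)) := by
  simp only [grad, Finset.sum_mul]
  rw [Finset.sum_comm]
  refine Finset.sum_congr rfl fun j hj => ?_
  have h1 := hP.los_lt j (Finset.mem_range.1 hj)
  have h2 := hP.win_lt j (Finset.mem_range.1 hj)
  simp only [mul_assoc, ← Finset.mul_sum, sub_mul, ite_mul, one_mul, zero_mul,
    Finset.sum_sub_distrib, Finset.sum_ite_eq, Finset.mem_range, h1, h2, if_true]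

/-- By Cauchy–Schwarz over the `N` examples, a squared coordinate is at most `N` times the number of
occurrences of that item as winner or loser; these numbers add up to at most `2N`. -/
lemma sum_grad_sq_le (hP : P.Valid) (w : ℕ → ℝ) :
    ∑ k ∈ Finset.range P.n, P.grad w P.N k ^ 2 ≤ 2 * (P.N : ℝ) ^ 2 := by
  have h1 : ∀ k, P.grad w P.N k ^ 2 ≤ P.N * ∑ j ∈ Finset.range P.N,
      ((if P.los j = k then 1 else 0) + (if P.win j = k then 1 else 0) : ℝ) := by
    intro k
    have := sq_sum_le_card_mul_sum_sq (s := Finset.range P.N) (f := fun j =>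
      logistic (w (P.los j) - w (P.win j)) *
        ((if P.los j = k then 1 else 0) - (if P.win j = k then 1 else 0)))
    rw [Finset.card_range] at this
    refine this.trans (mul_le_mul_of_nonneg_left (Finset.sum_le_sum fun j _ => ?_) (by positivity))
    have ha := logistic_nonneg (w (P.los j) - w (P.win j))
    have hb := logistic_le_one (w (P.los j) - w (P.win j))
    have hc : logistic (w (P.los j) - w (P.win j)) ^ 2 ≤ 1 := by nlinarith
    split_ifs <;> nlinarith
  calc _ ≤ ∑ k ∈ Finset.range P.n, P.N * ∑ j ∈ Finset.range P.N,
      ((if P.los j = k then 1 else 0) + (if P.win j = k then 1 else 0) : ℝ) :=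
        Finset.sum_le_sum fun k _ => h1 k
    _ = P.N * ∑ j ∈ Finset.range P.N, (2 : ℝ) := by
        rw [← Finset.mul_sum, Finset.sum_comm]
        congr 1
        refine Finset.sum_congr rfl fun j hj => ?_
        have h1 := hP.los_lt j (Finset.mem_range.1 hj)
        have h2 := hP.win_lt j (Finset.mem_range.1 hj)
        simp only [Finset.sum_add_distrib, Finset.sum_ite_eq, Finset.mem_range, h1, h2, if_true]
        norm_num
    _ = _ := by simp; ring

/-- The loss depends on differences only. Therefore gradient steps keep the sum of the coordinates
equal to 0. -/
lemma sum_grad (hP : P.Valid) (w : ℕ → ℝ) : ∑ k ∈ Finset.range P.n, P.grad w P.N k = 0 := by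
  have := sum_grad_mul hP w (fun _ => 1)
  simpa using this

/-- By convexity the inner product of the gradient with `w - u` is at least the gap in loss, which
exceeds `N η`. With step `γ = η / (2N)` the change is at most `-2 γ N η + γ^2 * 2 N^2 = -η^2 + η^2 /
2`. -/
lemma dist2_descend (hP : P.Valid) {u w w' : ℕ → ℝ} (hw : P.loss u + P.N * P.tol < P.loss w)
    (hw' : ∀ k < P.n, w' k = w k - P.tol / 2 / P.N * P.grad w P.N k) :
    P.dist2 u w' ≤ P.dist2 u w - P.tol ^ 2 / 2 := by
  have hN : (0 : ℝ) < P.N := by exact_mod_cast hP.N_pos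
  have hη : 0 < P.tol := by unfold tol; positivity
  set γ := P.tol / 2 / P.N with hγ
  have h1 : P.dist2 u w' = P.dist2 u w
      - 2 * γ * ∑ k ∈ Finset.range P.n, P.grad w P.N k * (w k - u k)
      + γ ^ 2 * ∑ k ∈ Finset.range P.n, P.grad w P.N k ^ 2 := by
    unfold dist2
    rw [Finset.mul_sum, Finset.mul_sum, ← Finset.sum_sub_distrib, ← Finset.sum_add_distrib]
    refine Finset.sum_congr rfl fun k hk => ?_
    rw [hw' k (Finset.mem_range.1 hk)]
    ring
  have h2 : P.loss w - P.loss u ≤ ∑ k ∈ Finset.range P.n, P.grad w P.N k * (w k - u k) := by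
    rw [sum_grad_mul hP w (fun k => w k - u k)]
    unfold loss
    rw [← Finset.sum_sub_distrib]
    refine Finset.sum_le_sum fun j _ => ?_
    have := softplus_tangent_le (w (P.los j) - w (P.win j)) (u (P.los j) - u (P.win j))
    linarith
  have h3 := sum_grad_sq_le hP w
  have hγ0 : 0 < γ := by positivity
  have h4 : γ * P.N = P.tol / 2 := by rw [hγ]; field_simp
  have h5 : 2 * γ * (P.N * P.tol) ≤
      2 * γ * ∑ k ∈ Finset.range P.n, P.grad w P.N k * (w k - u k) := by
    gcongr; linarith
  have h6 : γ ^ 2 * ∑ k ∈ Finset.range P.n, P.grad w P.N k ^ 2 ≤ γ ^ 2 * (2 * (P.N : ℝ) ^ 2) := by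
    gcongr
  have h7 : γ ^ 2 * (2 * (P.N : ℝ) ^ 2) = 2 * (γ * P.N) ^ 2 := by ring
  have h8 : 2 * γ * (P.N * P.tol) = 2 * (γ * P.N) * P.tol := by ring
  rw [h7, h4] at h6
  rw [h8, h4] at h5
  rw [h1]
  nlinarith

end Problem

/-- One pass: repair the constraints or, if they hold, make a gradient step. -/
def pass : Program :=
  .seq repairAll
    (.seq (.ite (.natLt (lit 0) (reg 4)) .skip (.seq evalLoss (.seq recordBest descend)))
      (.setReal (lit 0) (lit 3) (.plus (rreg 3) (.const 1))))

/-- Compute the parameters of the method. -/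
def setUp : Program :=
  .seq (.setReal (lit 0) (lit 1)
      (.plus (.log (rreg 0)) (.divide (.const 1) (.times (.const 2) (.ofNat (reg 1))))))
    (.seq (.setReal (lit 0) (lit 2) (.plus (.times (.times (.times (.const 8)
        (.times (.ofNat (reg 0)) (.times (.ofNat (reg 0)) (.ofNat (reg 0)))))
        (.times (.log (rreg 0)) (.log (rreg 0))))
        (.times (.ofNat (reg 1)) (.ofNat (reg 1)))) (.const 1)))
      (.seq (.setReal (lit 0) (lit 4) (.times (.ofNat (reg 1)) (.log (.const 2))))
        (.seq (.setReal (lit 0) (lit 8)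
            (.divide (.divide (.const 1) (.times (.const 2) (.ofNat (reg 1)))) (.const 2)))
          (.seq (.setReal (lit 0) (lit 9) (.divide (rreg 8) (.ofNat (reg 1))))
            (.setReal (lit 0) (lit 10) (.divide (.log (rreg 0)) (rreg 1)))))))

/-- Scale the best point such that it satisfies the constraints. -/
def rescale : Program :=
  forLoop 2 0 (.setReal (lit 1) (reg 2) (.times (rreg 10) (vec 1 (reg 2))))

/-- The program for the approximate constrained maximum likelihood estimate. -/
def mleProgram : Program :=
  .seq setUp (.seq (.loop (.realLt (rreg 3) (rreg 2)) pass) rescale)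

/-! ### The main loop, its running time and its accuracy -/

namespace Problem

variable {P : Problem}

/-- The invariant of the main loop after `t` passes, for the comparison point `u`. -/
structure Progress (P : Problem) (u : ℕ → ℝ) (t : ℕ) (σ : Store) : Prop where
  frame : P.Frame σ
  cnt : σ.real 0 3 = t
  sum_eq : ∑ k ∈ Finset.range P.n, σ.real 2 k = 0
  feasible : P.Feasible P.thr (σ.real 1)
  best : σ.real 0 4 = P.loss (σ.real 1)
  grad_eq : ∀ k < P.n, σ.real 3 k = 0
  progress : P.loss (σ.real 1) ≤ P.loss u + P.N * P.tol ∨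
    P.dist2 u (σ.real 2) ≤ P.dist2 u 0 - t * (P.tol ^ 2 / 2)

lemma Progress.count {u : ℕ → ℝ} {t : ℕ} {σ : Store} (hf : P.Frame σ)
    (hs : ∑ k ∈ Finset.range P.n, σ.real 2 k = 0) (hb : P.Feasible P.thr (σ.real 1))
    (hbest : σ.real 0 4 = P.loss (σ.real 1)) (hg : ∀ k < P.n, σ.real 3 k = 0)
    (hp : P.loss (σ.real 1) ≤ P.loss u + P.N * P.tol ∨
      P.dist2 u (σ.real 2) ≤ P.dist2 u 0 - (t + 1) * (P.tol ^ 2 / 2)) :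
    P.Progress u (t + 1) (σ.setReal 0 3 (t + 1)) where
  frame := hf.setRealReg (by omega) (by omega) _
  cnt := by simp
  sum_eq := by simpa [Store.setReal_real_ne] using hs
  feasible := by simpa [Store.setReal_real_ne] using hb
  best := by simpa [Store.setReal_real_ne] using hbest
  grad_eq := by simpa [Store.setReal_real_ne] using hg
  progress := by simpa [Store.setReal_real_ne] using hp

/-- Either the best loss is already within `N η` of that of `u`, which persists because the best
loss never increases, or the pass gains `η^2 / 2` in distance: by a repair, or by a gradient step
from a point whose loss is too large. If that loss is not too large, the point has just been taken
into account and the first alternative begins to hold. -/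
lemma reach_pass (hP : P.Valid) {u : ℕ → ℝ} (hu : P.Feasible P.level u) {t : ℕ} {σ : Store}
    (h : P.Progress u t σ) :
    Reach pass σ (P.n * (P.n * 75 + 106) + P.N * 120 + 100) (P.Progress u (t + 1)) := by
  refine Reach.seq (B₂ := P.n * 80 + P.N * 120 + 85) (reach_repairAll hP hu h.frame h.sum_eq)
    (fun τ hτ => ?_) (by ring_nf; omega)
  have hcnt : τ.real 0 3 = t := by rw [hτ.real0, h.cnt]
  have hbest : τ.real 0 4 = P.loss (τ.real 1) := by rw [hτ.real0, hτ.real1, h.best]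
  have hfeas : P.Feasible P.thr (τ.real 1) := by rw [hτ.real1]; exact h.feasible
  have hgrad : ∀ k < P.n, τ.real 3 k = 0 := by rw [hτ.real3]; exact h.grad_eq
  refine Reach.seq (B₁ := P.n * 80 + P.N * 120 + 70) (B₂ := 15) (M := fun υ => P.Frame υ ∧
    υ.real 0 3 = t ∧ ∑ k ∈ Finset.range P.n, υ.real 2 k = 0 ∧ P.Feasible P.thr (υ.real 1) ∧
    υ.real 0 4 = P.loss (υ.real 1) ∧ (∀ k < P.n, υ.real 3 k = 0) ∧
    (P.loss (υ.real 1) ≤ P.loss u + P.N * P.tol ∨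
      P.dist2 u (υ.real 2) ≤ P.dist2 u 0 - (t + 1) * (P.tol ^ 2 / 2))) ?_ ?_ (by omega)
  · refine Reach.ite (B := P.n * 80 + P.N * 120 + 60) (fun ht => ?_) (fun ht => ?_)
      (by simp [Test.cost, NatExpr.cost]; omega)
    · have hflag : 0 < τ.nat 0 4 := by simpa [Test.Holds, NatExpr.eval] using ht
      refine Reach.skip (by omega) ⟨hτ.frame, hcnt, hτ.sum_eq, hfeas, hbest, hgrad, ?_⟩
      rcases hτ.progress with ⟨h0, -⟩ | ⟨-, h1⟩
      · omega
      · rcases h.progress with h2 | h2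
        · left; rwa [hτ.real1]
        · right; linarith
    · have hflag : τ.nat 0 4 = 0 := by simpa [Test.Holds, NatExpr.eval] using ht
      rcases hτ.progress with ⟨-, hw, hcons⟩ | ⟨h1, -⟩
      swap
      · omega
      have hfw : P.Feasible P.thr (τ.real 2) := by
        rw [hw]
        exact ⟨h.sum_eq, fun x hx y hy hxy => hcons x hx y hy (.inl hx) hxy⟩
      refine Reach.seq (B₂ := P.n * 80 + 45) (reach_evalLoss hP hτ.frame hgrad) (fun υ hυ => ?_)
        (by omega)
      refine Reach.seq (B₂ := P.n * 50 + 11) (reach_recordBest hP hυ hbest hfeas hfw)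
        (fun ρ hρ => ?_) (by omega)
      refine (reach_descend hρ).mono le_rfl fun κ hκ => ?_
      obtain ⟨k1, k2, k3, k4, k5⟩ := hκ
      refine ⟨k1, k2.trans hcnt, ?_, by rw [k4]; exact hρ.feasible, k3, fun k hk => (k5 k hk).1, ?_⟩
      · rw [Finset.sum_congr rfl fun k hk => (k5 k (Finset.mem_range.1 hk)).2,
          Finset.sum_sub_distrib, ← Finset.mul_sum, sum_grad hP, hτ.sum_eq]
        ring
      · rw [k4]
        by_cases hl : P.loss (τ.real 2) ≤ P.loss u + P.N * P.tol
        · exact .inl (hρ.le_new.trans hl)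
        · rcases h.progress with h2 | h2
          · exact .inl (hρ.le_old.trans (by rwa [hτ.real1]))
          · right
            have := dist2_descend hP (not_le.1 hl) fun k hk => (k5 k hk).2
            rw [hw] at this
            linarith
  · rintro υ ⟨k1, k2, k3, k4, k5, k6, k7⟩
    refine Reach.setReal (by simp [NatExpr.cost, RealExpr.cost]) ?_
    have := Progress.count (t := t) k1 k3 k4 k5 k6 k7
    simpa [NatExpr.eval, RealExpr.eval, k2] using this

lemma reach_setUp {φ : ℝ} (hφ : P.level = Real.log φ) (hP : P.Valid) (u : ℕ → ℝ)
    {σ : Store} (hn : σ.nat 0 0 = P.n) (hN : σ.nat 0 1 = P.N)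
    (hrows : ∀ r ≠ 0, σ.nat r = P.rows r) (h0 : σ.real 0 0 = φ) (h3 : σ.real 0 3 = 0)
    (hr : ∀ r ≠ 0, σ.real r = 0) : Reach setUp σ 150 (P.Progress u 0) := by
  have hη : 0 ≤ P.tol := by unfold tol; positivity
  refine Reach.seq (B₁ := 16) (B₂ := 134) (M := fun τ => τ = σ.setReal 0 1 P.thr)
    (Reach.setReal (by simp [NatExpr.cost, RealExpr.cost]) ?_) ?_ (by omega)
  · simp [NatExpr.eval, RealExpr.eval, thr, tol, hφ, h0, hN]
  rintro τ rfl
  refine Reach.seq (B₁ := 50) (B₂ := 84) (M := fun τ => τ = (σ.setReal 0 1 P.thr).setReal 0 2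
    P.bound) (Reach.setReal (by simp [NatExpr.cost, RealExpr.cost]) ?_) ?_ (by omega)
  · simp only [NatExpr.eval, RealExpr.eval, Store.setReal_real_same, Store.setReal_nat, hn, hN,
      bound, hφ]
    rw [Function.update_of_ne (by omega), h0]
    congr 1; push_cast; ring
  rintro τ rfl
  refine Reach.seq (B₁ := 16) (B₂ := 68) (M := fun τ => τ = ((σ.setReal 0 1 P.thr).setReal 0 2
    P.bound).setReal 0 4 (P.N * Real.log 2))
    (Reach.setReal (by simp [NatExpr.cost, RealExpr.cost]) ?_) ?_ (by omega)
  · simp [NatExpr.eval, RealExpr.eval, hN]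
  rintro τ rfl
  refine Reach.seq (B₁ := 20) (B₂ := 48) (M := fun τ => τ = (((σ.setReal 0 1 P.thr).setReal 0 2
    P.bound).setReal 0 4 (P.N * Real.log 2)).setReal 0 8 (P.tol / 2))
    (Reach.setReal (by simp [NatExpr.cost, RealExpr.cost]) ?_) ?_ (by omega)
  · simp [NatExpr.eval, RealExpr.eval, hN, tol]
  rintro τ rfl
  refine Reach.seq (B₁ := 20) (B₂ := 28) (M := fun τ => τ = ((((σ.setReal 0 1 P.thr).setReal 0 2
    P.bound).setReal 0 4 (P.N * Real.log 2)).setReal 0 8 (P.tol / 2)).setReal 0 9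
      (P.tol / 2 / P.N))
    (Reach.setReal (by simp [NatExpr.cost, RealExpr.cost]) ?_) ?_ (by omega)
  · simp [NatExpr.eval, RealExpr.eval, hN]
  rintro τ rfl
  refine Reach.setReal (by simp [NatExpr.cost, RealExpr.cost]) ?_
  have hthr : 0 ≤ P.thr := add_nonneg hP.level_pos.le hη
  have hloss : P.loss 0 = P.N * Real.log 2 := by
    simp [loss, softplus]; norm_num
  refine ⟨⟨by simpa using hn, by simpa using hN, by simpa using hrows, ?_, ?_, ?_, ?_, ?_⟩,
    ?_, ?_, ?_, ?_, ?_, ?_⟩ <;>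
  simp [NatExpr.eval, RealExpr.eval, Store.setReal_real_ne, h0, h3, hr, hφ, Feasible, hthr, hloss]

lemma reach_rescale {b : ℕ → ℝ} {σ : Store} (hf : P.Frame σ) (hb : σ.real 1 = b) :
    Reach rescale σ (P.n * 30 + 11)
      (fun τ => ∀ k < P.n, τ.real 1 k = P.level / P.thr * b k) := by
  refine (Reach.forLoop (B := 15) (fun i τ => τ.nat 0 2 = i ∧ P.Frame τ ∧
    ∀ k < P.n, τ.real 1 k = if k < i then P.level / P.thr * b k else b k) (m := P.n)
    (fun k _ τ h => ⟨h.1, h.2.1.n_eq⟩) (fun i hi τ g => ?_)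
    ⟨by simp, hf.setNat (by omega) _, by simp [hb]⟩).mono (by omega)
      fun τ g k hk => by simpa [hk] using g.2.2 k hk
  obtain ⟨g1, g2, g3⟩ := g
  refine Reach.setReal (by simp [NatExpr.cost, RealExpr.cost]) ⟨by simpa using g1, by simp,
    (g2.setReal (by simp [NatExpr.eval]) _ _).setNat (by omega) _, fun k hk => ?_⟩
  by_cases hki : k = i
  · subst hki
    have := g3 k hk
    simp only [lt_irrefl, if_false] at this
    simp [NatExpr.eval, RealExpr.eval, g1, g2.ratio_eq, this]
  · have h1 : k < i + 1 ↔ k < i := by omega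
    simpa [NatExpr.eval, RealExpr.eval, g1, hki, h1] using g3 k hk

/-- A bound for the running time of the program. -/
def timeBound (P : Problem) : ℕ :=
  ⌈P.bound⌉₊ * (P.n * (P.n * 75 + 106) + P.N * 120 + 107) + P.n * 30 + 168

/-- The comparison point `u` enters only the analysis; the program does not know it. -/
theorem reach_mleProgram {φ : ℝ} (hφ : P.level = Real.log φ) (hP : P.Valid) {u : ℕ → ℝ}
    (hu : P.Feasible P.level u) (hdist : P.dist2 u 0 ≤ P.n ^ 3 * P.level ^ 2)
    {σ : Store} (hn : σ.nat 0 0 = P.n) (hN : σ.nat 0 1 = P.N)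
    (hrows : ∀ r ≠ 0, σ.nat r = P.rows r) (h0 : σ.real 0 0 = φ) (h3 : σ.real 0 3 = 0)
    (hr : ∀ r ≠ 0, σ.real r = 0) :
    Reach mleProgram σ P.timeBound (fun τ => ∃ b, P.Feasible P.thr b ∧
      P.loss b ≤ P.loss u + P.N * P.tol ∧ ∀ k < P.n, τ.real 1 k = P.level / P.thr * b k) := by
  have hNpos : (0 : ℝ) < P.N := by exact_mod_cast hP.N_pos
  refine Reach.seq (reach_setUp hφ hP u hn hN hrows h0 h3 hr)
    (B₂ := ⌈P.bound⌉₊ * (P.n * (P.n * 75 + 106) + P.N * 120 + 107) + P.n * 30 + 18)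
    (fun τ hτ => ?_) (by unfold timeBound; omega)
  -- The counter is a real cell, but it holds natural numbers: `t < bound` means `t < ⌈bound⌉₊`.
  have hloop := Reach.loop (t := .realLt (rreg 3) (rreg 2)) (p := pass) (P.Progress u) ⌈P.bound⌉₊
    (fun k _ σ hσ => by
      simp [Test.Holds, NatExpr.eval, RealExpr.eval, hσ.cnt, hσ.frame.bound_eq, Nat.lt_ceil])
    (fun k _ σ hσ => reach_pass hP hu hσ) hτ
  refine Reach.seq hloop (B₂ := P.n * 30 + 11) (fun υ hυ => ?_) ?_
  · refine (reach_rescale hυ.frame rfl).mono le_rfl fun ρ hρ => ⟨_, hυ.feasible, ?_, hρ⟩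
    rcases hυ.progress with h | h
    · exact h
    · exfalso
      have h1 : 0 ≤ P.dist2 u (υ.real 2) := Finset.sum_nonneg fun _ _ => sq_nonneg _
      have h2 : P.bound ≤ (⌈P.bound⌉₊ : ℝ) := Nat.le_ceil _
      have h3 : P.bound * (P.tol ^ 2 / 2) ≤ ⌈P.bound⌉₊ * (P.tol ^ 2 / 2) := by gcongr
      -- The summand 1 in `bound` leaves an excess of `η^2 / 2` over the initial distance, which
      -- would make the final distance negative.
      have h4 : P.bound * (P.tol ^ 2 / 2) = P.n ^ 3 * P.level ^ 2 + P.tol ^ 2 / 2 := by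
        unfold bound tol
        field_simp
        ring
      have h5 : 0 < P.tol := by unfold tol; positivity
      have h6 : 0 < P.tol ^ 2 / 2 := by positivity
      linarith
  · have : (Test.realLt (rreg 3) (rreg 2)).cost = 7 := rfl
    rw [this]
    have e : 7 + (P.n * (P.n * 75 + 106) + P.N * 120 + 100) =
      P.n * (P.n * 75 + 106) + P.N * 120 + 107 := by ring
    rw [e]; omega

end Problem

/-! ### Existence and computation of the constrained maximum likelihood estimate -/

/-- The winner of an example. -/
def winner {n : ℕ} (a : Example n) : Fin n := if a.2 then a.1.1.1 else a.1.1.2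

/-- The loser of an example. -/
def loser {n : ℕ} (a : Example n) : Fin n := if a.2 then a.1.1.2 else a.1.1.1

lemma negLogLik_eq {n N : ℕ} (s : Fin N → Example n) (w : EuclideanSpace ℝ (Fin n)) :
    negLogLik s w = 1 / N * ∑ i, softplus (w (loser (s i)) - w (winner (s i))) := by
  unfold negLogLik
  rw [neg_mul, ← mul_neg, ← Finset.sum_neg_distrib]
  congr 1
  refine Finset.sum_congr rfl fun i _ => ?_
  unfold winner loser
  cases (s i).2
  · simp only [Bool.false_eq_true, if_false]
    rw [add_comm, log_exp_add_exp]; ring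
  · simp only [if_true]
    rw [log_exp_add_exp]; ring

lemma continuous_negLogLik {n N : ℕ} (s : Fin N → Example n) : Continuous (negLogLik s) := by
  have h : negLogLik s = fun w => 1 / (N : ℝ) *
      ∑ i, softplus (w (loser (s i)) - w (winner (s i))) := funext (negLogLik_eq s)
  rw [h]
  have hs : Continuous softplus :=
    continuous_iff_continuousAt.2 fun x => (hasDerivAt_softplus x).continuousAt
  refine continuous_const.mul (continuous_finsetSum _ fun i _ => hs.comp ?_)
  fun_prop

lemma abs_sub_le_of_walk {n : ℕ} {G : SimpleGraph (Fin n)} {l : ℝ} {w : Fin n → ℝ}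
    (h : ∀ x y, G.Adj x y → |w x - w y| ≤ l) {x y : Fin n} (p : G.Walk x y) :
    |w x - w y| ≤ p.length * l := by
  induction p with
  | nil => simp
  | cons hadj p ih =>
    rw [SimpleGraph.Walk.length_cons]
    push_cast
    have h1 := h _ _ hadj
    have h2 := abs_sub_le (w _) (w _) (w _) |>.trans (add_le_add h1 ih)
    linarith

/-- A path in the connected graph has fewer than `n` edges, so all differences are at most `n log
φ`; as the coordinates sum to 0, `w x` is the average of its differences to the others. -/
lemma abs_le_of_mem_paramSet {n : ℕ} {G : SimpleGraph (Fin n)} (hG : G.Connected) {φ : ℝ}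
    (hφ : 1 < φ) {w : EuclideanSpace ℝ (Fin n)} (hw : w ∈ paramSet G φ) (x : Fin n) :
    |w x| ≤ n * Real.log φ := by
  have hl : 0 < Real.log φ := Real.log_pos hφ
  have hn : (0 : ℝ) < n := by exact_mod_cast x.pos
  have hdiff : ∀ y, |w x - w y| ≤ n * Real.log φ := by
    intro y
    obtain ⟨p, hp⟩ := (hG x y).exists_isPath
    have h1 := abs_sub_le_of_walk hw.2 p
    have h2 := hp.length_lt
    rw [Fintype.card_fin] at h2
    have h3 : (p.length : ℝ) ≤ n := by exact_mod_cast h2.le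
    exact h1.trans (by gcongr)
  have hsum : (n : ℝ) * w x = ∑ y, (w x - w y) := by
    rw [Finset.sum_sub_distrib, hw.1]; simp
  have h1 : (n : ℝ) * |w x| ≤ n * (n * Real.log φ) := by
    calc (n : ℝ) * |w x| = |∑ y, (w x - w y)| := by rw [← hsum, abs_mul, abs_of_pos hn]
      _ ≤ ∑ y, |w x - w y| := Finset.abs_sum_le_sum_abs _ _
      _ ≤ ∑ _y : Fin n, n * Real.log φ := Finset.sum_le_sum fun y _ => hdiff y
      _ = _ := by simp
  exact le_of_mul_le_mul_left h1 hn

lemma zero_mem_paramSet {n : ℕ} (G : SimpleGraph (Fin n)) {φ : ℝ} (hφ : 1 < φ) :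
    (0 : EuclideanSpace ℝ (Fin n)) ∈ paramSet G φ := by
  have := (Real.log_pos hφ).le
  exact ⟨by simp, fun x y _ => by simpa using this⟩

lemma isCompact_paramSet {n : ℕ} {G : SimpleGraph (Fin n)} (hG : G.Connected) {φ : ℝ}
    (hφ : 1 < φ) : IsCompact (paramSet G φ) := by
  refine Metric.isCompact_of_isClosed_isBounded ?_ ?_
  · have : paramSet G φ = {w | ∑ x, w x = 0} ∩
        ⋂ x, ⋂ y, ⋂ (_ : G.Adj x y), {w | |w x - w y| ≤ Real.log φ} := by
      ext w; simp [paramSet]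
    rw [this]
    refine IsClosed.inter (isClosed_eq (by fun_prop) continuous_const) ?_
    exact isClosed_iInter fun x => isClosed_iInter fun y => isClosed_iInter fun _ =>
      isClosed_le (by fun_prop) continuous_const
  · rw [isBounded_iff_forall_norm_le]
    refine ⟨√(∑ _x : Fin n, (n * Real.log φ) ^ 2), fun w hw => ?_⟩
    rw [EuclideanSpace.norm_eq]
    refine Real.sqrt_le_sqrt (Finset.sum_le_sum fun x _ => ?_)
    rw [Real.norm_eq_abs]
    exact pow_le_pow_left₀ (abs_nonneg _) (abs_le_of_mem_paramSet hG hφ hw x) 2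

lemma exists_isConstrainedMLE {n N : ℕ} {G : SimpleGraph (Fin n)} (hG : G.Connected) {φ : ℝ}
    (hφ : 1 < φ) (s : Fin N → Example n) : ∃ w, IsConstrainedMLE G φ s w := by
  obtain ⟨w, hw, hmin⟩ := (isCompact_paramSet hG hφ).exists_isMinOn
    ⟨0, zero_mem_paramSet G hφ⟩ (continuous_negLogLik s).continuousOn
  exact ⟨w, hw, fun v hv => hmin hv⟩

/-- The problem that is stored in the input of the program. -/
def inputProblem {n N : ℕ} (G : SimpleGraph (Fin n)) (φ : ℝ) (s : Fin N → Example n) :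
    Problem where
  n := n
  N := N
  rows := (inputStore G φ s).nat
  level := Real.log φ

/-- Extend a vector by zeros. -/
def extend {n : ℕ} (w : EuclideanSpace ℝ (Fin n)) (k : ℕ) : ℝ := if h : k < n then w ⟨k, h⟩ else 0

@[simp] lemma extend_apply {n : ℕ} (w : EuclideanSpace ℝ (Fin n)) (x : Fin n) :
    extend w x = w x := by simp [extend]

/-! ### The input store as an optimization problem -/

section

variable {n N : ℕ} {G : SimpleGraph (Fin n)} {φ : ℝ} {s : Fin N → Example n}

lemma inputProblem_adj {x y : ℕ} :
    (inputProblem G φ s).adj x y ↔ ∃ (hx : x < n) (hy : y < n), G.Adj ⟨x, hx⟩ ⟨y, hy⟩ := by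
  unfold Problem.adj inputProblem inputStore
  simp only
  by_cases h : x < n ∧ y < n
  · by_cases h' : G.Adj ⟨x, h.1⟩ ⟨y, h.2⟩ <;> simp [h, h']
  · rw [dif_neg h]
    simp only [lt_irrefl, false_iff]
    rintro ⟨hx, hy, -⟩
    exact h ⟨hx, hy⟩

lemma inputProblem_win (i : Fin N) : (inputProblem G φ s).win i = winner (s i) := by
  unfold Problem.win inputProblem inputStore winner
  cases h : (s i).2 <;> simp [h]

lemma inputProblem_los (i : Fin N) : (inputProblem G φ s).los i = loser (s i) := by
  unfold Problem.los inputProblem inputStore loser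
  cases h : (s i).2 <;> simp [h]

lemma adj_winner_loser {a : Example n} (h : G.Adj a.1.1.1 a.1.1.2) :
    G.Adj (winner a) (loser a) := by
  unfold winner loser
  cases a.2
  · simpa using h.symm
  · simpa using h

lemma inputProblem_valid (hn : 2 ≤ n) (hN : n ≤ N + 1) (hφ : 1 < φ)
    (hs : ∀ i, G.Adj (s i).1.1.1 (s i).1.1.2) : (inputProblem G φ s).Valid where
  n_pos := by simp only [inputProblem]; omega
  N_pos := by simp only [inputProblem]; omega
  level_pos := Real.log_pos hφ
  adj_irrefl x h := by
    obtain ⟨_, _, h⟩ := inputProblem_adj.1 h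
    exact G.irrefl h
  win_lt i hi := by
    have := inputProblem_win (G := G) (φ := φ) (s := s) ⟨i, hi⟩
    rw [this]; exact Fin.is_lt _
  los_lt i hi := by
    have := inputProblem_los (G := G) (φ := φ) (s := s) ⟨i, hi⟩
    rw [this]; exact Fin.is_lt _
  adj_win_los i hi := by
    have h1 := inputProblem_win (G := G) (φ := φ) (s := s) ⟨i, hi⟩
    have h2 := inputProblem_los (G := G) (φ := φ) (s := s) ⟨i, hi⟩
    rw [h1, h2, inputProblem_adj]
    exact ⟨Fin.is_lt _, Fin.is_lt _, adj_winner_loser (hs _)⟩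
  adj_los_win i hi := by
    have h1 := inputProblem_win (G := G) (φ := φ) (s := s) ⟨i, hi⟩
    have h2 := inputProblem_los (G := G) (φ := φ) (s := s) ⟨i, hi⟩
    rw [h1, h2, inputProblem_adj]
    exact ⟨Fin.is_lt _, Fin.is_lt _, (adj_winner_loser (hs _)).symm⟩

lemma inputProblem_loss (hN : 0 < N) (b : ℕ → ℝ) (w : EuclideanSpace ℝ (Fin n))
    (h : ∀ x : Fin n, b x = w x) : (inputProblem G φ s).loss b = N * negLogLik s w := by
  have hN' : (N : ℝ) ≠ 0 := by positivity
  rw [negLogLik_eq, ← mul_assoc, mul_one_div_cancel hN', one_mul]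
  change ∑ i ∈ Finset.range N, softplus (b ((inputProblem G φ s).los i)
    - b ((inputProblem G φ s).win i)) = _
  rw [Finset.sum_range]
  refine Finset.sum_congr rfl fun i _ => ?_
  rw [inputProblem_win, inputProblem_los, h, h]

lemma inputProblem_feasible {u : EuclideanSpace ℝ (Fin n)} (hu : u ∈ paramSet G φ) :
    (inputProblem G φ s).Feasible (inputProblem G φ s).level (extend u) := by
  constructor
  · rw [Finset.sum_range, ← hu.1]
    exact Finset.sum_congr rfl fun x _ => extend_apply u x
  · intro x hx y hy hxy
    obtain ⟨hx', hy', h⟩ := inputProblem_adj.1 hxy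
    have := (abs_le.1 (hu.2 _ _ h)).2
    change extend u x - extend u y ≤ Real.log φ
    simpa only [extend, hx', hy', dif_pos] using this

lemma inputProblem_dist2 (hG : G.Connected) (hφ : 1 < φ) {u : EuclideanSpace ℝ (Fin n)}
    (hu : u ∈ paramSet G φ) :
    (inputProblem G φ s).dist2 (extend u) 0 ≤
      (inputProblem G φ s).n ^ 3 * (inputProblem G φ s).level ^ 2 := by
  change ∑ k ∈ Finset.range n, (0 - extend u k) ^ 2 ≤ (n : ℝ) ^ 3 * Real.log φ ^ 2
  rw [Finset.sum_range]
  calc _ ≤ ∑ _x : Fin n, (n * Real.log φ) ^ 2 := by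
        refine Finset.sum_le_sum fun x _ => ?_
        have := abs_le_of_mem_paramSet hG hφ hu x
        rw [extend_apply]
        simpa using pow_le_pow_left₀ (abs_nonneg _) this 2
    _ = _ := by simp; ring

/-- The running time of `mleProgram` as a polynomial in the sample size. -/
def timePoly (φ : ℝ) : Polynomial ℕ :=
  (8 * Polynomial.C ⌈Real.log φ ^ 2⌉₊ * (Polynomial.X + 1) ^ 5 + 1) *
    ((Polynomial.X + 1) * ((Polynomial.X + 1) * 75 + 106) + Polynomial.X * 120 + 107) +
    (Polynomial.X + 1) * 30 + 168

/-- Since `n ≤ N + 1`, every power of `n` is absorbed by a power of `N + 1`; the only dependence on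
`φ` is through a coefficient. -/
lemma timeBound_le (hN : n ≤ N + 1) :
    (inputProblem G φ s).timeBound ≤ (timePoly φ).eval N := by
  have hb : ⌈(inputProblem G φ s).bound⌉₊ ≤ 8 * ⌈Real.log φ ^ 2⌉₊ * (N + 1) ^ 5 + 1 := by
    rw [Nat.ceil_le]
    push_cast
    unfold Problem.bound inputProblem
    simp only
    have h1 : (n : ℝ) ≤ N + 1 := by exact_mod_cast hN
    have h2 : Real.log φ ^ 2 ≤ (⌈Real.log φ ^ 2⌉₊ : ℝ) := Nat.le_ceil _
    have h3 : (N : ℝ) ≤ N + 1 := by linarith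
    calc 8 * (n : ℝ) ^ 3 * Real.log φ ^ 2 * (N : ℝ) ^ 2 + 1
        ≤ 8 * ((N : ℝ) + 1) ^ 3 * (⌈Real.log φ ^ 2⌉₊ : ℝ) * ((N : ℝ) + 1) ^ 2 + 1 := by gcongr
      _ = _ := by ring
  have he : (timePoly φ).eval N = (8 * ⌈Real.log φ ^ 2⌉₊ * (N + 1) ^ 5 + 1) *
      ((N + 1) * ((N + 1) * 75 + 106) + N * 120 + 107) + (N + 1) * 30 + 168 := by
    simp [timePoly]
  rw [he]
  unfold Problem.timeBound
  have e1 : (inputProblem G φ s).n = n := rfl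
  have e2 : (inputProblem G φ s).N = N := rfl
  rw [e1, e2]
  gcongr

/-- The program computes an approximate constrained maximum likelihood estimate. -/
theorem mleProgram_spec (hn : 2 ≤ n) (hG : G.Connected) (hφ : 1 < φ)
    (hs : ∀ i, G.Adj (s i).1.1.1 (s i).1.1.2) (hN : n ≤ N + 1) :
    ∃ w ∈ paramSet G φ, OutputsWithin mleProgram (inputStore G φ s) ((timePoly φ).eval N) w ∧
      ∀ v ∈ paramSet G φ, negLogLik s w ≤ negLogLik s v + 1 / (N : ℝ) := by
  have hN0 : 0 < N := by omega
  have hN' : (0 : ℝ) < N := by exact_mod_cast hN0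
  obtain ⟨u, hu, humin⟩ := exists_isConstrainedMLE hG hφ s
  set P := inputProblem G φ s with hPdef
  have hP : P.Valid := inputProblem_valid hn hN hφ hs
  obtain ⟨k, τ, hrun, hk, b, hb, hloss, hout⟩ := Problem.reach_mleProgram (φ := φ) (P := P) rfl hP
    (inputProblem_feasible hu) (inputProblem_dist2 hG hφ hu) (σ := inputStore G φ s)
    (by simp [inputStore, hPdef, inputProblem]) (by simp [inputStore, hPdef, inputProblem])
    (fun r _ => rfl) (by simp [inputStore]) (by simp [inputStore])
    (fun r hr => by funext c; simp [inputStore, hr])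
  have hl : 0 < P.level := hP.level_pos
  have htol : 0 < P.tol := by
    have : (0 : ℝ) < P.N := hN'
    unfold Problem.tol; positivity
  have hthr : 0 < P.thr := add_pos hl htol
  -- The best point satisfies the constraints only up to `η`; the factor `c` restores them exactly
  -- and keeps the sum 0.
  set c := P.level / P.thr with hc
  have hc0 : 0 < c := div_pos hl hthr
  have hc1 : c ≤ 1 := by rw [hc, div_le_one hthr]; unfold Problem.thr; linarith
  have hct : c * P.thr = P.level := by rw [hc]; field_simp
  have hdiff : ∀ x y : Fin n, G.Adj x y → |b x - b y| ≤ P.thr := by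
    intro x y hxy
    have h1 := hb.2 x x.2 y y.2 (inputProblem_adj.2 ⟨x.2, y.2, hxy⟩)
    have h2 := hb.2 y y.2 x x.2 (inputProblem_adj.2 ⟨y.2, x.2, hxy.symm⟩)
    exact abs_le.2 ⟨by linarith, h1⟩
  let w : EuclideanSpace ℝ (Fin n) := WithLp.toLp 2 fun x => c * b x
  have hw : ∀ x, w x = c * b x := fun x => rfl
  have hwmem : w ∈ paramSet G φ := by
    refine ⟨?_, fun x y hxy => ?_⟩
    · simp only [hw]
      rw [← Finset.mul_sum]
      have := hb.1
      rw [Finset.sum_range] at this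
      change ∑ x : Fin n, b x = 0 at this
      rw [this, mul_zero]
    · rw [hw, hw, ← mul_sub, abs_mul, abs_of_pos hc0]
      calc c * |b x - b y| ≤ c * P.thr := by gcongr; exact hdiff x y hxy
        _ = Real.log φ := hct
  refine ⟨w, hwmem, ⟨k, τ, hrun, hk.trans (timeBound_le hN), fun x => hout x x.2⟩, fun v hv => ?_⟩
  let b' : EuclideanSpace ℝ (Fin n) := WithLp.toLp 2 fun x => b x
  rw [inputProblem_loss hN0 b b' (fun _ => rfl),
    inputProblem_loss hN0 (extend u) u (fun x => extend_apply u x)] at hloss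
  -- Scaling changes each relevant difference by at most `(1 - c) * thr = η`, hence each logistic
  -- loss by at most `η`.
  have h1 : negLogLik s w ≤ negLogLik s b' + P.tol := by
    rw [negLogLik_eq, negLogLik_eq]
    have : ∑ i, softplus (w (loser (s i)) - w (winner (s i))) ≤
        ∑ i, (softplus (b' (loser (s i)) - b' (winner (s i))) + P.tol) := by
      refine Finset.sum_le_sum fun i _ => ?_
      refine (softplus_le_add_abs (b' (loser (s i)) - b' (winner (s i))) _).trans
        (add_le_add_right ?_ _)
      have hd := hdiff _ _ (adj_winner_loser (hs i)).symm
      have e : w (loser (s i)) - w (winner (s i)) - (b' (loser (s i)) - b' (winner (s i)))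
          = -((1 - c) * (b (loser (s i)) - b (winner (s i)))) := by
        rw [hw, hw]; simp only [b']; ring
      rw [e, abs_neg, abs_mul, abs_of_nonneg (by linarith)]
      calc (1 - c) * |b (loser (s i)) - b (winner (s i))| ≤ (1 - c) * P.thr :=
            mul_le_mul_of_nonneg_left hd (by linarith)
        _ = P.tol := by rw [sub_mul, hct, one_mul]; unfold Problem.thr; ring
    rw [Finset.sum_add_distrib] at this
    calc _ ≤ 1 / (N : ℝ) * (∑ i, softplus (b' (loser (s i)) - b' (winner (s i)))
          + ∑ _i : Fin N, P.tol) := by gcongr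
      _ = _ := by
        rw [mul_add]; simp; field_simp
  have h2 : negLogLik s b' ≤ negLogLik s u + P.tol := by
    have e : (P.N : ℝ) = N := rfl
    rw [e, ← mul_add] at hloss
    exact le_of_mul_le_mul_left hloss hN'
  have h3 := humin v hv
  have h4 : P.tol + P.tol = 1 / (N : ℝ) := by
    unfold Problem.tol
    have e : (P.N : ℝ) = N := rfl
    rw [e]; field_simp; norm_num
  linarith

end

/-! ### The second smallest eigenvalue -/

/-- The eigenvalues are listed in decreasing order, so `j₀` carries the last one, of index `n - 1`,
and `j₁` the one of index `n - 2`, which is `fiedler`. -/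
lemma exists_eigenbasis {n : ℕ} (hn : 2 ≤ n) {A : Matrix (Fin n) (Fin n) ℝ}
    (hA : A.IsHermitian) :
    ∃ (u : Fin n → Fin n → ℝ) (l : Fin n → ℝ) (j₀ j₁ : Fin n),
      (∀ j k, u j ⬝ᵥ u k = if j = k then 1 else 0) ∧ (∀ j, A *ᵥ u j = l j • u j) ∧
      (∀ w : Fin n → ℝ, w = ∑ j, (u j ⬝ᵥ w) • u j) ∧
      (∀ j ≠ j₀, fiedler hn hA ≤ l j) ∧ j₁ ≠ j₀ ∧ l j₁ = fiedler hn hA ∧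
      l j₀ ≤ fiedler hn hA := by
  let e : Fin (Fintype.card (Fin n)) ≃ Fin n := Fintype.equivOfCardEq (Fintype.card_fin _)
  have hcard : Fintype.card (Fin n) = n := Fintype.card_fin n
  let b := hA.eigenvectorBasis
  have hl : ∀ i, hA.eigenvalues i = hA.eigenvalues₀ (e.symm i) := fun i => rfl
  refine ⟨fun j x => b j x, hA.eigenvalues, e ⟨n - 1, by omega⟩, e ⟨n - 2, by omega⟩,
    fun j k => ?_, fun j => hA.mulVec_eigenvectorBasis j, fun w => ?_, fun j hj => ?_, ?_, ?_, ?_⟩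
  · have h := orthonormal_iff_ite.1 b.orthonormal k j
    rw [EuclideanSpace.inner_eq_star_dotProduct] at h
    simp only [star_trivial] at h
    rw [← ite_cond_congr (propext (eq_comm (a := k) (b := j)))]
    exact h
  · have h := b.sum_repr' (WithLp.toLp 2 w)
    funext x
    have hx := congrArg (fun v : EuclideanSpace ℝ (Fin n) => v x) h
    simp only [WithLp.ofLp_sum, Finset.sum_apply, WithLp.ofLp_smul, Pi.smul_apply] at hx
    rw [← hx, Finset.sum_apply]
    refine Finset.sum_congr rfl fun j _ => ?_
    rw [EuclideanSpace.inner_eq_star_dotProduct]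
    simp [dotProduct_comm]
  · rw [hl]
    refine hA.eigenvalues₀_antitone ?_
    have : e.symm j ≠ ⟨n - 1, by omega⟩ := fun h => hj (by rw [← h]; simp)
    rw [Fin.le_def]
    have h1 := (e.symm j).2
    have h2 : (e.symm j : ℕ) ≠ n - 1 := fun h => this (Fin.ext h)
    simp only
    omega
  · intro h
    have := e.injective h
    rw [Fin.mk.injEq] at this
    omega
  · rw [hl]; simp [fiedler]
  · rw [hl]
    refine hA.eigenvalues₀_antitone ?_
    rw [Fin.le_def]; simp; omega

lemma dotProduct_mulVec_sum {n : ℕ} {A : Matrix (Fin n) (Fin n) ℝ} (hA : A.IsHermitian)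
    (v w : Fin n → ℝ) : v ⬝ᵥ (A *ᵥ w) = (A *ᵥ v) ⬝ᵥ w := by
  have : Aᵀ = A := by
    have := hA.eq
    rwa [Matrix.conjTranspose_eq_transpose_of_trivial] at this
  rw [Matrix.dotProduct_mulVec, ← Matrix.mulVec_transpose, this]

/-- If the rows of `A` sum to `0` and the second smallest eigenvalue is positive, the eigenvectors
for the larger eigenvalues span the vectors of sum `0`. -/
lemma exists_eigenbasis_sum_zero {n : ℕ} (hn : 2 ≤ n) {A : Matrix (Fin n) (Fin n) ℝ}
    (hA : A.IsHermitian) (h1 : A *ᵥ 1 = 0) (hpos : 0 < fiedler hn hA) :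
    ∃ (u : Fin n → Fin n → ℝ) (l : Fin n → ℝ) (S : Finset (Fin n)), S.Nonempty ∧
      (∀ j k, u j ⬝ᵥ u k = if j = k then 1 else 0) ∧ (∀ j, A *ᵥ u j = l j • u j) ∧
      (∀ j ∈ S, fiedler hn hA ≤ l j) ∧
      (∀ w : Fin n → ℝ, ∑ x, w x = 0 → w = ∑ j ∈ S, (u j ⬝ᵥ w) • u j) := by
  obtain ⟨u, l, j₀, j₁, ho, he, hsp, hge, hne, -, -⟩ := exists_eigenbasis hn hA
  refine ⟨u, l, Finset.univ.erase j₀, ⟨j₁, by simp [hne]⟩, ho, he,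
    fun j hj => hge j (Finset.ne_of_mem_erase hj), fun w hw => ?_⟩
  -- An eigenvector with nonzero eigenvalue is orthogonal to the kernel vector `1`. Hence `1` is a
  -- multiple of `u j₀`, and a vector of sum 0 has no component along `u j₀`.
  have horth : ∀ j ≠ j₀, u j ⬝ᵥ 1 = 0 := by
    intro j hj
    have h := dotProduct_mulVec_sum hA (u j) 1
    rw [h1, dotProduct_zero, he, smul_dotProduct, smul_eq_mul] at h
    have : l j ≠ 0 := (hpos.trans_le (hge j hj)).ne'
    exact (mul_eq_zero.1 h.symm).resolve_left this
  have hone : (1 : Fin n → ℝ) = (u j₀ ⬝ᵥ 1) • u j₀ := by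
    conv_lhs => rw [hsp 1]
    rw [Finset.sum_eq_single j₀ (fun j _ hj => by rw [horth j hj, zero_smul]) (by simp)]
  have h0 : u j₀ ⬝ᵥ w = 0 := by
    have hw' : (1 : Fin n → ℝ) ⬝ᵥ w = 0 := by simpa [dotProduct] using hw
    rw [hone, smul_dotProduct, smul_eq_mul] at hw'
    refine (mul_eq_zero.1 hw').resolve_left fun hc => ?_
    rw [hc, zero_smul] at hone
    have := congrFun hone j₀
    simp at this
  conv_lhs => rw [hsp w, ← Finset.add_sum_erase _ _ (Finset.mem_univ j₀), h0, zero_smul, zero_add]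

section combination

variable {n : ℕ} {A : Matrix (Fin n) (Fin n) ℝ} {u : Fin n → Fin n → ℝ} {l : Fin n → ℝ}
  {S : Finset (Fin n)}

lemma dotProduct_eq_sum {w : Fin n → ℝ} (hw : w = ∑ j ∈ S, (u j ⬝ᵥ w) • u j) (v : Fin n → ℝ) :
    w ⬝ᵥ v = ∑ j ∈ S, (u j ⬝ᵥ w) * (u j ⬝ᵥ v) := by
  conv_lhs => rw [hw]
  rw [sum_dotProduct]
  exact Finset.sum_congr rfl fun j _ => by rw [smul_dotProduct, smul_eq_mul]

lemma quadratic_eq_sum (hA : A.IsHermitian) (he : ∀ j, A *ᵥ u j = l j • u j)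
    {w : Fin n → ℝ} (hw : w = ∑ j ∈ S, (u j ⬝ᵥ w) • u j) :
    w ⬝ᵥ (A *ᵥ w) = ∑ j ∈ S, l j * (u j ⬝ᵥ w) ^ 2 := by
  rw [dotProduct_eq_sum hw]
  refine Finset.sum_congr rfl fun j _ => ?_
  rw [dotProduct_mulVec_sum hA, he, smul_dotProduct, smul_eq_mul]
  ring

lemma fiedler_mul_le {hn : 2 ≤ n} (hA : A.IsHermitian) (h1 : A *ᵥ 1 = 0)
    (hpos : 0 < fiedler hn hA) {w : Fin n → ℝ} (hw : ∑ x, w x = 0) :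
    fiedler hn hA * (w ⬝ᵥ w) ≤ w ⬝ᵥ (A *ᵥ w) := by
  obtain ⟨u, l, S, -, -, he, hge, hsp⟩ := exists_eigenbasis_sum_zero hn hA h1 hpos
  rw [quadratic_eq_sum hA he (hsp w hw), dotProduct_eq_sum (hsp w hw), Finset.mul_sum]
  refine Finset.sum_le_sum fun j hj => ?_
  rw [← sq]
  exact mul_le_mul_of_nonneg_right (hge j hj) (sq_nonneg _)

/-- A lower bound of the quadratic form on the vectors of sum `0` is a lower bound of the second
smallest eigenvalue. -/
lemma le_fiedler (hn : 2 ≤ n) (hA : A.IsHermitian) {c : ℝ}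
    (h : ∀ w : Fin n → ℝ, ∑ x, w x = 0 → c * (w ⬝ᵥ w) ≤ w ⬝ᵥ (A *ᵥ w)) :
    c ≤ fiedler hn hA := by
  obtain ⟨u, l, j₀, j₁, ho, he, hsp, hge, hne, hl1, hl0⟩ := exists_eigenbasis hn hA
  -- Courant–Fischer: the span of the eigenvectors of the two smallest eigenvalues meets the
  -- hyperplane of sum 0 in a nonzero vector, whose Rayleigh quotient is at most the larger of the
  -- two.
  obtain ⟨a, b, hab, hsum⟩ : ∃ a b : ℝ, (a ≠ 0 ∨ b ≠ 0) ∧ ∑ x, (a • u j₀ + b • u j₁) x = 0 := by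
    by_cases h0 : ∑ x, u j₀ x = 0
    · exact ⟨1, 0, by simp, by simpa using h0⟩
    · refine ⟨-∑ x, u j₁ x, ∑ x, u j₀ x, .inr h0, ?_⟩
      simp only [Pi.add_apply, Pi.smul_apply, smul_eq_mul, Finset.sum_add_distrib,
        ← Finset.mul_sum]
      ring
  have hw := h _ hsum
  have e1 : (a • u j₀ + b • u j₁) ⬝ᵥ (a • u j₀ + b • u j₁) = a ^ 2 + b ^ 2 := by
    simp [add_dotProduct, dotProduct_add, ho, hne, hne.symm]; ring
  have e2 : (a • u j₀ + b • u j₁) ⬝ᵥ (A *ᵥ (a • u j₀ + b • u j₁))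
      = l j₀ * a ^ 2 + l j₁ * b ^ 2 := by
    simp [Matrix.mulVec_add, Matrix.mulVec_smul, he, add_dotProduct, dotProduct_add, ho, hne,
      hne.symm]; ring
  rw [e1, e2, hl1] at hw
  have hpos : 0 < a ^ 2 + b ^ 2 := by
    rcases hab with h | h <;> positivity
  have : l j₀ * a ^ 2 ≤ fiedler hn hA * a ^ 2 := by gcongr
  by_contra hc
  nlinarith

end combination

/-! ### The Laplacians as quadratic forms -/

lemma pairVec_dotProduct {n : ℕ} (p : Pair n) (w : Fin n → ℝ) :
    pairVec p ⬝ᵥ w = w p.1.1 - w p.1.2 := by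
  simp [pairVec, sub_dotProduct]

lemma empiricalLaplacian_bilin {n N : ℕ} (e : Fin N → Pair n) (v w : Fin n → ℝ) :
    v ⬝ᵥ (empiricalLaplacian e *ᵥ w)
      = 1 / N * ∑ i, (pairVec (e i) ⬝ᵥ v) * (pairVec (e i) ⬝ᵥ w) := by
  unfold empiricalLaplacian
  rw [Matrix.smul_mulVec, dotProduct_smul, smul_eq_mul, Matrix.sum_mulVec, dotProduct_sum]
  congr 1
  refine Finset.sum_congr rfl fun i _ => ?_
  rw [Matrix.vecMulVec_mulVec]
  simp [dotProduct_comm v, mul_comm]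

lemma pairProb_self {n : ℕ} (Q : PMF (Pair n)) (x : Fin n) : pairProb Q x x = 0 := by
  simp [pairProb]

lemma sum_pair {n : ℕ} (Q : PMF (Pair n)) (f : Fin n → Fin n → ℝ) :
    ∑ p, (Q p).toReal * f p.1.1 p.1.2
      = ∑ x, ∑ y, if x < y then pairProb Q x y * f x y else 0 := by
  rw [← Fintype.sum_prod_type' (f := fun x y => if x < y then pairProb Q x y * f x y else 0),
    ← Finset.sum_filter, Finset.sum_subtype (p := fun q : Fin n × Fin n => q.1 < q.2) _ (by simp)]
  refine Finset.sum_congr rfl fun p _ => ?_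
  simp [pairProb, p.2]

lemma laplacian_bilin {n : ℕ} (Q : PMF (Pair n)) (v w : Fin n → ℝ) :
    v ⬝ᵥ (laplacian Q *ᵥ w)
      = ∑ p, (Q p).toReal * ((pairVec p ⬝ᵥ v) * (pairVec p ⬝ᵥ w)) := by
  simp only [pairVec_dotProduct]
  rw [sum_pair Q fun x y => (v x - v y) * (w x - w y)]
  have h1 : v ⬝ᵥ (laplacian Q *ᵥ w) = ∑ x, ∑ y, pairProb Q x y * (v x * (w x - w y)) := by
    simp only [dotProduct, Matrix.mulVec]
    refine Finset.sum_congr rfl fun x _ => ?_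
    have : ∑ y, laplacian Q x y * w y = ∑ y, pairProb Q x y * (w x - w y) := by
      have : ∀ y, laplacian Q x y * w y = (if x = y then (∑ z, pairProb Q x z) * w x else 0)
          - pairProb Q x y * w y := by
        intro y
        by_cases h : x = y
        · subst h; simp [laplacian, pairProb_self]
        · simp [laplacian, h]
      simp only [this, Finset.sum_sub_distrib, Finset.sum_ite_eq, Finset.mem_univ, if_true,
        mul_sub, Finset.sum_mul]
    rw [this, Finset.mul_sum]
    exact Finset.sum_congr rfl fun y _ => by ring
  -- The row sums run over ordered pairs; both orders are collected at the representative with `x <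
  -- y`.
  have h2 : ∀ f : Fin n → Fin n → ℝ, (∀ x, f x x = 0) → ∑ x, ∑ y, f x y
      = ∑ x, ∑ y, if x < y then f x y + f y x else 0 := by
    intro f hf
    have : ∀ x y, f x y = (if x < y then f x y else 0) + (if y < x then f x y else 0) := by
      intro x y
      rcases lt_trichotomy x y with h | h | h
      · simp [h, h.not_gt]
      · subst h; simp [hf]
      · simp [h, h.not_gt]
    calc ∑ x, ∑ y, f x y = ∑ x, ∑ y, (if x < y then f x y else 0)
          + ∑ x, ∑ y, (if y < x then f x y else 0) := by
          simp only [← Finset.sum_add_distrib]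
          exact Finset.sum_congr rfl fun x _ => Finset.sum_congr rfl fun y _ => this x y
      _ = ∑ x, ∑ y, (if x < y then f x y else 0)
          + ∑ x, ∑ y, (if x < y then f y x else 0) := by
          congr 1; rw [Finset.sum_comm]
      _ = _ := by
          simp only [← Finset.sum_add_distrib]
          refine Finset.sum_congr rfl fun x _ => Finset.sum_congr rfl fun y _ => ?_
          split_ifs <;> simp
  rw [h1, h2 _ (by simp)]
  refine Finset.sum_congr rfl fun x _ => Finset.sum_congr rfl fun y _ => ?_
  rw [pairProb_comm Q y x]
  split_ifs <;> ring

lemma eq_zero_of_dotProduct {n : ℕ} {a : Fin n → ℝ} (h : ∀ v : Fin n → ℝ, v ⬝ᵥ a = 0) : a = 0 :=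
  dotProduct_self_eq_zero.1 (h a)

lemma empiricalLaplacian_mulVec_one {n N : ℕ} (e : Fin N → Pair n) :
    empiricalLaplacian e *ᵥ 1 = 0 :=
  eq_zero_of_dotProduct fun v => by
    rw [empiricalLaplacian_bilin]; simp [pairVec_dotProduct]

lemma laplacian_mulVec_one {n : ℕ} (Q : PMF (Pair n)) : laplacian Q *ᵥ 1 = 0 :=
  eq_zero_of_dotProduct fun v => by
    rw [laplacian_bilin]; simp [pairVec_dotProduct]

/-- If the second smallest eigenvalue of the empirical Laplacian is positive, the sample is not
small. -/
lemma le_of_fiedler_pos {n N : ℕ} (hn : 2 ≤ n) (e : Fin N → Pair n)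
    (h : 0 < fiedler hn (empiricalLaplacian_isHermitian e)) : n ≤ N + 1 := by
  by_contra hN
  let g (x : Fin n) : (Fin n → ℝ) →ₗ[ℝ] ℝ := LinearMap.proj x
  -- The sum and the `N` measurements are `N + 1 < n` linear functionals, so they have a common
  -- nonzero zero `w`; the quadratic form vanishes there although `w` has sum 0.
  let f : (Fin n → ℝ) →ₗ[ℝ] (Option (Fin N) → ℝ) := LinearMap.pi fun o =>
    o.elim (∑ x, g x) fun i => g (e i).1.1 - g (e i).1.2
  have hker : LinearMap.ker f ≠ ⊥ := LinearMap.ker_ne_bot_of_finrank_lt (by simp; omega)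
  obtain ⟨w, hw, hw0⟩ := (Submodule.ne_bot_iff _).1 hker
  rw [LinearMap.mem_ker] at hw
  have hsum : ∑ x, w x = 0 := by simpa [f, g] using congrFun hw none
  have hi : ∀ i, w (e i).1.1 - w (e i).1.2 = 0 := fun i => by simpa [f, g] using congrFun hw (some i)
  have := fiedler_mul_le (hn := hn) (empiricalLaplacian_isHermitian e)
    (empiricalLaplacian_mulVec_one e) h hsum
  rw [empiricalLaplacian_bilin] at this
  simp only [pairVec_dotProduct, hi, mul_zero, Finset.sum_const_zero] at this
  have h2 : 0 < w ⬝ᵥ w := lt_of_le_of_ne (by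
    exact Finset.sum_nonneg fun x _ => mul_self_nonneg _) fun h => hw0 (dotProduct_self_eq_zero.1 h.symm)
  nlinarith [mul_pos h h2]

/-- Otherwise the two smallest eigenvalues are at most 0. Their eigenvectors then have zero energy,
are constant along the edges and so, by connectedness, constant; two constant vectors cannot be
orthonormal. -/
lemma fiedler_laplacian_pos {n : ℕ} (hn : 2 ≤ n) (Q : PMF (Pair n))
    (hQ : (comparisonGraph Q).Connected) : 0 < fiedler hn (laplacian_isHermitian Q) := by
  obtain ⟨u, l, j₀, j₁, ho, he, hsp, hge, hne, hl1, hl0⟩ :=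
    exists_eigenbasis hn (laplacian_isHermitian Q)
  by_contra hneg
  have hconst : ∀ j, l j ≤ 0 → ∀ x y, u j x = u j y := by
    intro j hj
    have h1 : u j ⬝ᵥ (laplacian Q *ᵥ u j) = l j := by
      rw [he, dotProduct_smul, ho]; simp
    rw [laplacian_bilin] at h1
    have hnn : ∀ p ∈ Finset.univ, 0 ≤ (Q p).toReal * ((pairVec p ⬝ᵥ u j) * (pairVec p ⬝ᵥ u j)) :=
      fun p _ => mul_nonneg ENNReal.toReal_nonneg (mul_self_nonneg _)
    have h0 := (Finset.sum_eq_zero_iff_of_nonneg hnn).1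
      (le_antisymm (h1.le.trans hj) (Finset.sum_nonneg hnn))
    have hlt : ∀ x y, x < y → (comparisonGraph Q).Adj x y → u j x = u j y := by
      intro x y hxy hadj
      have h2 := h0 ⟨(x, y), hxy⟩ (Finset.mem_univ _)
      have h3 : 0 < (Q ⟨(x, y), hxy⟩).toReal := by
        have : 0 < pairProb Q x y := hadj
        simpa [pairProb, hxy] using this
      have h4 := (mul_eq_zero.1 h2).resolve_left h3.ne'
      rw [pairVec_dotProduct] at h4
      have := mul_self_eq_zero.1 h4
      simpa using sub_eq_zero.1 this
    have hadj : ∀ x y, (comparisonGraph Q).Adj x y → |u j x - u j y| ≤ 0 := by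
      intro x y hxy
      rcases lt_trichotomy x y with h | h | h
      · rw [hlt x y h hxy]; simp
      · rw [h]; simp
      · rw [hlt y x h hxy.symm]; simp
    intro x y
    obtain ⟨p⟩ := hQ x y
    have := abs_sub_le_of_walk hadj p
    rw [mul_zero] at this
    exact sub_eq_zero.1 (abs_nonpos_iff.1 this)
  have c0 := hconst j₀ (hl0.trans (not_lt.1 hneg))
  have c1 := hconst j₁ (hl1.le.trans (not_lt.1 hneg))
  have e0 := ho j₀ j₀
  have e1 := ho j₁ j₁
  have e01 := ho j₀ j₁
  simp only [dotProduct, c0 _ j₀, c1 _ j₀, Finset.sum_const, hne.symm, if_true, if_false,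
    Finset.card_univ, Fintype.card_fin, nsmul_eq_mul] at e0 e1 e01
  have : (n : ℝ) * (u j₀ j₀ * u j₀ j₀) * (n * (u j₁ j₀ * u j₁ j₀)) = 0 := by
    have : (n : ℝ) * (u j₀ j₀ * u j₀ j₀) * (n * (u j₁ j₀ * u j₁ j₀))
      = (n * (u j₀ j₀ * u j₁ j₀)) ^ 2 := by ring
    rw [this, e01]; simp
  rw [e0, e1] at this
  norm_num at this

/-! ### A tail bound for sums of independent noise -/

lemma sum_prod_pi {N : ℕ} {β : Type*} [Fintype β] [DecidableEq β] (f : Fin N → β → ℝ) :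
    ∑ q : Fin N → β, ∏ i, f i (q i) = ∏ i, ∑ a, f i a := by
  rw [Finset.prod_univ_sum, Fintype.piFinset_univ]

lemma integrable_exp_quadratic (y : ℝ) : Integrable fun x : ℝ => Real.exp (x * y - x ^ 2) := by
  have h := ((integrable_exp_neg_mul_sq (b := 1) one_pos).comp_sub_right (y / 2)).const_mul
    (Real.exp (y ^ 2 / 4))
  refine h.congr (Filter.Eventually.of_forall fun x => ?_)
  simp only [← Real.exp_add]
  congr 1; ring

lemma integral_exp_quadratic (y : ℝ) :
    ∫ x : ℝ, Real.exp (x * y - x ^ 2) = √Real.pi * Real.exp (y ^ 2 / 4) := by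
  have h1 : ∀ x : ℝ, Real.exp (x * y - x ^ 2)
      = Real.exp (y ^ 2 / 4) * Real.exp (-1 * (x - y / 2) ^ 2) := by
    intro x; rw [← Real.exp_add]; congr 1; ring
  simp only [h1]
  rw [integral_const_mul,
    integral_sub_right_eq_self (fun x : ℝ => Real.exp (-1 * x ^ 2)) (y / 2), integral_gaussian]
  rw [div_one, mul_comm]

/-- Gaussian linearization: `√π e^(y²/4) = ∫ e^(xy - x²) dx`. Exchanging sum and integral and
inserting the bound on the moment generating function leaves `∫ e^(-x²/2) dx = √(2π)`. -/
lemma sum_exp_sq_le {ι : Type*} [Fintype ι] {W Y : ι → ℝ}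
    (hY : ∀ t, ∑ q, W q * Real.exp (t * Y q) ≤ Real.exp (t ^ 2 / 2)) :
    ∑ q, W q * Real.exp (Y q ^ 2 / 4) ≤ √2 := by
  have hpi : 0 < √Real.pi := Real.sqrt_pos.2 Real.pi_pos
  have h1 : √Real.pi * ∑ q, W q * Real.exp (Y q ^ 2 / 4)
      = ∫ x : ℝ, ∑ q, W q * Real.exp (x * Y q - x ^ 2) := by
    rw [integral_finsetSum _ fun q _ => (integrable_exp_quadratic (Y q)).const_mul (W q),
      Finset.mul_sum]
    refine Finset.sum_congr rfl fun q _ => ?_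
    rw [integral_const_mul, integral_exp_quadratic]; ring
  have h2 : ∫ x : ℝ, ∑ q, W q * Real.exp (x * Y q - x ^ 2)
      ≤ ∫ x : ℝ, Real.exp (-(1 / 2) * x ^ 2) := by
    refine integral_mono (integrable_finsetSum _ fun q _ =>
      (integrable_exp_quadratic (Y q)).const_mul (W q))
      (integrable_exp_neg_mul_sq (by norm_num)) fun x => ?_
    have e : ∑ q, W q * Real.exp (x * Y q - x ^ 2)
        = Real.exp (-x ^ 2) * ∑ q, W q * Real.exp (x * Y q) := by
      rw [Finset.mul_sum]
      refine Finset.sum_congr rfl fun q _ => ?_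
      rw [sub_eq_add_neg, Real.exp_add]; ring
    simp only
    rw [e]
    calc _ ≤ Real.exp (-x ^ 2) * Real.exp (x ^ 2 / 2) := by gcongr; exact hY x
      _ = _ := by rw [← Real.exp_add]; congr 1; ring
  rw [← h1, integral_gaussian] at h2
  have e : √(Real.pi / (1 / 2)) = √Real.pi * √2 := by
    rw [← Real.sqrt_mul Real.pi_pos.le]; congr 1; ring
  rw [e] at h2
  exact le_of_mul_le_mul_left h2 hpi

/-- Symmetrization: multiplying by the expectation of `e^(-tX)`, which is at least 1 because `X` is
centred, gives the moment generating function of a difference of two independent copies. This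
difference is -1, 0 or 1 and symmetric, so the product is at most `cosh t ≤ e^(t²/2)`. -/
lemma bernoulli_mgf_le {p : ℝ} (h0 : 0 ≤ p) (h1 : p ≤ 1) (t : ℝ) :
    p * Real.exp (t * (1 - p)) + (1 - p) * Real.exp (t * (0 - p)) ≤ Real.exp (t ^ 2 / 2) := by
  have hA : 0 ≤ p * Real.exp (t * (1 - p)) + (1 - p) * Real.exp (t * (0 - p)) :=
    add_nonneg (by positivity) (mul_nonneg (by linarith) (Real.exp_pos _).le)
  have hB : 1 ≤ p * Real.exp (-(t * (1 - p))) + (1 - p) * Real.exp (-(t * (0 - p))) := by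
    have e1 := Real.add_one_le_exp (-(t * (1 - p)))
    have e2 := Real.add_one_le_exp (-(t * (0 - p)))
    have e3 := mul_le_mul_of_nonneg_left e1 h0
    have e4 := mul_le_mul_of_nonneg_left e2 (sub_nonneg.2 h1)
    nlinarith
  have hcosh : 1 ≤ Real.cosh t := Real.one_le_cosh t
  have hAB : (p * Real.exp (t * (1 - p)) + (1 - p) * Real.exp (t * (0 - p))) *
      (p * Real.exp (-(t * (1 - p))) + (1 - p) * Real.exp (-(t * (0 - p)))) ≤ Real.cosh t := by
    have f1 : Real.exp (t * (1 - p)) * Real.exp (-(t * (1 - p))) = 1 := by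
      rw [← Real.exp_add]; simp
    have f2 : Real.exp (t * (0 - p)) * Real.exp (-(t * (0 - p))) = 1 := by
      rw [← Real.exp_add]; simp
    have f3 : Real.exp (t * (1 - p)) * Real.exp (-(t * (0 - p))) = Real.exp t := by
      rw [← Real.exp_add]; congr 1; ring
    have f4 : Real.exp (t * (0 - p)) * Real.exp (-(t * (1 - p))) = Real.exp (-t) := by
      rw [← Real.exp_add]; congr 1; ring
    have : (p * Real.exp (t * (1 - p)) + (1 - p) * Real.exp (t * (0 - p))) *
      (p * Real.exp (-(t * (1 - p))) + (1 - p) * Real.exp (-(t * (0 - p))))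
      = p ^ 2 * (Real.exp (t * (1 - p)) * Real.exp (-(t * (1 - p))))
        + (1 - p) ^ 2 * (Real.exp (t * (0 - p)) * Real.exp (-(t * (0 - p))))
        + p * (1 - p) * (Real.exp (t * (1 - p)) * Real.exp (-(t * (0 - p)))
          + Real.exp (t * (0 - p)) * Real.exp (-(t * (1 - p)))) := by ring
    rw [this, f1, f2, f3, f4]
    have g : Real.exp t + Real.exp (-t) = 2 * Real.cosh t := by rw [Real.cosh_eq]; ring
    rw [g]
    nlinarith [mul_nonneg h0 (sub_nonneg.2 h1)]
  calc _ ≤ _ := le_mul_of_one_le_right hA hB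
    _ ≤ _ := hAB
    _ ≤ _ := Real.cosh_le_exp_half_sq t

section tail

variable {N : ℕ} {b ξ : Fin N → Bool → ℝ}

/-- Independence turns the sum over all bit vectors into a product, and the exponents add up by `∑ c
i ^ 2 = 1`. -/
lemma sum_exp_linear_le (hb : ∀ i q, 0 ≤ b i q)
    (hmgf : ∀ i t, ∑ q, b i q * Real.exp (t * ξ i q) ≤ Real.exp (t ^ 2 / 2))
    {c : Fin N → ℝ} (hc : ∑ i, c i ^ 2 = 1) (t : ℝ) :
    ∑ q : Fin N → Bool, (∏ i, b i (q i)) * Real.exp (t * ∑ i, c i * ξ i (q i))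
      ≤ Real.exp (t ^ 2 / 2) := by
  have h1 : ∀ q : Fin N → Bool, (∏ i, b i (q i)) * Real.exp (t * ∑ i, c i * ξ i (q i))
      = ∏ i, (b i (q i) * Real.exp (t * c i * ξ i (q i))) := by
    intro q
    rw [Finset.prod_mul_distrib, ← Real.exp_sum, Finset.mul_sum]
    simp only [mul_assoc]
  simp only [h1]
  rw [sum_prod_pi fun i a => b i a * Real.exp (t * c i * ξ i a)]
  calc _ ≤ ∏ i, Real.exp ((t * c i) ^ 2 / 2) :=
        Finset.prod_le_prod (fun i _ => Finset.sum_nonneg fun q _ =>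
          mul_nonneg (hb i q) (Real.exp_pos _).le) fun i _ => hmgf i _
    _ = _ := by
        rw [← Real.exp_sum]
        congr 1
        rw [← Finset.sum_div]
        simp only [mul_pow]
        rw [← Finset.mul_sum, hc, mul_one]

/-- The sums `Y j` may be dependent. Convexity of `exp` bounds `exp (∑ Y j ^ 2 / (4 |S|))` by the
average of `exp (Y j ^ 2 / 4)`, of expectation at most `√2`. On the event considered the left side
exceeds `1 / δ^2`, so Markov's inequality gives `√2 δ^2 ≤ 2 δ^2 ≤ δ`. -/
lemma tail_bound {ι : Type*} {S : Finset ι} (hS : S.Nonempty) (hb : ∀ i q, 0 ≤ b i q)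
    (hmgf : ∀ i t, ∑ q, b i q * Real.exp (t * ξ i q) ≤ Real.exp (t ^ 2 / 2))
    {c : ι → Fin N → ℝ} (hc : ∀ j ∈ S, ∑ i, c j i ^ 2 = 1) {δ : ℝ} (hδ : 0 < δ)
    (hδ' : δ ≤ 1 / 2) :
    ∑ q : Fin N → Bool with 8 * S.card * Real.log (1 / δ)
      < ∑ j ∈ S, (∑ i, c j i * ξ i (q i)) ^ 2, ∏ i, b i (q i) ≤ δ := by
  have hcard : (0 : ℝ) < S.card := by exact_mod_cast hS.card_pos
  set Y : ι → (Fin N → Bool) → ℝ := fun j q => ∑ i, c j i * ξ i (q i)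
  set W : (Fin N → Bool) → ℝ := fun q => ∏ i, b i (q i)
  have hW : ∀ q, 0 ≤ W q := fun q => Finset.prod_nonneg fun i _ => hb i _
  have hjensen : ∀ q, Real.exp ((∑ j ∈ S, Y j q ^ 2) / (4 * S.card))
      ≤ ∑ j ∈ S, (1 / (S.card : ℝ)) * Real.exp (Y j q ^ 2 / 4) := by
    intro q
    have h := convexOn_exp.map_sum_le (t := S) (w := fun _ => 1 / (S.card : ℝ))
      (p := fun j => Y j q ^ 2 / 4) (fun _ _ => by positivity)
      (by simp [hcard.ne']) (fun _ _ => Set.mem_univ _)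
    simp only [smul_eq_mul] at h
    refine le_trans (le_of_eq ?_) h
    congr 1
    rw [← Finset.mul_sum, ← Finset.sum_div]
    field_simp
  have hexp : ∑ q, W q * Real.exp ((∑ j ∈ S, Y j q ^ 2) / (4 * S.card)) ≤ √2 := by
    calc _ ≤ ∑ q, W q * ∑ j ∈ S, (1 / (S.card : ℝ)) * Real.exp (Y j q ^ 2 / 4) :=
          Finset.sum_le_sum fun q _ => mul_le_mul_of_nonneg_left (hjensen q) (hW q)
      _ = ∑ j ∈ S, (1 / (S.card : ℝ)) * ∑ q, W q * Real.exp (Y j q ^ 2 / 4) := by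
          simp only [Finset.mul_sum]
          rw [Finset.sum_comm]
          exact Finset.sum_congr rfl fun j _ => Finset.sum_congr rfl fun q _ => by ring
      _ ≤ ∑ j ∈ S, (1 / (S.card : ℝ)) * √2 := by
          refine Finset.sum_le_sum fun j hj => mul_le_mul_of_nonneg_left ?_ (by positivity)
          exact sum_exp_sq_le fun t => sum_exp_linear_le hb hmgf (hc j hj) t
      _ = √2 := by simp; field_simp
  have hmarkov : (1 / δ ^ 2) * ∑ q with 8 * S.card * Real.log (1 / δ) < ∑ j ∈ S, Y j q ^ 2, W q
      ≤ √2 := by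
    refine le_trans ?_ hexp
    rw [Finset.mul_sum]
    calc _ ≤ ∑ q with 8 * S.card * Real.log (1 / δ) < ∑ j ∈ S, Y j q ^ 2,
          W q * Real.exp ((∑ j ∈ S, Y j q ^ 2) / (4 * S.card)) := by
          refine Finset.sum_le_sum fun q hq => ?_
          rw [mul_comm]
          refine mul_le_mul_of_nonneg_left ?_ (hW q)
          have hq' := (Finset.mem_filter.1 hq).2
          have : 2 * Real.log (1 / δ) ≤ (∑ j ∈ S, Y j q ^ 2) / (4 * S.card) := by
            rw [le_div_iff₀ (by positivity)]; linarith
          calc 1 / δ ^ 2 = Real.exp (2 * Real.log (1 / δ)) := by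
                rw [two_mul, Real.exp_add, Real.exp_log (by positivity)]; field_simp
            _ ≤ _ := Real.exp_le_exp.2 this
      _ ≤ _ := Finset.sum_le_sum_of_subset_of_nonneg (Finset.filter_subset _ _)
          fun q _ _ => mul_nonneg (hW q) (Real.exp_pos _).le
  have h2 : √2 ≤ 2 := by
    rw [Real.sqrt_le_left (by norm_num)]; norm_num
  have h3 : ∑ q with 8 * S.card * Real.log (1 / δ) < ∑ j ∈ S, Y j q ^ 2, W q ≤ 2 * δ ^ 2 := by
    have := hmarkov.trans h2
    rw [one_div, inv_mul_le_iff₀ (by positivity)] at this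
    linarith
  refine h3.trans ?_
  nlinarith

end tail

/-! ### The error of approximate maximum likelihood estimates -/

/-- The probability of the bit `q` when the pair `p` is compared. -/
def bitProb {n : ℕ} (z : EuclideanSpace ℝ (Fin n)) (p : Pair n) (q : Bool) : ℝ :=
  if q then winProb z p.1.1 p.1.2 else winProb z p.1.2 p.1.1

/-- The centred bit. -/
def noise {n : ℕ} (z : EuclideanSpace ℝ (Fin n)) (p : Pair n) (q : Bool) : ℝ :=
  (if q then 1 else 0) - winProb z p.1.1 p.1.2

lemma bitProb_nonneg {n : ℕ} (z : EuclideanSpace ℝ (Fin n)) (p : Pair n) (q : Bool) :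
    0 ≤ bitProb z p q := by
  unfold bitProb; split_ifs <;> exact winProb_nonneg _ _ _

lemma sum_bitProb {n : ℕ} (z : EuclideanSpace ℝ (Fin n)) (p : Pair n) :
    ∑ q, bitProb z p q = 1 := by
  simp [bitProb, winProb_add]

lemma noise_mgf_le {n : ℕ} (z : EuclideanSpace ℝ (Fin n)) (p : Pair n) (t : ℝ) :
    ∑ q, bitProb z p q * Real.exp (t * noise z p q) ≤ Real.exp (t ^ 2 / 2) := by
  have h := winProb_add z p.1.1 p.1.2
  have h1 : winProb z p.1.2 p.1.1 = 1 - winProb z p.1.1 p.1.2 := by linarith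
  have h2 := winProb_nonneg z p.1.2 p.1.1
  rw [Fintype.sum_bool]
  simp only [bitProb, noise, if_true, Bool.false_eq_true, if_false, h1]
  exact bernoulli_mgf_le (winProb_nonneg _ _ _) (by linarith) t

lemma logistic_sub {n : ℕ} (z : EuclideanSpace ℝ (Fin n)) (x y : Fin n) :
    logistic (z y - z x) = winProb z y x := by
  unfold logistic winProb
  rw [Real.exp_sub]
  have := Real.exp_pos (z x)
  field_simp
  rw [add_comm]

/-- A quadratic lower bound of the negative log-likelihood. -/
lemma negLogLik_lower {n N : ℕ} {G : SimpleGraph (Fin n)} {φ : ℝ} (hφ : 1 < φ)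
    {z w : EuclideanSpace ℝ (Fin n)} (hz : z ∈ paramSet G φ) (hw : w ∈ paramSet G φ)
    (s : Fin N → Example n) (hs : ∀ i, G.Adj (s i).1.1.1 (s i).1.1.2) :
    negLogLik s z - 1 / N * ∑ i, noise z (s i).1 (s i).2 * (pairVec (s i).1 ⬝ᵥ (⇑w - ⇑z))
      + 1 / (8 * φ) * (1 / N * ∑ i, (pairVec (s i).1 ⬝ᵥ (⇑w - ⇑z)) ^ 2) ≤ negLogLik s w := by
  rw [negLogLik_eq, negLogLik_eq, mul_left_comm, ← mul_sub, ← mul_add, Finset.mul_sum,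
    ← Finset.sum_sub_distrib, ← Finset.sum_add_distrib]
  refine mul_le_mul_of_nonneg_left (Finset.sum_le_sum fun i _ => ?_) (by positivity)
  have hadj := (adj_winner_loser (hs i)).symm
  have h := softplus_strong hφ (hz.2 _ _ hadj) (hw.2 _ _ hadj)
  refine le_trans (le_of_eq ?_) h
  -- The slope at `z` is the model probability that the loser wins; up to the orientation of the
  -- pair this is the centred bit, so the linear term is pure noise.
  rw [logistic_sub, pairVec_dotProduct]
  have hadd := winProb_add z (s i).1.1.1 (s i).1.1.2
  unfold noise loser winner
  cases (s i).2
  · simp only [Bool.false_eq_true, if_false, Pi.sub_apply]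
    ring
  · have : winProb z (s i).1.1.2 (s i).1.1.1 = 1 - winProb z (s i).1.1.1 (s i).1.1.2 := by
      linarith
    simp only [if_true, Pi.sub_apply, this]
    ring

/-- The constant for the sample size given the compared pairs. -/
def sampleConst (φ : ℝ) : ℝ := 16 * φ + 512 * φ ^ 2

/-- This lets the optimization error `1/N` be absorbed into the statistical error `n log(1/δ) / N`.
-/
lemma one_le_mul_log {n : ℕ} (hn : 2 ≤ n) {δ : ℝ} (hδ : 0 < δ) (hδ' : δ ≤ 1 / 2) :
    1 ≤ n * Real.log (1 / δ) := by
  have h1 : Real.log 2 ≤ Real.log (1 / δ) := by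
    refine Real.log_le_log (by norm_num) ?_
    rw [le_div_iff₀ hδ]; linarith
  have h2 := Real.log_two_gt_d9
  have h3 : (2 : ℝ) ≤ n := by exact_mod_cast hn
  nlinarith

open Classical in
/-- Given the compared pairs, all approximate maximum likelihood estimates are close to the target
with high probability. -/
theorem sum_bad_le {n N : ℕ} (hn : 2 ≤ n) {G : SimpleGraph (Fin n)} {φ : ℝ} (hφ : 1 < φ)
    {z : EuclideanSpace ℝ (Fin n)} (hz : z ∈ paramSet G φ) (e : Fin N → Pair n)
    (he : ∀ i, G.Adj (e i).1.1 (e i).1.2)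
    (hpos : 0 < fiedler hn (empiricalLaplacian_isHermitian e)) {ε δ : ℝ} (hε : 0 < ε)
    (hδ : 0 < δ) (hδ' : δ ≤ 1 / 2)
    (hN : sampleConst φ * ((n : ℝ) / (fiedler hn (empiricalLaplacian_isHermitian e) * ε ^ 2)
      * Real.log (1 / δ)) ≤ N) :
    ∑ q : Fin N → Bool with ¬ ∀ w ∈ paramSet G φ,
      negLogLik (fun i => (e i, q i)) w ≤ negLogLik (fun i => (e i, q i)) z + 1 / (N : ℝ) →
        ‖z - w‖ ≤ ε, ∏ i, bitProb z (e i) (q i) ≤ δ := by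
  set A := empiricalLaplacian e with hAdef
  have hA : A.IsHermitian := empiricalLaplacian_isHermitian e
  set f := fiedler hn (empiricalLaplacian_isHermitian e) with hf
  have h1 := empiricalLaplacian_mulVec_one e
  have hN1 := le_of_fiedler_pos hn e hpos
  have hN0 : (0 : ℝ) < N := by
    have : 0 < N := by omega
    exact_mod_cast this
  obtain ⟨u, l, S, hS, ho, heig, hge, hsp⟩ := exists_eigenbasis_sum_zero hn hA h1 hpos
  have hl : ∀ j ∈ S, 0 < l j := fun j hj => hpos.trans_le (hge j hj)
  -- The normalization by `√(N * l j)` makes each `c j` a unit vector, because `u j` has energy `l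
  -- j` for the empirical Laplacian.
  let c : Fin n → Fin N → ℝ := fun j i => pairVec (e i) ⬝ᵥ u j / √(N * l j)
  have hc : ∀ j ∈ S, ∑ i, c j i ^ 2 = 1 := by
    intro j hj
    have h2 : u j ⬝ᵥ (A *ᵥ u j) = l j := by
      rw [heig, dotProduct_smul, ho]; simp
    rw [hAdef, empiricalLaplacian_bilin] at h2
    have hNl : 0 < N * l j := mul_pos hN0 (hl j hj)
    have h3 : ∑ i, c j i ^ 2 = (∑ i, (pairVec (e i) ⬝ᵥ u j) * (pairVec (e i) ⬝ᵥ u j))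
        / (N * l j) := by
      rw [Finset.sum_div]
      refine Finset.sum_congr rfl fun i _ => ?_
      simp only [c]
      rw [div_pow, Real.sq_sqrt hNl.le, sq]
    have h4 : ∑ i, (pairVec (e i) ⬝ᵥ u j) * (pairVec (e i) ⬝ᵥ u j) = N * l j := by
      rw [← h2]; field_simp
    rw [h3, h4, div_self hNl.ne']
  refine le_trans (Finset.sum_le_sum_of_subset_of_nonneg ?_ ?_)
    (tail_bound hS (fun i q => bitProb_nonneg z (e i) q) (fun i t => noise_mgf_le z (e i) t)
      hc hδ hδ')
  swap
  · exact fun q _ _ => Finset.prod_nonneg fun i _ => bitProb_nonneg _ _ _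
  intro q hq
  rw [Finset.mem_filter] at hq ⊢
  refine ⟨Finset.mem_univ _, ?_⟩
  by_contra hle
  rw [not_lt] at hle
  refine hq.2 fun w hw hlik => ?_
  set Δ : Fin n → ℝ := ⇑w - ⇑z with hΔ
  have hΔsum : ∑ x, Δ x = 0 := by
    simp only [hΔ, Pi.sub_apply, Finset.sum_sub_distrib, hw.1, hz.1, sub_zero]
  set Y : Fin n → ℝ := fun j => ∑ i, c j i * noise z (e i) (q i) with hY
  have hquad : 1 / (N : ℝ) * ∑ i, (pairVec (e i) ⬝ᵥ Δ) ^ 2 = ∑ j ∈ S, l j * (u j ⬝ᵥ Δ) ^ 2 := by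
    rw [← quadratic_eq_sum hA heig (hsp Δ hΔsum), hAdef, empiricalLaplacian_bilin]
    simp only [sq]
  have hlin : 1 / (N : ℝ) * ∑ i, noise z (e i) (q i) * (pairVec (e i) ⬝ᵥ Δ)
      = ∑ j ∈ S, √(l j) * (u j ⬝ᵥ Δ) * (Y j / √N) := by
    have h2 : ∀ i, pairVec (e i) ⬝ᵥ Δ = ∑ j ∈ S, (u j ⬝ᵥ Δ) * (pairVec (e i) ⬝ᵥ u j) := by
      intro i
      rw [dotProduct_comm, dotProduct_eq_sum (hsp Δ hΔsum)]
      simp only [dotProduct_comm (u _) (pairVec (e i))]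
    simp only [h2, Finset.mul_sum]
    rw [Finset.sum_comm]
    refine Finset.sum_congr rfl fun j hj => ?_
    simp only [hY, c]
    rw [Finset.sum_div, Finset.mul_sum]
    refine Finset.sum_congr rfl fun i _ => ?_
    have hsl : 0 < √(l j) := Real.sqrt_pos.2 (hl j hj)
    have hsN : 0 < √(N : ℝ) := Real.sqrt_pos.2 hN0
    rw [Real.sqrt_mul hN0.le]
    have hNN : (N : ℝ) = √N * √N := (Real.mul_self_sqrt hN0.le).symm
    rw [show (1 : ℝ) / N = 1 / (√N * √N) by rw [← hNN]]
    field_simp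
  have hlow := negLogLik_lower hφ hz hw (fun i => (e i, q i)) he
  simp only at hlow
  rw [← hΔ, hquad, hlin] at hlow
  set κ := 1 / (8 * φ) with hκ
  have hφ0 : 0 < φ := by linarith
  have hκ0 : 0 < κ := by positivity
  set D := ∑ j ∈ S, l j * (u j ⬝ᵥ Δ) ^ 2 with hD
  -- Young's inequality in each eigendirection: half of the curvature term absorbs the noise.
  have hamgm : ∑ j ∈ S, √(l j) * (u j ⬝ᵥ Δ) * (Y j / √N)
      ≤ κ / 2 * D + 1 / (2 * κ * N) * ∑ j ∈ S, Y j ^ 2 := by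
    rw [hD, Finset.mul_sum, Finset.mul_sum, ← Finset.sum_add_distrib]
    refine Finset.sum_le_sum fun j hj => ?_
    have e1 : l j * (u j ⬝ᵥ Δ) ^ 2 = (√(l j) * (u j ⬝ᵥ Δ)) ^ 2 := by
      rw [mul_pow, Real.sq_sqrt (hl j hj).le]
    have e2 : 1 / (2 * κ * N) * Y j ^ 2 = 1 / (2 * κ) * (Y j / √N) ^ 2 := by
      rw [div_pow, Real.sq_sqrt hN0.le]; field_simp
    rw [e1, e2]
    have h3 := sq_nonneg (κ * (√(l j) * (u j ⬝ᵥ Δ)) - Y j / √N)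
    have h4 : κ / 2 * (√(l j) * (u j ⬝ᵥ Δ)) ^ 2 + 1 / (2 * κ) * (Y j / √N) ^ 2
        - √(l j) * (u j ⬝ᵥ Δ) * (Y j / √N)
        = 1 / (2 * κ) * (κ * (√(l j) * (u j ⬝ᵥ Δ)) - Y j / √N) ^ 2 := by
      field_simp; ring
    have h5 : 0 ≤ 1 / (2 * κ) * (κ * (√(l j) * (u j ⬝ᵥ Δ)) - Y j / √N) ^ 2 := by positivity
    linarith
  set T := (n : ℝ) * Real.log (1 / δ) with hT
  have hT1 : 1 ≤ T := one_le_mul_log hn hδ hδ'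
  have hYT : ∑ j ∈ S, Y j ^ 2 ≤ 8 * T := by
    refine hle.trans ?_
    have hcard : (S.card : ℝ) ≤ n := by
      have := Finset.card_le_univ S
      rw [Fintype.card_fin] at this
      exact_mod_cast this
    have hlog : 0 ≤ Real.log (1 / δ) := Real.log_nonneg (by rw [le_div_iff₀ hδ]; linarith)
    rw [hT, mul_assoc]
    gcongr
  -- The constant is read off here: multiplying `1/N + 8T / (2κN)` by `2/κ` with `κ = 1/(8φ)` gives
  -- `(16φ + 512φ² T) / N`, and `T ≥ 1`.
  have hDle : D ≤ sampleConst φ * T / N := by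
    have h2 : κ / 2 * D ≤ 1 / N + 1 / (2 * κ * N) * (8 * T) := by
      have : 1 / (2 * κ * N) * ∑ j ∈ S, Y j ^ 2 ≤ 1 / (2 * κ * N) * (8 * T) := by gcongr
      linarith
    have h3 : (1 : ℝ) / N ≤ T / N := by gcongr
    have h4 : κ / 2 * D ≤ κ / 2 * (sampleConst φ * T / N) := by
      refine (h2.trans (add_le_add_left h3 _)).trans (le_of_eq ?_)
      rw [hκ]; unfold sampleConst; field_simp; ring
    exact le_of_mul_le_mul_left h4 (by positivity)
  have hfD : f * (Δ ⬝ᵥ Δ) ≤ D := by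
    have := fiedler_mul_le (hn := hn) hA h1 hpos hΔsum
    rwa [quadratic_eq_sum hA heig (hsp Δ hΔsum)] at this
  have hnorm : ‖z - w‖ ^ 2 = Δ ⬝ᵥ Δ := by
    rw [EuclideanSpace.norm_sq_eq, dotProduct]
    refine Finset.sum_congr rfl fun x _ => ?_
    simp only [hΔ, Pi.sub_apply, PiLp.sub_apply, Real.norm_eq_abs, sq_abs]
    ring
  have hfin : f * ‖z - w‖ ^ 2 ≤ f * ε ^ 2 := by
    rw [hnorm]
    refine hfD.trans (hDle.trans ?_)
    rw [div_le_iff₀ hN0]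
    have h5 : sampleConst φ * T = (sampleConst φ * ((n : ℝ) / (f * ε ^ 2)
        * Real.log (1 / δ))) * (f * ε ^ 2) := by
      rw [hT]; field_simp
    rw [h5, mul_comm (f * ε ^ 2)]
    gcongr
  exact abs_le_of_sq_le_sq' (le_of_mul_le_mul_left hfin hpos) hε.le |>.2

/-! ### Concentration of the empirical Laplacian -/

/-- The law of independent pairs, indexed by `ι`. -/
abbrev pairLaw {n : ℕ} (Q : PMF (Pair n)) (ι : Type*) [Fintype ι] : Measure (ι → Pair n) :=
  Measure.pi fun _ => Q.toMeasure

lemma integral_pairLaw_eval {n : ℕ} (Q : PMF (Pair n)) {ι : Type*} [Fintype ι] (i : ι)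
    (f : Pair n → ℝ) : ∫ e, f (e i) ∂pairLaw Q ι = ∑ p, (Q p).toReal * f p := by
  rw [integral_comp_eval (μ := fun _ : ι => Q.toMeasure) (f := f)
    (measurable_of_finite f).aestronglyMeasurable, PMF.integral_eq_sum]
  rfl

/-- The variance of a mean of `K` independent copies is `1/K` times a single variance, which is at
most the second moment. -/
lemma second_moment_le {n K : ℕ} (hK : 0 < K) (Q : PMF (Pair n)) (f : Pair n → ℝ) :
    ∫ e, (1 / (K : ℝ) * ∑ i, f (e i) - ∑ p, (Q p).toReal * f p) ^ 2 ∂pairLaw Q (Fin K)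
      ≤ 1 / K * ∑ p, (Q p).toReal * f p ^ 2 := by
  have hK' : (0 : ℝ) < K := by exact_mod_cast hK
  set μ := pairLaw Q (Fin K)
  set m := ∑ p, (Q p).toReal * f p with hm
  let X : Fin K → (Fin K → Pair n) → ℝ := fun i e => f (e i)
  have hind : ProbabilityTheory.iIndepFun X μ :=
    ProbabilityTheory.iIndepFun_pi (X := fun _ => f) fun i =>
      (measurable_of_finite f).aemeasurable
  have hvar : ProbabilityTheory.variance (∑ i, X i) μ
      = ∑ i, ProbabilityTheory.variance (X i) μ :=
    ProbabilityTheory.IndepFun.variance_sum (fun i _ => MemLp.of_discrete)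
      fun i _ j _ hij => hind.indepFun hij
  have hvi : ∀ i, ProbabilityTheory.variance (X i) μ ≤ ∑ p, (Q p).toReal * f p ^ 2 := by
    intro i
    refine (ProbabilityTheory.variance_le_expectation_sq
      (measurable_of_finite _).aestronglyMeasurable).trans (le_of_eq ?_)
    exact integral_pairLaw_eval Q i fun p => f p ^ 2
  have hmean : ∫ e, (∑ i, X i) e ∂μ = K * m := by
    simp only [Finset.sum_apply]
    rw [integral_finsetSum _ fun i _ => Integrable.of_finite]
    simp only [X]
    rw [Finset.sum_congr rfl fun i _ => integral_pairLaw_eval Q i f]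
    simp [hm]
  rw [ProbabilityTheory.variance_eq_integral (measurable_of_finite _).aemeasurable, hmean] at hvar
  have h1 : ∀ e, (1 / (K : ℝ) * ∑ i, f (e i) - m) ^ 2
      = 1 / (K : ℝ) ^ 2 * ((∑ i, X i) e - K * m) ^ 2 := by
    intro e
    simp only [Finset.sum_apply, X]
    field_simp
  simp only [h1]
  rw [integral_const_mul, hvar]
  calc _ ≤ 1 / (K : ℝ) ^ 2 * ∑ _i : Fin K, ∑ p, (Q p).toReal * f p ^ 2 := by
        gcongr with i; exact hvi i
    _ = _ := by simp; field_simp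

lemma sum_toReal_eq_one {α : Type*} [Fintype α] (Q : PMF α) : ∑ p, (Q p).toReal = 1 := by
  have h := Q.tsum_coe
  rw [tsum_fintype] at h
  rw [← ENNReal.toReal_sum fun p _ => Q.apply_ne_top p, h, ENNReal.toReal_one]

lemma pairVec_norm {n : ℕ} (p : Pair n) : pairVec p ⬝ᵥ pairVec p = 2 := by
  have h := p.2.ne
  rw [pairVec_dotProduct]
  simp [pairVec, h, h.symm]; norm_num

lemma sum_pairVec {n : ℕ} (p : Pair n) : ∑ x, pairVec p x = 0 := by
  simp [pairVec]

/-- A sample of pairs whose empirical Laplacian is not much smaller than the Laplacian. -/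
def Sparse {n K : ℕ} (hn : 2 ≤ n) (Q : PMF (Pair n)) (e : Fin K → Pair n) : Prop :=
  ∃ w : Fin n → ℝ, ∑ x, w x = 0 ∧
    1 / K * ∑ i, (pairVec (e i) ⬝ᵥ w) ^ 2
      < fiedler hn (laplacian_isHermitian Q) / 2 * (w ⬝ᵥ w)

/-- A single block fails with probability at most `1 / 16`. -/
lemma measure_sparse_le {n K : ℕ} (hn : 2 ≤ n) (Q : PMF (Pair n))
    (hpos : 0 < fiedler hn (laplacian_isHermitian Q)) (hK : 0 < K)
    (hKn : 128 * (n : ℝ) ≤ K * fiedler hn (laplacian_isHermitian Q)) :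
    (pairLaw Q (Fin K)).real {e | Sparse hn Q e} ≤ 1 / 16 := by
  have hK' : (0 : ℝ) < K := by exact_mod_cast hK
  set A := laplacian Q with hAdef
  have hA : A.IsHermitian := laplacian_isHermitian Q
  set lam := fiedler hn (laplacian_isHermitian Q) with hlam
  obtain ⟨u, l, S, -, ho, heig, hge, hsp⟩ :=
    exists_eigenbasis_sum_zero hn hA (laplacian_mulVec_one Q) hpos
  have hl : ∀ j ∈ S, 0 < l j := fun j hj => hpos.trans_le (hge j hj)
  have hcard : (S.card : ℝ) ≤ n := by
    have := Finset.card_le_univ S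
    rw [Fintype.card_fin] at this
    exact_mod_cast this
  -- Whitened measurement vectors: in these coordinates the Laplacian of `Q` becomes the identity on
  -- `S`, and `M` below is the deviation of the empirical matrix from it.
  let v : Fin n → Pair n → ℝ := fun j p => pairVec p ⬝ᵥ u j / √(l j)
  let f : Fin n × Fin n → Pair n → ℝ := fun a p => v a.1 p * v a.2 p
  let m : Fin n × Fin n → ℝ := fun a => ∑ p, (Q p).toReal * f a p
  have hm : ∀ a ∈ S ×ˢ S, m a = if a.1 = a.2 then 1 else 0 := by
    rintro ⟨j, k⟩ hjk
    obtain ⟨hj, hk⟩ := Finset.mem_product.1 hjk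
    have h := laplacian_bilin Q (u j) (u k)
    rw [← hAdef, heig, dotProduct_smul, ho, smul_eq_mul] at h
    have h2 : m (j, k) = (∑ p, (Q p).toReal * ((pairVec p ⬝ᵥ u j) * (pairVec p ⬝ᵥ u k)))
        / (√(l j) * √(l k)) := by
      simp only [m, f, v]
      rw [Finset.sum_div]
      exact Finset.sum_congr rfl fun p _ => by ring
    rw [h2, ← h]
    have hj0 := hl j hj
    by_cases e : j = k
    · subst e
      simp only [if_true, mul_one]
      rw [Real.mul_self_sqrt hj0.le, div_self hj0.ne']
    · simp [e]
  have hv2 : ∀ p, ∑ j ∈ S, v j p ^ 2 ≤ 2 / lam := by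
    intro p
    have h := dotProduct_eq_sum (hsp (pairVec p) (sum_pairVec p)) (pairVec p)
    rw [pairVec_norm] at h
    rw [h, Finset.sum_div]
    refine Finset.sum_le_sum fun j hj => ?_
    simp only [v]
    rw [div_pow, Real.sq_sqrt (hl j hj).le, ← sq, dotProduct_comm]
    exact div_le_div_of_nonneg_left (sq_nonneg _) hpos (hge j hj)
  -- The fourth moments are controlled because a whitened vector has squared norm at most `2 / lam`,
  -- while the expected squared norm is the number of directions.
  have hsum : ∑ a ∈ S ×ˢ S, ∑ p, (Q p).toReal * f a p ^ 2 ≤ 2 * n / lam := by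
    rw [Finset.sum_comm]
    calc _ = ∑ p, (Q p).toReal * ((∑ j ∈ S, v j p ^ 2) * (∑ j ∈ S, v j p ^ 2)) := by
          refine Finset.sum_congr rfl fun p _ => ?_
          rw [← Finset.mul_sum, Finset.sum_mul_sum, Finset.sum_product]
          simp only [f, mul_pow]
      _ ≤ ∑ p, (Q p).toReal * ((2 / lam) * (∑ j ∈ S, v j p ^ 2)) := by
          gcongr with p; exact hv2 p
      _ = 2 / lam * ∑ j ∈ S, m (j, j) := by
          simp only [m, f, Finset.mul_sum]
          rw [Finset.sum_comm]
          exact Finset.sum_congr rfl fun j _ => Finset.sum_congr rfl fun p _ => by ring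
      _ = 2 / lam * S.card := by
          congr 1
          rw [Finset.sum_congr rfl fun j hj => hm (j, j) (Finset.mem_product.2 ⟨hj, hj⟩)]
          simp
      _ ≤ 2 / lam * n := by gcongr
      _ = _ := by ring
  let M : Fin n × Fin n → (Fin K → Pair n) → ℝ := fun a e => 1 / (K : ℝ) * ∑ i, f a (e i) - m a
  -- A deviation of squared Frobenius norm below `1/4` changes the quadratic form by at most half of
  -- the energy for `Q`, so at least half of that energy survives.
  have hsub : {e | Sparse hn Q e} ⊆ {e | 1 / 4 ≤ ∑ a ∈ S ×ˢ S, M a e ^ 2} := by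
    rintro e ⟨w, hw0, hw⟩
    by_contra hlt
    rw [Set.mem_ofPred_eq, not_le] at hlt
    refine absurd hw (not_lt.2 ?_)
    let c : Fin n → ℝ := fun j => √(l j) * (u j ⬝ᵥ w)
    have hc2 : ∑ j ∈ S, c j ^ 2 = w ⬝ᵥ (A *ᵥ w) := by
      rw [quadratic_eq_sum hA heig (hsp w hw0)]
      refine Finset.sum_congr rfl fun j hj => ?_
      simp only [c]
      rw [mul_pow, Real.sq_sqrt (hl j hj).le]
    have hvc : ∀ p, pairVec p ⬝ᵥ w = ∑ j ∈ S, c j * v j p := by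
      intro p
      rw [dotProduct_comm, dotProduct_eq_sum (hsp w hw0)]
      refine Finset.sum_congr rfl fun j hj => ?_
      have := Real.sqrt_pos.2 (hl j hj)
      simp only [c, v]
      rw [dotProduct_comm (u j) (pairVec p)]
      field_simp
    have hq : 1 / (K : ℝ) * ∑ i, (pairVec (e i) ⬝ᵥ w) ^ 2
        = ∑ a ∈ S ×ˢ S, c a.1 * c a.2 * M a e + ∑ j ∈ S, c j ^ 2 := by
      have h1 : ∑ a ∈ S ×ˢ S, c a.1 * c a.2 * m a = ∑ j ∈ S, c j ^ 2 := by
        rw [Finset.sum_congr rfl fun a ha => by rw [hm a ha], Finset.sum_product]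
        refine Finset.sum_congr rfl fun j hj => ?_
        simp [hj, sq]
      rw [← h1, ← Finset.sum_add_distrib, Finset.mul_sum]
      simp only [M, sub_add_cancel, ← mul_add]
      have h2 : ∀ i, (pairVec (e i) ⬝ᵥ w) ^ 2 = ∑ a ∈ S ×ˢ S, c a.1 * c a.2 * f a (e i) := by
        intro i
        rw [hvc, sq, Finset.sum_mul_sum, Finset.sum_product]
        exact Finset.sum_congr rfl fun j _ => Finset.sum_congr rfl fun k _ => by
          simp only [f]; ring
      simp only [h2, Finset.mul_sum]
      rw [Finset.sum_comm]
      exact Finset.sum_congr rfl fun a _ => Finset.sum_congr rfl fun i _ => by ring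
    have hcs : (∑ a ∈ S ×ˢ S, c a.1 * c a.2 * M a e) ^ 2 ≤ ((∑ j ∈ S, c j ^ 2) / 2) ^ 2 := by
      have h1 := Finset.sum_mul_sq_le_sq_mul_sq (S ×ˢ S) (fun a => c a.1 * c a.2) fun a => M a e
      have h2 : ∑ a ∈ S ×ˢ S, (c a.1 * c a.2) ^ 2 = (∑ j ∈ S, c j ^ 2) ^ 2 := by
        rw [sq (∑ j ∈ S, c j ^ 2), Finset.sum_mul_sum, Finset.sum_product]
        simp only [mul_pow]
      rw [h2] at h1
      calc _ ≤ _ := h1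
        _ ≤ (∑ j ∈ S, c j ^ 2) ^ 2 * (1 / 4) := by gcongr
        _ = _ := by ring
    have hcnn : 0 ≤ (∑ j ∈ S, c j ^ 2) / 2 := by positivity
    have habs := (abs_le_of_sq_le_sq' hcs hcnn).1
    have hfied := fiedler_mul_le (hn := hn) hA (laplacian_mulVec_one Q) hpos hw0
    rw [hq, div_mul_eq_mul_div]
    rw [← hc2] at hfied
    linarith
  have hmarkov := mul_meas_ge_le_integral_of_nonneg (μ := pairLaw Q (Fin K))
    (f := fun e => ∑ a ∈ S ×ˢ S, M a e ^ 2)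
    (Filter.Eventually.of_forall fun e => Finset.sum_nonneg fun a _ => sq_nonneg _)
    Integrable.of_finite (1 / 4)
  have hint : ∫ e, ∑ a ∈ S ×ˢ S, M a e ^ 2 ∂pairLaw Q (Fin K) ≤ 1 / K * (2 * n / lam) := by
    rw [integral_finsetSum _ fun a _ => Integrable.of_finite]
    calc _ ≤ ∑ a ∈ S ×ˢ S, 1 / (K : ℝ) * ∑ p, (Q p).toReal * f a p ^ 2 :=
          Finset.sum_le_sum fun a _ => second_moment_le hK Q (f a)
      _ = 1 / (K : ℝ) * ∑ a ∈ S ×ˢ S, ∑ p, (Q p).toReal * f a p ^ 2 := by rw [Finset.mul_sum]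
      _ ≤ _ := by gcongr
  -- With `128 n ≤ K lam` the expected squared Frobenius norm is at most `1/64`; Markov's inequality
  -- at `1/4` gives `1/16`.
  have hle : 1 / (K : ℝ) * (2 * n / lam) ≤ 1 / 64 := by
    rw [one_div_mul_eq_div, div_div, div_le_div_iff₀ (by positivity) (by norm_num)]
    linarith
  have hmono := measureReal_mono hsub (μ := pairLaw Q (Fin K))
  linarith

/-- An injective choice of coordinates, arranged in blocks, again consists of independent pairs; so
the blocks are independent. -/
lemma map_blocks {n m K N : ℕ} (Q : PMF (Pair n)) (β : Fin m × Fin K ↪ Fin N) :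
    (pairLaw Q (Fin N)).map (fun e b k => e (β (b, k)))
      = Measure.pi fun _ : Fin m => pairLaw Q (Fin K) := by
  have h1 := Measure.map_infinitePi_infinitePi_of_inj (P := fun _ : Fin N => Q.toMeasure)
    β.injective
  have h2 := Measure.infinitePi_map_curry (fun (_ : Fin m) (_ : Fin K) => Q.toMeasure)
  rw [← h1, Measure.map_map (MeasurableEquiv.measurable _) (by fun_prop)] at h2
  simp only [Measure.infinitePi_eq_pi] at h2
  exact h2

/-- The empirical Laplacian of many pairs is not much smaller than the Laplacian, with high
probability. -/
theorem measure_fiedler_lt_le {n m K N : ℕ} (hn : 2 ≤ n) (Q : PMF (Pair n))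
    (hpos : 0 < fiedler hn (laplacian_isHermitian Q)) (hK : 0 < K)
    (hKn : 128 * (n : ℝ) ≤ K * fiedler hn (laplacian_isHermitian Q)) (hmK : m * K ≤ N)
    (hN : N ≤ 2 * (m * K)) :
    (pairLaw Q (Fin N)).real {e | fiedler hn (empiricalLaplacian_isHermitian e)
      < fiedler hn (laplacian_isHermitian Q) / 8} ≤ (1 / 2) ^ m := by
  classical
  set lam := fiedler hn (laplacian_isHermitian Q) with hlam
  let β : Fin m × Fin K ↪ Fin N :=
    finProdFinEquiv.toEmbedding.trans (Fin.castLEEmb hmK)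
  let Φ : (Fin N → Pair n) → Fin m → Fin K → Pair n := fun e b k => e (β (b, k))
  let bad : Finset (Fin m) → Set (Fin m → Fin K → Pair n) := fun B =>
    Set.univ.pi fun b => if b ∈ B then {e | Sparse hn Q e} else Set.univ
  have hsub : {e : Fin N → Pair n | fiedler hn (empiricalLaplacian_isHermitian e) < lam / 8}
      ⊆ ⋃ B ∈ (Finset.univ : Finset (Finset (Fin m))).filter (fun B => m ≤ 2 * B.card),
        Φ ⁻¹' bad B := by
    intro e he
    rw [Set.mem_ofPred_eq] at he
    set B := Finset.univ.filter fun b => Sparse hn Q (Φ e b) with hB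
    simp only [Set.mem_iUnion]
    refine ⟨B, ?_, ?_⟩
    swap
    · intro b _
      by_cases hb : Sparse hn Q (Φ e b) <;> simp [hB, hb]
    rw [Finset.mem_filter]
    refine ⟨Finset.mem_univ _, ?_⟩
    -- If fewer than half of the blocks fail, the others contribute at least `(m/2) K (lam/2) |w|²`
    -- to the total energy, and `N ≤ 2 m K` turns this into `N (lam/8) |w|²`.
    by_contra hlt
    refine absurd he (not_lt.2 (le_fiedler hn _ fun w hw => ?_))
    rw [empiricalLaplacian_bilin]
    simp only [← sq]
    have hww : 0 ≤ w ⬝ᵥ w := Finset.sum_nonneg fun x _ => mul_self_nonneg _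
    have hK' : (0 : ℝ) < K := by exact_mod_cast hK
    have h1 : ∑ b, ∑ k, (pairVec (Φ e b k) ⬝ᵥ w) ^ 2 ≤ ∑ i, (pairVec (e i) ⬝ᵥ w) ^ 2 := by
      rw [← Fintype.sum_prod_type' (f := fun b k => (pairVec (Φ e b k) ⬝ᵥ w) ^ 2)]
      calc _ = ∑ i ∈ Finset.univ.map β, (pairVec (e i) ⬝ᵥ w) ^ 2 := by
            rw [Finset.sum_map]
        _ ≤ _ := Finset.sum_le_sum_of_subset_of_nonneg (Finset.subset_univ _)
            fun i _ _ => sq_nonneg _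
    have h2 : ∑ b ∈ Bᶜ, (K : ℝ) * (lam / 2 * (w ⬝ᵥ w))
        ≤ ∑ b, ∑ k, (pairVec (Φ e b k) ⬝ᵥ w) ^ 2 := by
      refine le_trans (Finset.sum_le_sum fun b hb => ?_)
        (Finset.sum_le_sum_of_subset_of_nonneg (Finset.subset_univ Bᶜ)
          fun b _ _ => Finset.sum_nonneg fun k _ => sq_nonneg _)
      have hb' : ¬ Sparse hn Q (Φ e b) := by simpa [hB] using hb
      unfold Sparse at hb'
      push Not at hb'
      have h3 := hb' w hw
      rw [one_div, ← div_eq_inv_mul, le_div_iff₀ hK', mul_comm] at h3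
      exact h3
    rw [Finset.sum_const, nsmul_eq_mul] at h2
    have h4 : (m : ℝ) ≤ 2 * (Bᶜ.card : ℝ) := by
      rw [Finset.card_compl, Fintype.card_fin]
      have : m ≤ 2 * (m - B.card) := by omega
      exact_mod_cast this
    have hm : 0 < m := by omega
    have hN0 : (0 : ℝ) < N := by
      have := Nat.mul_pos hm hK
      have : 0 < N := by omega
      exact_mod_cast this
    have hN' : (N : ℝ) ≤ 2 * (m * K) := by exact_mod_cast hN
    rw [one_div, ← div_eq_inv_mul, le_div_iff₀ hN0]
    calc lam / 8 * (w ⬝ᵥ w) * N ≤ lam / 8 * (w ⬝ᵥ w) * (2 * (m * K)) := by gcongr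
      _ ≤ lam / 8 * (w ⬝ᵥ w) * (2 * ((2 * (Bᶜ.card : ℝ)) * K)) := by gcongr
      _ = (Bᶜ.card : ℝ) * (K * (lam / 2 * (w ⬝ᵥ w))) := by ring
      _ ≤ _ := h2.trans h1
  have hbad : ∀ B ∈ (Finset.univ : Finset (Finset (Fin m))).filter (fun B => m ≤ 2 * B.card),
      (pairLaw Q (Fin N)).real (Φ ⁻¹' bad B) ≤ (1 / 4) ^ m := by
    intro B hB
    have hmap := map_blocks Q β
    have h1 : (pairLaw Q (Fin N)).real (Φ ⁻¹' bad B)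
        = ∏ b, (pairLaw Q (Fin K)).real (if b ∈ B then {e | Sparse hn Q e} else Set.univ) := by
      rw [← map_measureReal_apply (measurable_of_finite Φ) (Set.toFinite _).measurableSet, hmap,
        measureReal_def, Measure.pi_pi, ENNReal.toReal_prod]
      rfl
    have h2 : ∀ b, (pairLaw Q (Fin K)).real (if b ∈ B then {e | Sparse hn Q e} else Set.univ)
        ≤ if b ∈ B then 1 / 16 else 1 := by
      intro b
      split_ifs
      · exact measure_sparse_le hn Q hpos hK hKn
      · simp
    rw [h1]
    calc _ ≤ ∏ b, if b ∈ B then (1 / 16 : ℝ) else 1 :=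
          Finset.prod_le_prod (fun b _ => measureReal_nonneg) fun b _ => h2 b
      _ = (1 / 16) ^ B.card := by
          rw [Finset.prod_ite_mem, Finset.univ_inter, Finset.prod_const]
      -- At least half of the blocks lie in `B`, so `(1/16)^|B| ≤ (1/4)^m`; against the `2^m`
      -- choices of `B` the total is `(1/2)^m`.
      _ = (1 / 4) ^ (2 * B.card) := by rw [pow_mul]; norm_num
      _ ≤ _ := pow_le_pow_of_le_one (by norm_num) (by norm_num) (Finset.mem_filter.1 hB).2
  calc _ ≤ _ := measureReal_mono hsub (measure_ne_top _ _)
    _ ≤ ∑ B ∈ (Finset.univ : Finset (Finset (Fin m))).filter (fun B => m ≤ 2 * B.card),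
        (pairLaw Q (Fin N)).real (Φ ⁻¹' bad B) := measureReal_biUnion_finset_le _ _
    _ ≤ ∑ _B : Finset (Fin m), ((1 / 4) ^ m : ℝ) :=
        (Finset.sum_le_sum hbad).trans
          (Finset.sum_le_sum_of_subset_of_nonneg (Finset.subset_univ _) fun _ _ _ => by positivity)
    _ = _ := by
        rw [Finset.sum_const, Finset.card_univ, Fintype.card_finset, Fintype.card_fin,
          nsmul_eq_mul]
        push_cast
        rw [← mul_pow]; norm_num

/-! ### The law of the sample -/

lemma exampleLaw_apply {n : ℕ} (Q : PMF (Pair n)) (z : EuclideanSpace ℝ (Fin n)) (p : Pair n)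
    (q : Bool) : (exampleLaw Q z (p, q)).toReal = (Q p).toReal * bitProb z p q := by
  have h1 : exampleLaw Q z (p, q) = Q p * bitLaw z p.1.1 p.1.2 q := by
    unfold exampleLaw
    rw [PMF.bind_apply, tsum_eq_single p]
    · congr 1
      rw [PMF.map_apply, tsum_eq_single q]
      · simp
      · intro b hb; simp [hb.symm]
    · intro p' hp'
      rw [PMF.map_apply, ENNReal.tsum_eq_zero.2, mul_zero]
      intro b
      simp [hp'.symm]
  rw [h1, ENNReal.toReal_mul]
  congr 1
  unfold bitLaw
  rw [PMF.ofFintype_apply, ENNReal.toReal_ofReal (by split_ifs <;> exact winProb_nonneg _ _ _)]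
  rfl

instance {n : ℕ} (Q : PMF (Pair n)) (z : EuclideanSpace ℝ (Fin n)) (N : ℕ) :
    IsProbabilityMeasure (sampleLaw Q z N) := by unfold sampleLaw; infer_instance

open Classical in
-- Disintegration of the sample into the compared pairs and, given these, independent bits; it
-- carries the bound for fixed pairs over to the sample law.
lemma sampleLaw_real {n N : ℕ} (Q : PMF (Pair n)) (z : EuclideanSpace ℝ (Fin n))
    (A : Set (Fin N → Example n)) :
    (sampleLaw Q z N).real A = ∑ e : Fin N → Pair n, (∏ i, (Q (e i)).toReal) *
      ∑ q : Fin N → Bool with (fun i => (e i, q i)) ∈ A, ∏ i, bitProb z (e i) (q i) := by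
  have h1 : (sampleLaw Q z N).real A = ∑ s, if s ∈ A then ∏ i, (exampleLaw Q z (s i)).toReal
      else 0 := by
    rw [← Finset.sum_filter]
    have : A = ((Finset.univ.filter (· ∈ A) : Finset (Fin N → Example n)) : Set _) := by
      ext; simp
    conv_lhs => rw [this]
    rw [← sum_measureReal_singleton]
    refine Finset.sum_congr rfl fun s _ => ?_
    unfold sampleLaw
    rw [measureReal_def, Measure.pi_singleton, ENNReal.toReal_prod]
    refine Finset.prod_congr rfl fun i _ => ?_
    rw [PMF.toMeasure_apply_singleton _ _ (measurableSet_singleton _)]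
  rw [h1, ← (Equiv.arrowProdEquivProdArrow (Fin N) (fun _ => Pair n) (fun _ => Bool)).symm.sum_comp,
    Fintype.sum_prod_type]
  refine Finset.sum_congr rfl fun e _ => ?_
  rw [Finset.sum_filter, Finset.mul_sum]
  refine Finset.sum_congr rfl fun q _ => ?_
  rw [mul_ite, mul_zero, ← Finset.prod_mul_distrib]
  change (if (fun i => (e i, q i)) ∈ A then ∏ i, (exampleLaw Q z (e i, q i)).toReal else 0) = _
  simp only [exampleLaw_apply]

open Classical in
lemma pairLaw_real {n N : ℕ} (Q : PMF (Pair n)) (B : Set (Fin N → Pair n)) :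
    (pairLaw Q (Fin N)).real B = ∑ e : Fin N → Pair n with e ∈ B, ∏ i, (Q (e i)).toReal := by
  have : B = ((Finset.univ.filter (· ∈ B) : Finset (Fin N → Pair n)) : Set _) := by
    ext; simp
  conv_lhs => rw [this]
  rw [← sum_measureReal_singleton]
  refine Finset.sum_congr rfl fun s _ => ?_
  rw [measureReal_def, Measure.pi_singleton, ENNReal.toReal_prod]
  refine Finset.prod_congr rfl fun i _ => ?_
  rw [PMF.toMeasure_apply_singleton _ _ (measurableSet_singleton _)]

lemma sum_prod_bitProb {n N : ℕ} (z : EuclideanSpace ℝ (Fin n)) (e : Fin N → Pair n) :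
    ∑ q : Fin N → Bool, ∏ i, bitProb z (e i) (q i) = 1 := by
  rw [sum_prod_pi fun i a => bitProb z (e i) a]
  simp only [sum_bitProb, Finset.prod_const_one]

lemma adj_of_mem_support {n : ℕ} {Q : PMF (Pair n)} {p : Pair n} (hp : p ∈ Q.support) :
    (comparisonGraph Q).Adj p.1.1 p.1.2 := by
  change 0 < pairProb Q p.1.1 p.1.2
  simp only [pairProb, p.2, dif_pos]
  exact ENNReal.toReal_pos ((PMF.mem_support_iff _ _).1 hp) (Q.apply_ne_top _)

section good

variable {n N : ℕ} {φ ε δ : ℝ} {Q : PMF (Pair n)} {z : EuclideanSpace ℝ (Fin n)}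

open Classical in
lemma sum_not_good_le (hn : 2 ≤ n) (hφ : 1 < φ) (hQ : (comparisonGraph Q).Connected)
    (hz : z ∈ paramSet (comparisonGraph Q) φ) {e : Fin N → Pair n} (he : ∀ i, e i ∈ Q.support)
    (hpos : 0 < fiedler hn (empiricalLaplacian_isHermitian e)) (hε : 0 < ε)
    (hδ : 0 < δ) (hδ' : δ ≤ 1 / 2)
    (hN : sampleConst φ * ((n : ℝ) / (fiedler hn (empiricalLaplacian_isHermitian e) * ε ^ 2)
      * Real.log (1 / δ)) ≤ N) :
    ∑ q : Fin N → Bool with ¬ GoodSample mleProgram ((timePoly φ).eval N) (comparisonGraph Q) φ z ε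
      (fun i => (e i, q i)), ∏ i, bitProb z (e i) (q i) ≤ δ := by
  have hadj : ∀ i, (comparisonGraph Q).Adj (e i).1.1 (e i).1.2 :=
    fun i => adj_of_mem_support (he i)
  refine le_trans (Finset.sum_le_sum_of_subset_of_nonneg ?_ ?_)
    (sum_bad_le hn hφ hz e hadj hpos hε hδ hδ' hN)
  swap
  · exact fun q _ _ => Finset.prod_nonneg fun i _ => bitProb_nonneg _ _ _
  intro q hq
  rw [Finset.mem_filter] at hq ⊢
  refine ⟨Finset.mem_univ _, fun hclose => hq.2 ⟨fun w hw => ?_, ?_⟩⟩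
  · refine hclose w hw.1 ((hw.2 z hz).trans ?_)
    have : (0 : ℝ) ≤ 1 / N := by positivity
    linarith
  · obtain ⟨w, hw, hout, hle⟩ := mleProgram_spec (s := fun i => (e i, q i)) hn hQ hφ hadj
      (le_of_fiedler_pos hn e hpos)
    exact ⟨w, hout, hclose w hw (hle z hz)⟩

/-- Conditioning on the pairs divides by their probability `c`, which is positive since they lie in
the support and is also a factor of the probability of the bad event. -/
lemma cond_good (hn : 2 ≤ n) (hφ : 1 < φ) (hQ : (comparisonGraph Q).Connected)
    (hz : z ∈ paramSet (comparisonGraph Q) φ) {e : Fin N → Pair n} (he : ∀ i, e i ∈ Q.support)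
    (hpos : 0 < fiedler hn (empiricalLaplacian_isHermitian e)) (hε : 0 < ε)
    (hδ : 0 < δ) (hδ' : δ ≤ 1 / 2)
    (hN : sampleConst φ * ((n : ℝ) / (fiedler hn (empiricalLaplacian_isHermitian e) * ε ^ 2)
      * Real.log (1 / δ)) ≤ N) :
    1 - δ ≤ (ProbabilityTheory.cond (sampleLaw Q z N) {s | ∀ i, (s i).1 = e i}).real
      {s | GoodSample mleProgram ((timePoly φ).eval N) (comparisonGraph Q) φ z ε s} := by
  classical
  set S : Set (Fin N → Example n) := {s | ∀ i, (s i).1 = e i} with hS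
  set A : Set (Fin N → Example n) :=
    {s | GoodSample mleProgram ((timePoly φ).eval N) (comparisonGraph Q) φ z ε s} with hA
  set c := ∏ i, (Q (e i)).toReal with hc
  have hc0 : 0 < c := Finset.prod_pos fun i _ =>
    ENNReal.toReal_pos ((PMF.mem_support_iff _ _).1 (he i)) (Q.apply_ne_top _)
  have hmem : ∀ (e' : Fin N → Pair n) (q : Fin N → Bool), (fun i => (e' i, q i)) ∈ S ↔ e' = e :=
    fun e' q => by simp [hS, funext_iff]
  have hSreal : (sampleLaw Q z N).real S = c := by
    rw [sampleLaw_real, Finset.sum_eq_single e]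
    · simp only [hmem, Finset.filter_true]
      rw [sum_prod_bitProb, mul_one]
    · intro e' _ hne
      simp [hmem, hne]
    · simp
  have hbad : (sampleLaw Q z N).real (S ∩ Aᶜ) ≤ c * δ := by
    rw [sampleLaw_real, Finset.sum_eq_single e]
    · refine mul_le_mul_of_nonneg_left ?_ hc0.le
      refine le_trans (le_of_eq (Finset.sum_congr ?_ fun _ _ => rfl))
        (sum_not_good_le hn hφ hQ hz he hpos hε hδ hδ' hN)
      ext q
      simp [hmem, hA]
    · intro e' _ hne
      simp [hmem, hne]
    · simp
  have hS0 : sampleLaw Q z N S ≠ 0 := by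
    intro h0
    rw [measureReal_def, h0] at hSreal
    simp at hSreal
    exact hc0.ne' hSreal.symm
  have := ProbabilityTheory.cond_isProbabilityMeasure hS0
  have hcompl : (ProbabilityTheory.cond (sampleLaw Q z N) S).real Aᶜ ≤ δ := by
    rw [measureReal_def, ProbabilityTheory.cond_apply (Set.toFinite S).measurableSet,
      ENNReal.toReal_mul, ENNReal.toReal_inv, ← measureReal_def, ← measureReal_def, hSreal,
      inv_mul_le_iff₀ hc0]
    exact hbad
  rw [probReal_compl_eq_one_sub (Set.toFinite A).measurableSet] at hcompl
  linarith

/-- The test vector `e_0 - e_1` has squared norm 2, and by Cauchy–Schwarz its energy is at most 4.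
-/
lemma fiedler_laplacian_le_two (hn : 2 ≤ n) (Q : PMF (Pair n))
    (hpos : 0 < fiedler hn (laplacian_isHermitian Q)) :
    fiedler hn (laplacian_isHermitian Q) ≤ 2 := by
  let p : Pair n := ⟨(⟨0, by omega⟩, ⟨1, by omega⟩), by simp⟩
  have h := fiedler_mul_le (hn := hn) (laplacian_isHermitian Q) (laplacian_mulVec_one Q) hpos
    (sum_pairVec p)
  rw [laplacian_bilin, pairVec_norm] at h
  have hle : ∑ p', (Q p').toReal * ((pairVec p' ⬝ᵥ pairVec p) * (pairVec p' ⬝ᵥ pairVec p))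
      ≤ ∑ p', (Q p').toReal * 4 := by
    refine Finset.sum_le_sum fun p' _ => mul_le_mul_of_nonneg_left ?_ ENNReal.toReal_nonneg
    have h1 : (pairVec p' ⬝ᵥ pairVec p) ^ 2 ≤ (pairVec p' ⬝ᵥ pairVec p') *
        (pairVec p ⬝ᵥ pairVec p) := by
      simp only [dotProduct, ← sq]
      exact Finset.sum_mul_sq_le_sq_mul_sq _ _ _
    rw [pairVec_norm, pairVec_norm] at h1
    linarith
  rw [← Finset.sum_mul, sum_toReal_eq_one] at hle
  linarith

/-- The constant for the sample size. -/
def mainConst (φ : ℝ) : ℝ := 16 * sampleConst φ + 645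

lemma sampleConst_pos (hφ : 1 < φ) : 0 < sampleConst φ := by
  unfold sampleConst; nlinarith

/-- The sample can be divided into sufficiently many blocks of sufficient size. -/
lemma exists_blocks {lam : ℝ} (hn : 2 ≤ n) (hlam : 0 < lam) (hlam2 : lam ≤ 2) (hδ : 0 < δ)
    (hδ' : δ ≤ 1 / 2) (hN : 645 * ((n : ℝ) / lam * Real.log (1 / δ)) ≤ N) :
    ∃ m K : ℕ, 0 < K ∧ 128 * (n : ℝ) ≤ K * lam ∧ m * K ≤ N ∧ N ≤ 2 * (m * K) ∧
      (1 / 2 : ℝ) ^ m ≤ δ / 2 := by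
  have hL2 : Real.log 2 ≤ Real.log (1 / δ) :=
    Real.log_le_log (by norm_num) (by rw [le_div_iff₀ hδ]; linarith)
  have h2 := Real.log_two_gt_d9
  set L := Real.log (1 / δ) with hL
  have hn' : (2 : ℝ) ≤ n := by exact_mod_cast hn
  have hl2 : 0 < Real.log 2 := by linarith
  have hL0 : 0 < L := by linarith
  -- This choice makes `2^(-m) ≤ δ/2`. As `log 2 ≤ L`, it also gives `m ≤ 3L / log 2 ≤ 5L`.
  obtain ⟨m, hm1, hm2⟩ : ∃ m : ℕ, (L + Real.log 2) / Real.log 2 ≤ m ∧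
      (m : ℝ) ≤ (L + Real.log 2) / Real.log 2 + 1 :=
    ⟨_, Nat.le_ceil _, (Nat.ceil_lt_add_one (by positivity)).le⟩
  have hm5 : (m : ℝ) ≤ 5 * L := by
    refine hm2.trans ?_
    rw [div_add_one hl2.ne', div_le_iff₀ hl2]
    nlinarith
  have hm0 : 0 < m := by
    have : (0 : ℝ) < m := lt_of_lt_of_le (by positivity) hm1
    exact_mod_cast this
  have hm0' : (0 : ℝ) < m := by exact_mod_cast hm0
  have hnl : 1 ≤ (n : ℝ) / lam := by rw [le_div_iff₀ hlam]; linarith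
  -- The constant is `645 = 129 * 5`: the block size is `N / m` rounded down, and the loss of less
  -- than 1 is covered by `n / lam ≥ 1`, which leaves 128.
  have hNm : 129 * ((n : ℝ) / lam) * m ≤ N := by
    calc 129 * ((n : ℝ) / lam) * m ≤ 129 * ((n : ℝ) / lam) * (5 * L) := by gcongr
      _ = 645 * ((n : ℝ) / lam * L) := by ring
      _ ≤ _ := hN
  have hdiv : N < m * (N / m + 1) := Nat.lt_mul_div_succ N hm0
  have hdiv' : (N : ℝ) < m * ((N / m : ℕ) + 1) := by exact_mod_cast hdiv
  have hK : 128 * ((n : ℝ) / lam) ≤ (N / m : ℕ) := by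
    have : 129 * ((n : ℝ) / lam) * m < ((N / m : ℕ) + 1) * m := by linarith
    have := lt_of_mul_lt_mul_right this hm0'.le
    linarith
  have hK0 : 0 < N / m := by
    have : (0 : ℝ) < (N / m : ℕ) := lt_of_lt_of_le (by positivity) hK
    exact_mod_cast this
  refine ⟨m, N / m, hK0, ?_, Nat.mul_div_le N m, ?_, ?_⟩
  · calc 128 * (n : ℝ) = 128 * ((n : ℝ) / lam) * lam := by field_simp
      _ ≤ _ := by gcongr
  · have : m * 1 ≤ m * (N / m) := Nat.mul_le_mul_left m hK0
    rw [mul_add] at hdiv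
    omega
  · have h1 : L + Real.log 2 ≤ m * Real.log 2 := by rwa [div_le_iff₀ hl2] at hm1
    have h3 : Real.log (2 / δ) ≤ Real.log (2 ^ m) := by
      rw [Real.log_pow]
      refine le_trans (le_of_eq ?_) h1
      rw [hL, ← Real.log_mul (by positivity) (by norm_num)]
      congr 1; ring
    have h4 := (Real.log_le_log_iff (by positivity) (by positivity)).1 h3
    rw [div_pow, one_pow, div_le_iff₀ (by positivity)]
    rw [div_le_iff₀ hδ] at h4
    linarith

/-- Half of `δ` is spent on samples of pairs with a small empirical eigenvalue and half on the bits.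
The factor 16 in `mainConst` comes from `λ(L) ≥ λ(Q)/8` and `log(2/δ) ≤ 2 log(1/δ)`; `ε ≤ 1` ensures
that the sample is also large enough for the concentration of the Laplacian. -/
lemma prob_good (hn : 2 ≤ n) (hφ : 1 < φ) (hQ : (comparisonGraph Q).Connected)
    (hz : z ∈ paramSet (comparisonGraph Q) φ) (hε : 0 < ε) (hε1 : ε ≤ 1)
    (hδ : 0 < δ) (hδ' : δ ≤ 1 / 2)
    (hN : mainConst φ * ((n : ℝ) / (fiedler hn (laplacian_isHermitian Q) * ε ^ 2)
      * Real.log (1 / δ)) ≤ N) :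
    1 - δ ≤ (sampleLaw Q z N).real
      {s | GoodSample mleProgram ((timePoly φ).eval N) (comparisonGraph Q) φ z ε s} := by
  classical
  have hpos := fiedler_laplacian_pos hn Q hQ
  have hle2 := fiedler_laplacian_le_two hn Q hpos
  set lam := fiedler hn (laplacian_isHermitian Q) with hlam
  have hC := sampleConst_pos hφ
  have hlog : 0 < Real.log (1 / δ) := Real.log_pos (by rw [lt_div_iff₀ hδ]; linarith)
  have hn0 : (0 : ℝ) < n := by
    have : 0 < n := by omega
    exact_mod_cast this
  have hX : 0 < (n : ℝ) / (lam * ε ^ 2) * Real.log (1 / δ) := by positivity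
  have hN1 : 645 * ((n : ℝ) / lam * Real.log (1 / δ)) ≤ N := by
    have h1 : (n : ℝ) / lam ≤ n / (lam * ε ^ 2) := by
      refine div_le_div_of_nonneg_left hn0.le (by positivity) ?_
      exact mul_le_of_le_one_right hpos.le (pow_le_one₀ hε.le hε1)
    refine le_trans ?_ hN
    unfold mainConst
    calc 645 * ((n : ℝ) / lam * Real.log (1 / δ))
        ≤ 645 * ((n : ℝ) / (lam * ε ^ 2) * Real.log (1 / δ)) := by gcongr
      _ ≤ _ := by
        rw [add_mul]
        have : 0 ≤ 16 * sampleConst φ * ((n : ℝ) / (lam * ε ^ 2) * Real.log (1 / δ)) := by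
          positivity
        linarith
  obtain ⟨m, K, hK, hKn, hmK, hNmK, hm⟩ := exists_blocks hn hpos hle2 hδ hδ' hN1
  set B : Set (Fin N → Pair n) := {e | fiedler hn (empiricalLaplacian_isHermitian e) < lam / 8}
    with hB
  have hBle : (pairLaw Q (Fin N)).real B ≤ δ / 2 :=
    (measure_fiedler_lt_le hn Q hpos hK hKn hmK hNmK).trans hm
  set A : Set (Fin N → Example n) :=
    {s | GoodSample mleProgram ((timePoly φ).eval N) (comparisonGraph Q) φ z ε s} with hA
  set W : (Fin N → Pair n) → ℝ := fun e => ∏ i, (Q (e i)).toReal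
  have hW : ∀ e, 0 ≤ W e := fun e => Finset.prod_nonneg fun i _ => ENNReal.toReal_nonneg
  have hWsum : ∑ e, W e = 1 := by
    have := sum_prod_pi (N := N) fun _ (p : Pair n) => (Q p).toReal
    rw [this]
    simp only [sum_toReal_eq_one, Finset.prod_const_one]
  have hbit : ∀ (e : Fin N → Pair n) (q : Fin N → Bool), 0 ≤ ∏ i, bitProb z (e i) (q i) :=
    fun e q => Finset.prod_nonneg fun i _ => bitProb_nonneg _ _ _
  have hterm : ∀ e, W e * ∑ q : Fin N → Bool with (fun i => (e i, q i)) ∈ Aᶜ,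
      ∏ i, bitProb z (e i) (q i) ≤ (if e ∈ B then W e else 0) + W e * (δ / 2) := by
    intro e
    by_cases heB : e ∈ B
    · rw [if_pos heB]
      have h1 : ∑ q : Fin N → Bool with (fun i => (e i, q i)) ∈ Aᶜ,
          ∏ i, bitProb z (e i) (q i) ≤ 1 := by
        rw [← sum_prod_bitProb z e]
        exact Finset.sum_le_sum_of_subset_of_nonneg (Finset.filter_subset _ _)
          fun q _ _ => hbit e q
      have h2 := mul_le_mul_of_nonneg_left h1 (hW e)
      have h3 : 0 ≤ W e * (δ / 2) := mul_nonneg (hW e) (by linarith)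
      linarith
    · rw [if_neg heB, zero_add]
      by_cases hsupp : ∀ i, e i ∈ Q.support
      · refine mul_le_mul_of_nonneg_left ?_ (hW e)
        have hfe : lam / 8 ≤ fiedler hn (empiricalLaplacian_isHermitian e) := by
          simpa [hB] using heB
        have hfpos : 0 < fiedler hn (empiricalLaplacian_isHermitian e) := by linarith
        have hNe : sampleConst φ * ((n : ℝ) /
            (fiedler hn (empiricalLaplacian_isHermitian e) * ε ^ 2)
            * Real.log (1 / (δ / 2))) ≤ N := by
          refine le_trans ?_ hN
          have h1 : (n : ℝ) / (fiedler hn (empiricalLaplacian_isHermitian e) * ε ^ 2)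
              ≤ 8 * (n / (lam * ε ^ 2)) := by
            calc _ ≤ (n : ℝ) / (lam / 8 * ε ^ 2) :=
                  div_le_div_of_nonneg_left hn0.le (by positivity) (by gcongr)
              _ = _ := by field_simp
          have h2 : Real.log (1 / (δ / 2)) ≤ 2 * Real.log (1 / δ) := by
            rw [two_mul, ← Real.log_mul (by positivity) (by positivity)]
            refine Real.log_le_log (by positivity) ?_
            rw [one_div_div, one_div_mul_one_div, div_le_div_iff₀ hδ (by positivity)]
            nlinarith
          have h0 : 0 ≤ Real.log (1 / (δ / 2)) :=
            Real.log_nonneg (by rw [le_div_iff₀ (by linarith)]; linarith)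
          calc _ ≤ sampleConst φ * (8 * (n / (lam * ε ^ 2)) * (2 * Real.log (1 / δ))) := by
                gcongr
            _ = 16 * sampleConst φ * ((n : ℝ) / (lam * ε ^ 2) * Real.log (1 / δ)) := by ring
            _ ≤ _ := by
              unfold mainConst
              gcongr
              linarith
        refine le_trans (le_of_eq (Finset.sum_congr ?_ fun _ _ => rfl))
          (sum_not_good_le hn hφ hQ hz hsupp hfpos hε (by linarith) (by linarith) hNe)
        ext q
        simp [hA]
      -- Sequences with a pair outside the support may violate the constraints, but they have weight
      -- 0.
      · push Not at hsupp
        obtain ⟨i, hi⟩ := hsupp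
        have hWe : W e = 0 := by
          refine Finset.prod_eq_zero (Finset.mem_univ i) ?_
          have : Q (e i) = 0 := by
            by_contra h
            exact hi ((PMF.mem_support_iff _ _).2 h)
          rw [this, ENNReal.toReal_zero]
        rw [hWe]; simp
  have hbad : (sampleLaw Q z N).real Aᶜ ≤ δ := by
    rw [sampleLaw_real]
    refine le_trans (Finset.sum_le_sum fun e _ => ?_)
      ((Finset.sum_le_sum fun e _ => hterm e).trans ?_)
    · exact le_of_eq (by congr!)
    calc ∑ e, ((if e ∈ B then W e else 0) + W e * (δ / 2))
        = (pairLaw Q (Fin N)).real B + δ / 2 := by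
          rw [Finset.sum_add_distrib, ← Finset.sum_mul, hWsum, one_mul, pairLaw_real,
            Finset.sum_filter]
      _ ≤ _ := by linarith
  rw [probReal_compl_eq_one_sub (Set.toFinite A).measurableSet] at hbad
  linarith

end good

end BTL

end

theorem mainTheorem6 :
    ∃ p : BTL.Program, ∀ φ : ℝ, 1 < φ → ∃ C : ℝ, 0 < C ∧ ∃ T : Polynomial ℕ,
      ∀ (n : ℕ) (hn : 2 ≤ n) (Q : PMF (BTL.Pair n)), (BTL.comparisonGraph Q).Connected →
        -- the program approximately computes the constrained maximum likelihood estimator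
        (∀ (N : ℕ) (s : Fin N → BTL.Example n), (∀ i, (s i).1 ∈ Q.support) → n ≤ N + 1 →
          (∃ w, BTL.IsConstrainedMLE (BTL.comparisonGraph Q) φ s w) ∧
          ∃ w ∈ BTL.paramSet (BTL.comparisonGraph Q) φ,
            BTL.OutputsWithin p (BTL.inputStore (BTL.comparisonGraph Q) φ s) (T.eval N) w ∧
            ∀ v ∈ BTL.paramSet (BTL.comparisonGraph Q) φ,
              BTL.negLogLik s w ≤ BTL.negLogLik s v + 1 / (N : ℝ)) ∧
        ∀ z ∈ BTL.paramSet (BTL.comparisonGraph Q) φ,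
          ∀ (ε δ : ℝ), 0 < ε → 0 < δ → δ ≤ 1 / 2 → ∀ N : ℕ,
            -- the sample size in terms of the empirical Laplacian, given the compared pairs
            (∀ e : Fin N → BTL.Pair n, (∀ i, e i ∈ Q.support) →
              0 < BTL.fiedler hn (BTL.empiricalLaplacian_isHermitian e) →
              C * ((n : ℝ) / (BTL.fiedler hn (BTL.empiricalLaplacian_isHermitian e) * ε ^ 2)
                * Real.log (1 / δ)) ≤ (N : ℝ) →
              1 - δ ≤ (ProbabilityTheory.cond (BTL.sampleLaw Q z N)
                  {s | ∀ i, (s i).1 = e i}).real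
                {s | BTL.GoodSample p (T.eval N) (BTL.comparisonGraph Q) φ z ε s}) ∧
            -- the sample size in terms of the Laplacian of the pair distribution
            (ε ≤ 1 →
              C * ((n : ℝ) / (BTL.fiedler hn (BTL.laplacian_isHermitian Q) * ε ^ 2)
                * Real.log (1 / δ)) ≤ (N : ℝ) →
              1 - δ ≤ (BTL.sampleLaw Q z N).real
                {s | BTL.GoodSample p (T.eval N) (BTL.comparisonGraph Q) φ z ε s}) := by
  refine ⟨BTL.mleProgram, fun φ hφ => ?_⟩
  have hC := BTL.sampleConst_pos hφ
  refine ⟨BTL.mainConst φ, by unfold BTL.mainConst; linarith, BTL.timePoly φ,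
    fun n hn Q hQ => ⟨fun N s hs hN => ⟨BTL.exists_isConstrainedMLE hQ hφ s,
      BTL.mleProgram_spec hn hQ hφ (fun i => BTL.adj_of_mem_support (hs i)) hN⟩,
      fun z hz ε δ hε hδ hδ' N => ⟨fun e he hpos hN => ?_,
        fun hε1 hN => BTL.prob_good hn hφ hQ hz hε hε1 hδ hδ' hN⟩⟩⟩
  -- For given pairs the smaller constant `sampleConst φ` already suffices.
  refine BTL.cond_good hn hφ hQ hz he hpos hε hδ hδ' (le_trans ?_ hN)
  have hlog : 0 ≤ Real.log (1 / δ) :=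
    Real.log_nonneg (by rw [le_div_iff₀ hδ]; linarith)
  refine mul_le_mul_of_nonneg_right (by unfold BTL.mainConst; linarith) (by positivity)
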